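/- **Proposition 4.4.** Let $c\neq 0$ be a real number and let $M_2(c)$ denote $\mathbb{C}P^2$ if $c>0$ and $\mathbb{C}H^2$ if $c<0$, with its standard Kähler metric $G$ of constant holomorphic sectional curvature $c$ and complex structure $J$. Let $M$ be a connected $C^\infty$ manifold of dimension $3$ without boundary, immersed by a $C^\infty$ immersion in $M_2(c)$ as an oriented real hypersurface with unit normal field $N$. Denote by $g$ the induced metric on $M$, by $\nabla$ its Levi-Civita connection, by $R(X,Y)Z=\nabla_X\nabla_YZ-\nabla_Y\nabla_XZ-\nabla_{[X,Y]}Z$ its curvature, by $\overline\nabla$ the Levi-Civita connection of $M_2(c)$, by $A$ the shape operator, $AX=-\overline\nabla_XN$, and put $\xi=-JN$, $\eta(X)=g(X,\xi)$, $lX=R(X,\xi)\xi$ (the structure Jacobi operator) and $(X\wedge Y)Z=g(Y,Z)X-g(Z,X)Y$. Suppose that $l$ is pseudo-parallel, that is, there is a function $L:M\to\mathbb{R}$ such that $$R(X,Y)\,lZ-l\big(R(X,Y)Z\big)=L\,\big\{(X\wedge Y)\,lZ-l\big((X\wedge Y)Z\big)\big\}$$ for all smooth vector fields $X,Y,Z$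 on $M$. Then $M$ is a Hopf hypersurface: $A\xi=\alpha\xi$ on all of $M$, where $\alpha=\eta(A\xi)$. -/

import Mathlib

open scoped Manifold ContDiff Matrix

noncomputable section

/-! ### The complex projective plane and the complex hyperbolic plane

A point of the plane is a complex line `ℂ v` in `ℂ³`, encoded by the orthogonal projection onto it
with respect to the Hermitian form `h(v, w) = v̄₀ w₀ + v̄₁ w₁ + s v̄₂ w₂`, where `s = 1` if `c > 0`
(every line is taken) and `s = -1` if `c < 0` (only the lines on which `h` is negative are taken).
This is the standard embedding of the plane as a submanifold of the real vector space of
`h`-self-adjoint endomorphisms of `ℂ³`. The metric is induced from the constant bilinear form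
`(2 / c) Re tr (X Y)`; it is the Fubini-Study metric (`c > 0`), respectively the Bergman metric
(`c < 0`), normalized to have constant holomorphic sectional curvature `c`. -/

namespace SpaceForm

/-- The vector space `ℂ³`. -/
abbrev C3 := EuclideanSpace ℂ (Fin 3)

/-- The complex linear endomorphisms of `ℂ³`; the product `X * Y` is composition. -/
abbrev EndC3 := C3 →L[ℂ] C3

/-- The sign `s` in the signature `(1, 1, s)`. -/
def sgn (c : ℝ) : ℝ := if 0 < c then 1 else -1

/-- The Hermitian form `h`, conjugate linear in the first variable. -/
def herm (c : ℝ) (v w : C3) : ℂ :=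
  star (v 0) * w 0 + star (v 1) * w 1 + (sgn c : ℂ) * (star (v 2) * w 2)

/-- The plane `M₂(c)`, which is `ℂP²` if `c > 0` and `ℂH²` if `c < 0`: the set of the
`h`-orthogonal projections `w ↦ (h(v, w) / h(v, v)) v` onto lines `ℂ v` with `s h(v, v) > 0`. -/
def plane (c : ℝ) : Set EndC3 :=
  {P | ∃ v : C3, 0 < sgn c * (herm c v v).re ∧ ∀ w, P w = (herm c v w / herm c v v) • v}

/-- The tangent space of the plane at `P`: the `h`-self-adjoint endomorphisms `X` with
`P X + X P = X` (the linearization of `P² = P`). -/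
def tangent (c : ℝ) (P : EndC3) : Set EndC3 :=
  {X | (∀ v w, herm c (X v) w = herm c v (X w)) ∧ P * X + X * P = X}

/-- The metric `G` on the tangent spaces of the plane. -/
def metric (c : ℝ) (X Y : EndC3) : ℝ :=
  2 / c * (LinearMap.trace ℂ C3 (X * Y : EndC3).toLinearMap).re

/-- The complex structure: under `T_{ℂv} = Hom(ℂv, (ℂv)^⊥)`, `X ↦ X P`, it is multiplication
by `i`. -/
def J (P X : EndC3) : EndC3 := Complex.I • (X * P - P * X)

/-- The orthogonal projection of an `h`-self-adjoint endomorphism to the tangent space at `P`. -/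
def tangentProj (P W : EndC3) : EndC3 := P * W + W * P - (2 : ℂ) • (P * W * P)

end SpaceForm

open SpaceForm

/-- An oriented real hypersurface immersed in `M₂(c)`: a smooth immersion `f` of a 3-manifold `M`
together with a smooth unit normal vector field `N` along `f`. -/
structure RealHypersurface (c : ℝ) (M : Type*) [TopologicalSpace M]
    [ChartedSpace (EuclideanSpace ℝ (Fin 3)) M] where
  /-- the immersion -/
  f : M → EndC3
  /-- the unit normal field -/
  N : M → EndC3
  f_mem : ∀ p, f p ∈ plane c
  f_smooth : ContMDiff (𝓡 3) 𝓘(ℝ, EndC3) ∞ f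
  f_immersion : ∀ p, Function.Injective (mvfderiv (𝓡 3) f p)
  N_smooth : ContMDiff (𝓡 3) 𝓘(ℝ, EndC3) ∞ N
  N_tangent : ∀ p, N p ∈ tangent c (f p)
  N_unit : ∀ p, metric c (N p) (N p) = 1
  N_normal : ∀ p (X : TangentSpace (𝓡 3) p), metric c (N p) (mvfderiv (𝓡 3) f p X) = 0

namespace RealHypersurface

variable {c : ℝ} {M : Type*} [TopologicalSpace M] [ChartedSpace (EuclideanSpace ℝ (Fin 3)) M]

/-- Vector fields on `M` (no regularity imposed). -/
abbrev Field (M : Type*) [TopologicalSpace M] [ChartedSpace (EuclideanSpace ℝ (Fin 3)) M] :=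
  (p : M) → TangentSpace (𝓡 3) p

/-- The vector field `X` is of class `C^∞` on the set `U`. -/
def SmoothOn [IsManifold (𝓡 3) ∞ M] (X : Field M) (U : Set M) : Prop :=
  ContMDiffOn (𝓡 3) (𝓡 3).tangent ∞ (fun p => (⟨p, X p⟩ : TangentBundle (𝓡 3) M)) U

variable (S : RealHypersurface c M)

/-- The differential `df_p` of the immersion, as an endomorphism of `ℂ³`. -/
def df (p : M) (X : TangentSpace (𝓡 3) p) : EndC3 := mvfderiv (𝓡 3) S.f p X

/-- The induced Riemannian metric `g` on `M`. -/
def g (p : M) (X Y : TangentSpace (𝓡 3) p) : ℝ := metric c (S.df p X) (S.df p Y)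

/-- The standard basis of the tangent space at `p`. -/
def basisVec (p : M) (i : Fin 3) : TangentSpace (𝓡 3) p :=
  (EuclideanSpace.single i (1 : ℝ) : EuclideanSpace ℝ (Fin 3))

/-- The Gram matrix of `g` in the standard basis. -/
def gram (p : M) : Matrix (Fin 3) (Fin 3) ℝ :=
  Matrix.of fun i j => S.g p (basisVec p i) (basisVec p j)

/-- The tangential component of an ambient vector `W` at `p`: the vector `T` of `T_p M` with
`g(T, Y) = G(W, df Y)` for all `Y`, computed with the inverse of the Gram matrix. -/
def tan (p : M) (W : EndC3) : TangentSpace (𝓡 3) p :=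
  ∑ i, ((S.gram p)⁻¹ *ᵥ fun j => metric c W (S.df p (basisVec p j))) i • basisVec p i

/-- The Levi-Civita connection of `M₂(c)` along `f`: the derivative of a vector field `V` along `f`
in the direction `X`, projected to the tangent space of `M₂(c)`. -/
def ambientNabla (p : M) (X : TangentSpace (𝓡 3) p) (V : M → EndC3) : EndC3 :=
  tangentProj (S.f p) (mvfderiv (𝓡 3) V p X)

/-- The Levi-Civita connection of `(M, g)`: `∇_X Y` is the tangential component of the ambient
covariant derivative of `Y`. -/
def nabla (X Y : Field M) : Field M :=
  fun p => S.tan p (S.ambientNabla p (X p) fun q => S.df q (Y q))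

/-- The Riemannian curvature `R(X,Y)Z = ∇_X ∇_Y Z - ∇_Y ∇_X Z - ∇_[X,Y] Z` of `M`. -/
def R (X Y Z : Field M) : Field M :=
  S.nabla X (S.nabla Y Z) - S.nabla Y (S.nabla X Z)
    - S.nabla (VectorField.mlieBracket (𝓡 3) X Y) Z

/-- The shape operator, `A X = - ∇̄_X N`. -/
def A (p : M) (X : TangentSpace (𝓡 3) p) : TangentSpace (𝓡 3) p :=
  S.tan p (-S.ambientNabla p X S.N)

/-- The structure vector field `ξ = -J N`. -/
def xi : Field M := fun p => S.tan p (-J (S.f p) (S.N p))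

/-- The 1-form `η = g(·, ξ)`. -/
def eta (p : M) (X : TangentSpace (𝓡 3) p) : ℝ := S.g p X (S.xi p)

/-- The structure Jacobi operator `l = R(·, ξ)ξ`. -/
def l (X : Field M) : Field M := S.R X S.xi S.xi

/-- The endomorphism `(X ∧ Y) Z = g(Y, Z) X - g(Z, X) Y`. -/
def wedge (X Y Z : Field M) : Field M :=
  fun p => S.g p (Y p) (Z p) • X p - S.g p (Z p) (X p) • Y p

/-- The structure Jacobi operator is pseudo-parallel: there is a function `L` on `M` with
`R(X,Y) lZ - l(R(X,Y)Z) = L {(X ∧ Y) lZ - l((X ∧ Y)Z)}` for all (locally defined) smooth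
vector fields `X`, `Y`, `Z`. -/
def PseudoParallelStructureJacobi [IsManifold (𝓡 3) ∞ M] : Prop :=
  ∃ L : M → ℝ, ∀ U : Set M, IsOpen U → ∀ X Y Z : Field M,
    SmoothOn X U → SmoothOn Y U → SmoothOn Z U → ∀ p ∈ U,
      S.R X Y (S.l Z) p - S.l (S.R X Y Z) p =
        L p • (S.wedge X Y (S.l Z) p - S.l (S.wedge X Y Z) p)

/-- `M` is a Hopf hypersurface: `ξ` is principal, i.e. `A ξ = α ξ` with `α = η(A ξ)`. -/
def IsHopf : Prop :=
  ∀ p, S.A p (S.xi p) = S.eta p (S.A p (S.xi p)) • S.xi p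

end RealHypersurface

end

/-! Let w = Aξ − αξ and let Ω be the open set where w ≠ 0. On Ω the fields e₀ = ξ, e₁ = U = w/|w|,
e₂ = JU form an orthonormal frame with Aξ = αξ + βU and β = |w| ≠ 0 (`exists_adaptedFrame`). Write
γ, δ, μ for g(AU,U), g(AU,JU), g(AJU,JU), put k = c/4 and κᵢ = g(∇_{eᵢ}U, JU). The claim is that Ω
is empty.

Pointwise algebra (`GaussAlgebra.PseudoParallel.shape`): the Gauss equation turns pseudo-parallelism
at a point into polynomial equations in A and L. Since β ≠ 0 and k ≠ 0, they force δ = 0, α ≠ 0 and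
one of two cases: αμ = 0, αγ = β², so that l is k times the identity on the complement of ξ; or αμ =
−k, αγ = β² − k, so that l = 0.

Differential equations (`AdaptedFrame.eq_empty`): the relations are differentiated along the frame
and compared with the Codazzi equations. In the first case this gives βk = 0 at once. In the second
case the JU-derivative of αγ − β² gives κ₀ = −4α, and all ξ- and U-derivatives of α and β are
multiples of κ₂. One Gauss equation then reads κ₂(β² + 2α² − 2k) = 0, and differentiating the second
factor along ξ shows κ₂ = 0. Now [U, ξ] annihilates α and β, which yields γ = −4α, that is β² + 4α²
= k. Its JU-derivative is 10βk = 0, a contradiction.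

The Gauss and Codazzi equations are derived from the model of the plane by rank one projections P.
Tangent vectors are off-diagonal for the splitting ℂv ⊕ v^⊥, the connection is the off-diagonal part
of the flat derivative, the curvature is the double commutator [[X,Y],Z] (`cov_cov_sub`), and the
rank one of P identifies it with the tensor of constant holomorphic curvature
(`Spans.bracket_eq_curvature`). -/

noncomputable section

open SpaceForm RealHypersurface

/-! ### Calculus along vector fields: charts, Lie brackets, product rules. -/

namespace RealHypersurface

variable {M : Type*} [TopologicalSpace M] [ChartedSpace (EuclideanSpace ℝ (Fin 3)) M]
variable {F G K : Type*} [NormedAddCommGroup F] [NormedSpace ℝ F] [NormedAddCommGroup G]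
  [NormedSpace ℝ G] [NormedAddCommGroup K] [NormedSpace ℝ K]

/-- The derivative of a vector-valued function along a vector field. -/
def deriv (X : Field M) (h : M → F) (p : M) : F := mvfderiv (𝓡 3) h p (X p)

/-- The function `h` is of class `C^∞` on the set `U`. -/
abbrev SmoothFun (h : M → F) (U : Set M) : Prop := ContMDiffOn (𝓡 3) 𝓘(ℝ, F) ∞ h U

lemma SmoothFun.mdiff {h : M → F} {U : Set M} (hh : SmoothFun h U) (hU : IsOpen U) {p : M}
    (hp : p ∈ U) : MDifferentiableAt (𝓡 3) 𝓘(ℝ, F) h p :=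
  ((hh p hp).contMDiffAt (hU.mem_nhds hp)).mdifferentiableAt (by simp)

/-- The chart is centred at `p` but the formula is needed at all nearby `q`, because it is
differentiated once more. -/
lemma mvfderiv_eq_fderiv_chart {h : M → F} {p q : M} [IsManifold (𝓡 3) ∞ M]
    (hq : q ∈ (extChartAt (𝓡 3) p).source)
    (hh : MDifferentiableAt (𝓡 3) 𝓘(ℝ, F) h q) (v : TangentSpace (𝓡 3) q) :
    mvfderiv (𝓡 3) h q v =
      fderiv ℝ (h ∘ (extChartAt (𝓡 3) p).symm) (extChartAt (𝓡 3) p q)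
        (mfderiv (𝓡 3) 𝓘(ℝ, EuclideanSpace ℝ (Fin 3)) (extChartAt (𝓡 3) p) q v) := by
  have h1 : h =ᶠ[nhds q] (h ∘ (extChartAt (𝓡 3) p).symm) ∘ (extChartAt (𝓡 3) p) := by
    filter_upwards [extChartAt_source_mem_nhds' hq] with x hx
    simp only [Function.comp_apply, (extChartAt (𝓡 3) p).left_inv hx]
  have hφ : MDifferentiableAt (𝓡 3) 𝓘(ℝ, EuclideanSpace ℝ (Fin 3)) (extChartAt (𝓡 3) p) q :=
    mdifferentiableAt_extChartAt (by simpa using hq)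
  have hs : MDifferentiableAt 𝓘(ℝ, EuclideanSpace ℝ (Fin 3)) 𝓘(ℝ, F)
      (h ∘ (extChartAt (𝓡 3) p).symm) (extChartAt (𝓡 3) p q) := by
    apply MDifferentiableAt.comp (I' := 𝓡 3)
    · rwa [(extChartAt (𝓡 3) p).left_inv hq]
    · have := mdifferentiableWithinAt_extChartAt_symm (I := 𝓡 3)
        ((extChartAt (𝓡 3) p).map_source hq)
      rwa [modelWithCornersSelf_coe, Set.range_id, mdifferentiableWithinAt_univ] at this
  have h2 : mfderiv (𝓡 3) 𝓘(ℝ, F) h q = _ := h1.mfderiv_eq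
  rw [mfderiv_comp _ hs hφ] at h2
  simp only [mvfderiv, ContinuousLinearMap.comp_apply]
  rw [h2, mfderiv_eq_fderiv]
  rfl

lemma mpullback_chart_apply [IsManifold (𝓡 3) ∞ M] (X : Field M) {p q : M}
    (hq : q ∈ (extChartAt (𝓡 3) p).source) :
    VectorField.mpullbackWithin 𝓘(ℝ, EuclideanSpace ℝ (Fin 3)) (𝓡 3) (extChartAt (𝓡 3) p).symm X
      (Set.range (𝓡 3)) (extChartAt (𝓡 3) p q) =
    mfderiv (𝓡 3) 𝓘(ℝ, EuclideanSpace ℝ (Fin 3)) (extChartAt (𝓡 3) p) q (X q) := by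
  have A : (extChartAt (𝓡 3) p).symm (extChartAt (𝓡 3) p q) = q :=
    (extChartAt (𝓡 3) p).left_inv hq
  have h1 : ContinuousLinearMap.IsInvertible (mfderivWithin 𝓘(ℝ, EuclideanSpace ℝ (Fin 3)) (𝓡 3)
      (extChartAt (𝓡 3) p).symm (Set.range (𝓡 3)) (extChartAt (𝓡 3) p q)) :=
    isInvertible_mfderivWithin_extChartAt_symm ((extChartAt (𝓡 3) p).map_source hq)
  have h2 := mfderivWithin_extChartAt_symm_comp_mfderiv_extChartAt' (I := 𝓡 3) hq
  rw [VectorField.mpullbackWithin_apply, h1.inverse_apply_eq]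
  have h3 := DFunLike.congr_fun h2 (X q)
  rw [A]
  exact h3.symm

variable [IsManifold (𝓡 3) ∞ M]

lemma SmoothFun.deriv {X : Field M} {h : M → F} {U : Set M} (hU : IsOpen U)
    (hX : SmoothOn X U) (hh : SmoothFun h U) : SmoothFun (deriv X h) U := by
  have h1 := hh.contMDiffOn_tangentMapWithin (m := ∞) (by simp) hU.uniqueMDiffOn
  have h2 := h1.comp hX (fun x hx => hx)
  have h3 := (contMDiff_snd_tangentBundle_modelSpace (n := ∞) F 𝓘(ℝ, F)).comp_contMDiffOn h2
  refine h3.congr fun x hx => ?_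
  exact (DFunLike.congr_fun (mfderivWithin_of_isOpen (I := 𝓡 3) (I' := 𝓘(ℝ, F)) (f := h) hU hx)
    (X x)).symm

/-- The second derivatives of a function commute up to the Lie bracket. -/
theorem deriv_mlieBracket {X Y : Field M} {h : M → F} {U : Set M} (hU : IsOpen U)
    (hX : SmoothOn X U) (hY : SmoothOn Y U) (hh : SmoothFun h U) {p : M} (hp : p ∈ U) :
    deriv (VectorField.mlieBracket (𝓡 3) X Y) h p =
      deriv X (deriv Y h) p - deriv Y (deriv X h) p := by
  set φ := extChartAt (𝓡 3) p with hφ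
  set h' := h ∘ φ.symm with hh'
  have hps : p ∈ φ.source := mem_extChartAt_source p
  -- In the chart the derivative along `Z` becomes y ↦ Dh'(y)(Z'(y)), with `Z'` the pulled back
  -- field. It holds near `φ p`, so it may be differentiated again.
  have key : ∀ {Z : Field M}, SmoothOn Z U → ∃ Z' : EuclideanSpace ℝ (Fin 3) → EuclideanSpace ℝ (Fin 3),
      Z' = VectorField.mpullbackWithin 𝓘(ℝ, EuclideanSpace ℝ (Fin 3)) (𝓡 3) φ.symm Z
        (Set.range (𝓡 3)) ∧ DifferentiableAt ℝ Z' (φ p) ∧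
      (deriv Z h) ∘ φ.symm =ᶠ[nhds (φ p)] fun y => fderiv ℝ h' y (Z' y) := by
    intro Z hZ
    refine ⟨_, rfl, ?_, ?_⟩
    · have h1 : MDifferentiableWithinAt (𝓡 3) (𝓡 3).tangent
          (fun x => (Z x : TangentBundle (𝓡 3) M)) Set.univ p :=
        (((hZ p hp).contMDiffAt (hU.mem_nhds hp)).mdifferentiableAt (by simp)).mdifferentiableWithinAt
      have h2 := h1.differentiableWithinAt_mpullbackWithin_vectorField
      refine h2.differentiableAt ?_
      rw [modelWithCornersSelf_coe, Set.range_id, Set.preimage_univ, Set.inter_univ]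
      exact Filter.univ_mem
    · have h1 : ∀ᶠ y in nhds (φ p), y ∈ φ.target ∩ φ.symm ⁻¹' U := by
        refine Filter.inter_mem (extChartAt_target_mem_nhds p) ?_
        refine (continuousAt_extChartAt_symm p).preimage_mem_nhds (hU.mem_nhds ?_)
        rwa [← hφ, φ.left_inv hps]
      filter_upwards [h1] with y hy
      have h3 := φ.map_target hy.1
      have h4 := mpullback_chart_apply Z h3
      rw [φ.right_inv hy.1] at h4
      have h5 := mvfderiv_eq_fderiv_chart h3 (hh.mdiff hU hy.2) (Z (φ.symm y))
      rw [φ.right_inv hy.1] at h5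
      erw [h4]
      exact h5
  have hsm : ContDiffAt ℝ ∞ h' (φ p) := by
    rw [← contMDiffAt_iff_contDiffAt]
    have h1 : ContMDiffAt (𝓡 3) 𝓘(ℝ, F) ∞ h p := (hh p hp).contMDiffAt (hU.mem_nhds hp)
    refine ContMDiffAt.comp (I' := 𝓡 3) (φ p) ?_ ?_
    · rwa [hφ, (extChartAt (𝓡 3) p).left_inv hps]
    · exact (contMDiffOn_extChartAt_symm p).contMDiffAt (extChartAt_target_mem_nhds p)
  have hdd : DifferentiableAt ℝ (fderiv ℝ h') (φ p) :=
    ((hsm.fderiv_right (m := 1) (by norm_cast)).differentiableAt (by simp))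
  have second : ∀ {Z W : Field M}, SmoothOn Z U → ∀ Z' W' : EuclideanSpace ℝ (Fin 3) → EuclideanSpace ℝ (Fin 3),
      DifferentiableAt ℝ Z' (φ p) →
      (deriv Z h) ∘ φ.symm =ᶠ[nhds (φ p)] (fun y => fderiv ℝ h' y (Z' y)) →
      W' (φ p) = mfderiv (𝓡 3) 𝓘(ℝ, EuclideanSpace ℝ (Fin 3)) φ p (W p) →
      deriv W (deriv Z h) p =
        fderiv ℝ (fderiv ℝ h') (φ p) (W' (φ p)) (Z' (φ p)) +
          fderiv ℝ h' (φ p) (fderiv ℝ Z' (φ p) (W' (φ p))) := by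
    intro Z W hZ Z' W' hZ' he hW
    have h1 : deriv W (deriv Z h) p = _ :=
      mvfderiv_eq_fderiv_chart hps ((hh.deriv hU hZ).mdiff hU hp) (W p)
    rw [h1, he.fderiv_eq, ← hW, fderiv_clm_apply hdd hZ']
    simp [add_comm]
  obtain ⟨X', eX, dX, hX'⟩ := key hX
  obtain ⟨Y', eY, dY, hY'⟩ := key hY
  have vX : X' (φ p) = mfderiv (𝓡 3) 𝓘(ℝ, EuclideanSpace ℝ (Fin 3)) φ p (X p) := by
    rw [eX]; exact mpullback_chart_apply X hps
  have vY : Y' (φ p) = mfderiv (𝓡 3) 𝓘(ℝ, EuclideanSpace ℝ (Fin 3)) φ p (Y p) := by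
    rw [eY]; exact mpullback_chart_apply Y hps
  rw [second hX X' Y' dX hX' vY, second hY Y' X' dY hY' vX]
  have h1 : deriv (VectorField.mlieBracket (𝓡 3) X Y) h p = _ :=
      mvfderiv_eq_fderiv_chart hps (hh.mdiff hU hp) (VectorField.mlieBracket (𝓡 3) X Y p)
  have h2 : mfderiv (𝓡 3) 𝓘(ℝ, EuclideanSpace ℝ (Fin 3)) φ p (VectorField.mlieBracket (𝓡 3) X Y p)
      = fderiv ℝ Y' (φ p) (X' (φ p)) - fderiv ℝ X' (φ p) (Y' (φ p)) := by
    let b : EuclideanSpace ℝ (Fin 3) := VectorField.lieBracketWithin ℝ X' Y'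
        ((extChartAt (𝓡 3) p).symm ⁻¹' Set.univ ∩ Set.range (𝓡 3)) (φ p)
    have hb : b = fderiv ℝ Y' (φ p) (X' (φ p)) - fderiv ℝ X' (φ p) (Y' (φ p)) := by
      simp only [b]
      rw [modelWithCornersSelf_coe, Set.range_id, Set.preimage_univ, Set.inter_univ,
        VectorField.lieBracketWithin_univ]
      rfl
    have h3 := (isInvertible_mfderiv_extChartAt (I := 𝓡 3) hps).self_apply_inverse b
    refine Eq.trans ?_ (h3.trans hb)
    simp only [b, eX, eY]
    rfl
  -- The two second-order terms cancel by symmetry of D²h'; what is left is Dh' applied to the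
  -- bracket of the pulled back fields.
  have hsymm := hsm.isSymmSndFDerivAt (by simp; exact ENat.LEInfty.out) (Y' (φ p)) (X' (φ p))
  rw [h1]
  erw [h2]
  rw [hsymm, map_sub]
  abel

omit [IsManifold (𝓡 3) ∞ M]

lemma deriv_congr {X : Field M} {h k : M → F} {U : Set M} (hU : IsOpen U) (e : Set.EqOn h k U)
    {p : M} (hp : p ∈ U) : deriv X h p = deriv X k p := by
  have : h =ᶠ[nhds p] k := e.eventuallyEq_of_mem (hU.mem_nhds hp)
  have h1 : mfderiv (𝓡 3) 𝓘(ℝ, F) h p = mfderiv (𝓡 3) 𝓘(ℝ, F) k p := this.mfderiv_eq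
  exact DFunLike.congr_fun h1 (X p)

lemma deriv_eq_zero_of_const {X : Field M} {h : M → F} {U : Set M} {a : F} (hU : IsOpen U)
    (e : ∀ q ∈ U, h q = a) {p : M} (hp : p ∈ U) : deriv X h p = 0 := by
  rw [deriv_congr hU (k := fun _ => a) e hp, deriv, mvfderiv_const]
  rfl

lemma deriv_add (X : Field M) {h k : M → F} {p : M}
    (hh : MDifferentiableAt (𝓡 3) 𝓘(ℝ, F) h p) (hk : MDifferentiableAt (𝓡 3) 𝓘(ℝ, F) k p) :
    deriv X (fun q => h q + k q) p = deriv X h p + deriv X k p := by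
  rw [deriv, mvfderiv_fun_add hh hk]; rfl

lemma deriv_sub (X : Field M) {h k : M → F} {p : M}
    (hh : MDifferentiableAt (𝓡 3) 𝓘(ℝ, F) h p) (hk : MDifferentiableAt (𝓡 3) 𝓘(ℝ, F) k p) :
    deriv X (fun q => h q - k q) p = deriv X h p - deriv X k p := by
  rw [deriv, mvfderiv_fun_sub hh hk]; rfl

lemma deriv_clm (X : Field M) (T : F →L[ℝ] G) {h : M → F} {p : M}
    (hh : MDifferentiableAt (𝓡 3) 𝓘(ℝ, F) h p) :
    deriv X (fun q => T (h q)) p = T (deriv X h p) := by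
  have h1 : HasMFDerivAt (𝓡 3) 𝓘(ℝ, G) (T ∘ h) p _ :=
    (T.hasFDerivAt (x := h p)).hasMFDerivAt.comp p hh.hasMFDerivAt
  exact DFunLike.congr_fun h1.mfderiv (X p)

lemma deriv_bilin (X : Field M) (B : F →L[ℝ] G →L[ℝ] K) {h : M → F} {k : M → G} {p : M}
    (hh : MDifferentiableAt (𝓡 3) 𝓘(ℝ, F) h p) (hk : MDifferentiableAt (𝓡 3) 𝓘(ℝ, G) k p) :
    deriv X (fun q => B (h q) (k q)) p = B (deriv X h p) (k p) + B (h p) (deriv X k p) := by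
  have h0 := B.isBoundedBilinearMap.hasFDerivAt (h p, k p)
  have h1 : HasMFDerivAt (𝓡 3) 𝓘(ℝ, K) ((fun z : F × G => B z.1 z.2) ∘ fun q => (h q, k q)) p _ :=
    HasMFDerivAt.comp p h0.hasMFDerivAt
      ⟨hh.continuousAt.prodMk hk.continuousAt, hh.hasMFDerivAt.2.prodMk hk.hasMFDerivAt.2⟩
  have h2 := DFunLike.congr_fun h1.mfderiv (X p)
  refine h2.trans ?_
  exact add_comm _ _

lemma SmoothFun.clm {U : Set M} {h : M → F} (hh : SmoothFun h U) (T : F →L[ℝ] G) :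
    SmoothFun (fun q => T (h q)) U :=
  T.contDiff.contMDiff.comp_contMDiffOn hh

lemma SmoothFun.bilin {U : Set M} {h : M → F} {k : M → G} (hh : SmoothFun h U)
    (hk : SmoothFun k U) (B : F →L[ℝ] G →L[ℝ] K) : SmoothFun (fun q => B (h q) (k q)) U :=
  B.isBoundedBilinearMap.contDiff.contMDiff.comp_contMDiffOn (hh.prodMk_space hk)

lemma deriv_smul (X : Field M) {a : M → ℝ} {h : M → F} {p : M}
    (ha : MDifferentiableAt (𝓡 3) 𝓘(ℝ, ℝ) a p) (hh : MDifferentiableAt (𝓡 3) 𝓘(ℝ, F) h p) :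
    deriv X (fun q => a q • h q) p = deriv X a p • h p + a p • deriv X h p :=
  deriv_bilin X (ContinuousLinearMap.lsmul ℝ ℝ) ha hh

lemma deriv_mul (X : Field M) {a b : M → ℝ} {p : M}
    (ha : MDifferentiableAt (𝓡 3) 𝓘(ℝ, ℝ) a p) (hb : MDifferentiableAt (𝓡 3) 𝓘(ℝ, ℝ) b p) :
    deriv X (fun q => a q * b q) p = deriv X a p * b p + a p * deriv X b p :=
  deriv_bilin X (ContinuousLinearMap.mul ℝ ℝ) ha hb

end RealHypersurface

namespace SpaceForm

/-! ### Linear algebra of the plane -/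

lemma herm_add_right (c : ℝ) (v w u : C3) : herm c v (w + u) = herm c v w + herm c v u := by
  simp only [herm, PiLp.add_apply]; ring

lemma herm_smul_right (c : ℝ) (a : ℂ) (v w : C3) : herm c v (a • w) = a * herm c v w := by
  simp only [herm, PiLp.smul_apply, smul_eq_mul]; ring

lemma star_herm (c : ℝ) (v w : C3) : star (herm c v w) = herm c w v := by
  simp [herm]; ring

lemma herm_add_left (c : ℝ) (v w u : C3) : herm c (v + w) u = herm c v u + herm c w u := by
  simp only [herm, PiLp.add_apply, star_add]; ring

lemma herm_smul_left (c : ℝ) (a : ℂ) (v w : C3) : herm c (a • v) w = star a * herm c v w := by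
  simp only [herm, PiLp.smul_apply, smul_eq_mul, star_mul]; ring

lemma sgn_ne_zero (c : ℝ) : sgn c ≠ 0 := by unfold sgn; split_ifs <;> norm_num

lemma herm_nondegenerate {c : ℝ} {w : C3} (h : ∀ v, herm c v w = 0) : w = 0 := by
  ext i
  have h1 := h (EuclideanSpace.single i 1)
  have hs : (sgn c : ℂ) ≠ 0 := by exact_mod_cast sgn_ne_zero c
  fin_cases i <;> simpa [herm, hs] using h1

lemma herm_self_im (c : ℝ) (v : C3) : (herm c v v).im = 0 := by
  have := congrArg Complex.im (star_herm c v v)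
  simp at this
  linarith

/-- The form `h` as a complex linear functional of its second argument. -/
def hermL (c : ℝ) (v : C3) : C3 →ₗ[ℂ] ℂ where
  toFun := herm c v
  map_add' := herm_add_right c v
  map_smul' a w := herm_smul_right c a v w

/-- A vector spanning the line of a point of the plane. -/
structure Spans (c : ℝ) (v : C3) (P : EndC3) : Prop where
  pos : 0 < sgn c * (herm c v v).re
  apply : ∀ w, P w = (herm c v w / herm c v v) • v

namespace Spans
variable {c : ℝ} {v : C3} {P : EndC3} (h : Spans c v P)
include h

lemma herm_ne : herm c v v ≠ 0 := fun h0 => by have := h.pos; simp [h0] at this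

lemma ne_zero : v ≠ 0 := fun h0 => h.herm_ne (by simp [h0, herm])

lemma apply_self : P v = v := by rw [h.apply, div_self h.herm_ne, one_smul]

lemma mul_self : P * P = P := by
  ext1 w
  rw [mul_apply_eq_comp, h.apply w, map_smul, h.apply_self]

lemma selfAdjoint (u w : C3) : herm c (P u) w = herm c u (P w) := by
  have e : star (herm c v v) = herm c v v := star_herm c v v
  rw [h.apply, h.apply, herm_smul_left, herm_smul_right, star_div₀, e, star_herm]
  ring

lemma trace_mul (W : EndC3) :
    LinearMap.trace ℂ C3 (P * W : EndC3).toLinearMap = herm c v (W v) / herm c v v := by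
  have e : (P * W : EndC3).toLinearMap =
      ((herm c v v)⁻¹ • (hermL c v ∘ₗ W.toLinearMap)).smulRight v := by
    ext1 w
    simp [h.apply, hermL, div_eq_inv_mul]
  rw [e, LinearMap.trace_smulRight]
  simp [hermL, div_eq_inv_mul]

lemma mul_mul (W : EndC3) :
    P * W * P = LinearMap.trace ℂ C3 (P * W : EndC3).toLinearMap • P := by
  rw [h.trace_mul]
  ext1 w
  simp only [mul_apply_eq_comp, smul_apply]
  rw [h.apply w, map_smul, map_smul, h.apply (W v), smul_smul, smul_smul, mul_comm]

end Spans

lemma exists_spans {c : ℝ} {P : EndC3} (h : P ∈ plane c) : ∃ v, Spans c v P :=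
  let ⟨v, hv⟩ := h; ⟨v, hv.1, hv.2⟩

/-- The Hermitian metric `tr (P X Y)` of the plane. -/
def pair (P X Y : EndC3) : ℂ := LinearMap.trace ℂ C3 (P * X * Y : EndC3).toLinearMap

section products
variable {P X Y Z : EndC3}

lemma real_smul_eq (a : ℝ) (X : EndC3) : a • X = (a : ℂ) • X := by
  ext1 w
  ext i
  simp

lemma proj_mul_proj (hP : P * P = P) (hX : P * X + X * P = X) : P * X * P = 0 := by
  have h1 : P * (P * X + X * P) = P * X := by rw [hX]
  rw [mul_add, ← mul_assoc, hP, ← mul_assoc] at h1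
  simpa using h1

/-- Tangent vectors are off-diagonal with respect to ℂv ⊕ v^⊥, so a product of two is block diagonal
and, in `tangent_triple`, a product of three is off-diagonal again. -/
lemma commute_mul (hX : P * X + X * P = X) (hY : P * Y + Y * P = Y) :
    P * (X * Y) = X * Y * P := by
  have h1 : P * (X * Y) = (X - X * P) * Y := by rw [← mul_assoc, eq_sub_of_add_eq hX]
  have h2 : X * Y * P = X * (Y - P * Y) := by rw [mul_assoc, eq_sub_of_add_eq' hY]
  rw [h1, h2, sub_mul, mul_sub, mul_assoc X P Y]

lemma tangent_triple (hX : P * X + X * P = X) (hY : P * Y + Y * P = Y)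
    (hZ : P * Z + Z * P = Z) : P * (X * Y * Z) + X * Y * Z * P = X * Y * Z := by
  calc P * (X * Y * Z) + X * Y * Z * P = P * (X * Y) * Z + X * Y * (Z * P) := by noncomm_ring
    _ = X * Y * (P * Z + Z * P) := by rw [commute_mul hX hY]; noncomm_ring
    _ = _ := by rw [hZ]

variable {c : ℝ} {v : C3} (h : Spans c v P)
include h

/-- `X * Y` commutes with `P`, and `P` has rank one, so the compression of any endomorphism by `P`
is a scalar multiple of `P`. -/
lemma Spans.proj_mul_mul (hX : P * X + X * P = X) (hY : P * Y + Y * P = Y) :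
    P * X * Y = pair P X Y • P := by
  have h1 := h.mul_mul (X * Y)
  rw [mul_assoc, ← commute_mul hX hY, ← mul_assoc, h.mul_self, ← mul_assoc] at h1
  exact h1

lemma Spans.mul_mul_proj (hX : P * X + X * P = X) (hY : P * Y + Y * P = Y) :
    X * Y * P = pair P X Y • P := by
  rw [← h.proj_mul_mul hX hY, ← commute_mul hX hY, mul_assoc]

lemma Spans.pair_eq (hX : ∀ v w, herm c (X v) w = herm c v (X w)) :
    pair P X Y = herm c (X v) (Y v) / herm c v v := by
  rw [pair, mul_assoc, h.trace_mul, hX]; rfl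

lemma Spans.star_pair (hX : ∀ v w, herm c (X v) w = herm c v (X w))
    (hY : ∀ v w, herm c (Y v) w = herm c v (Y w)) : star (pair P X Y) = pair P Y X := by
  rw [h.pair_eq hX, h.pair_eq hY, star_div₀, star_herm, star_herm]

-- `X * P` is the component in Hom(ℂv, v^⊥), where `J` acts as i, and `P * X` the opposite block,
-- where it acts as −i. This turns complex coefficients into real combinations of `X` and `J X`.
omit h in
lemma smul_add_star_smul (hX : P * X + X * P = X) (z : ℂ) :
    z • (X * P) + star z • (P * X) = z.re • X + z.im • J P X := by
  have key : ∀ a b : EndC3, ((z.re : ℂ) + z.im * Complex.I) • a + ((z.re : ℂ) - z.im * Complex.I) • b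
      = (z.re : ℂ) • (b + a) + (z.im : ℂ) • (Complex.I • (a - b)) := fun a b => by module
  have hz : star z = z.re - z.im * Complex.I := by apply Complex.ext <;> simp
  have h1 := key (X * P) (P * X)
  rwa [hX, ← hz, Complex.re_add_im, ← real_smul_eq, ← real_smul_eq] at h1

end products

section bilinear

/-- The real part of the trace as a real linear functional. -/
def reTrace : EndC3 →L[ℝ] ℝ :=
  LinearMap.toContinuousLinearMap
    { toFun := fun X => (LinearMap.trace ℂ C3 X.toLinearMap).re
      map_add' := fun X Y => by simp
      map_smul' := fun a X => by simp [real_smul_eq] }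

/-- Composition as a real bilinear map. -/
def mulB : EndC3 →L[ℝ] EndC3 →L[ℝ] EndC3 :=
  LinearMap.mkContinuous₂ (LinearMap.mk₂ ℝ (fun X Y : EndC3 => X * Y)
      (fun X Y Z => add_mul X Y Z) (fun a X Y => by rw [real_smul_eq, smul_mul_assoc, ← real_smul_eq])
      (fun X Y Z => mul_add X Y Z) (fun a X Y => by rw [real_smul_eq, mul_smul_comm, ← real_smul_eq]))
    1 (fun X Y => by
      simp only [LinearMap.mk₂_apply, one_mul]; exact norm_mul_le X Y)

lemma mulB_apply (X Y : EndC3) : mulB X Y = X * Y := by simp [mulB]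

/-- The metric as a real bilinear map. -/
def metricB (c : ℝ) : EndC3 →L[ℝ] EndC3 →L[ℝ] ℝ :=
  (2 / c) • (ContinuousLinearMap.compL ℝ EndC3 EndC3 ℝ reTrace ∘L mulB)

lemma metricB_apply (c : ℝ) (X Y : EndC3) : metricB c X Y = metric c X Y := by
  simp [metricB, metric, reTrace, mulB_apply]

variable (c a : ℝ) (X Y Z : EndC3)

lemma metric_comm : metric c X Y = metric c Y X := by
  unfold metric
  congr 2
  exact LinearMap.trace_mul_comm ℂ X.toLinearMap Y.toLinearMap

lemma metric_add_left : metric c (X + Y) Z = metric c X Z + metric c Y Z := by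
  simp only [← metricB_apply, map_add, add_apply]
lemma metric_sub_left : metric c (X - Y) Z = metric c X Z - metric c Y Z := by
  simp only [← metricB_apply, map_sub, sub_apply]
lemma metric_neg_left : metric c (-X) Z = -metric c X Z := by
  simp only [← metricB_apply, map_neg, neg_apply]
lemma metric_smul_left : metric c (a • X) Z = a * metric c X Z := by
  simp only [← metricB_apply, map_smul, smul_apply, smul_eq_mul]
lemma metric_zero_left : metric c 0 Z = 0 := by
  simp only [← metricB_apply, map_zero, zero_apply]
lemma metric_add_right : metric c Z (X + Y) = metric c Z X + metric c Z Y := by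
  simp only [← metricB_apply, map_add]
lemma metric_neg_right : metric c Z (-X) = -metric c Z X := by
  simp only [← metricB_apply, map_neg]
lemma metric_smul_right : metric c Z (a • X) = a * metric c Z X := by
  simp only [← metricB_apply, map_smul, smul_eq_mul]

end bilinear

end SpaceForm

/-! ### Kähler metric, complex structure and curvature tensor of the plane. -/

namespace SpaceForm

section ring
variable {A : Type*} [Ring A] [Algebra ℂ A] {p x y z : A}

lemma ring_proj_J (hp : p * p = p) (hx : p * x * p = 0) :
    p * (Complex.I • (x * p - p * x)) * y = (-Complex.I) • (p * x * y) := by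
  rw [mul_smul_comm, mul_sub, ← mul_assoc, ← mul_assoc, hp, hx, zero_sub, smul_mul_assoc, neg_mul,
    neg_smul, smul_neg]

lemma ring_J_mem (hp : p * p = p) (hx : p * x * p = 0) :
    p * (Complex.I • (x * p - p * x)) + (Complex.I • (x * p - p * x)) * p =
      Complex.I • (x * p - p * x) := by
  rw [mul_smul_comm, smul_mul_assoc, ← smul_add, mul_sub, sub_mul, ← mul_assoc, ← mul_assoc,
      hx, hp, mul_assoc x, hp]
  congr 1
  abel

lemma ring_J_J (hp : p * p = p) (hx : p * x * p = 0) (hx' : p * x + x * p = x) :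
    Complex.I • ((Complex.I • (x * p - p * x)) * p - p * (Complex.I • (x * p - p * x))) = -x := by
  rw [mul_smul_comm, smul_mul_assoc, ← smul_sub, smul_smul, Complex.I_mul_I, neg_smul,
    one_smul, neg_inj, mul_sub, sub_mul, ← mul_assoc, ← mul_assoc, hx, hp, mul_assoc x, hp]
  nth_rewrite 3 [← hx']
  abel

/-- The double commutator is a sum of four triple products. Each is off-diagonal, hence equals its
left plus its right product with `p`, and there a neighbouring pair of factors collapses to a
scalar. -/
lemma ring_bracket {axy ayx axz azx ayz azy : ℂ}
    (txyz : p * (x * y * z) + x * y * z * p = x * y * z)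
    (tyxz : p * (y * x * z) + y * x * z * p = y * x * z)
    (tzxy : p * (z * x * y) + z * x * y * p = z * x * y)
    (tzyx : p * (z * y * x) + z * y * x * p = z * y * x)
    (hxy : p * x * y = axy • p) (hyx : p * y * x = ayx • p)
    (hzx : p * z * x = azx • p) (hzy : p * z * y = azy • p)
    (hxy' : x * y * p = axy • p) (hyx' : y * x * p = ayx • p) (hxz' : x * z * p = axz • p)
    (hyz' : y * z * p = ayz • p) :
    (x * y - y * x) * z - z * (x * y - y * x) =
      (ayz • (x * p) + azy • (p * x)) - (axz • (y * p) + azx • (p * y))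
        - ((axy - ayx) • (z * p) + (ayx - axy) • (p * z)) := by
  have e1 : p * (x * y * z) = axy • (p * z) := by
    rw [← mul_assoc, ← mul_assoc, hxy, smul_mul_assoc]
  have e2 : p * (y * x * z) = ayx • (p * z) := by
    rw [← mul_assoc, ← mul_assoc, hyx, smul_mul_assoc]
  have e3 : p * (z * x * y) = azx • (p * y) := by
    rw [← mul_assoc, ← mul_assoc, hzx, smul_mul_assoc]
  have e4 : p * (z * y * x) = azy • (p * x) := by
    rw [← mul_assoc, ← mul_assoc, hzy, smul_mul_assoc]
  have f1 : x * y * z * p = ayz • (x * p) := by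
    rw [mul_assoc x, mul_assoc, hyz', mul_smul_comm]
  have f2 : y * x * z * p = axz • (y * p) := by
    rw [mul_assoc y, mul_assoc, hxz', mul_smul_comm]
  have f3 : z * x * y * p = axy • (z * p) := by
    rw [mul_assoc z, mul_assoc, hxy', mul_smul_comm]
  have f4 : z * y * x * p = ayx • (z * p) := by
    rw [mul_assoc z, mul_assoc, hyx', mul_smul_comm]
  have e : (x * y - y * x) * z - z * (x * y - y * x) =
      x * y * z - y * x * z - z * x * y + z * y * x := by noncomm_ring
  rw [e, ← txyz, ← tyxz, ← tzxy, ← tzyx, e1, e2, e3, e4, f1, f2, f3, f4]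
  module

end ring

variable {c : ℝ} {v : C3} {P X Y Z W : EndC3}

lemma Spans.metric_eq (h : Spans c v P) (hX : X ∈ tangent c P) (hY : Y ∈ tangent c P) :
    metric c X Y = 4 / c * (pair P X Y).re := by
  have h1 : LinearMap.trace ℂ C3 (X * Y : EndC3).toLinearMap = pair P X Y + pair P Y X := by
    have h2 : X * Y = P * X * Y + X * (P * Y) := by
      rw [← mul_assoc, ← add_mul, hX.2]
    have h3 : LinearMap.trace ℂ C3 (X * (P * Y) : EndC3).toLinearMap = pair P Y X :=
      LinearMap.trace_mul_comm ℂ X.toLinearMap (P * Y).toLinearMap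
    rw [← h3, h2, pair, ← map_add]
    rfl
  rw [metric, h1, ← h.star_pair hX.1 hY.1]
  simp
  ring

lemma Spans.pair_J (h : Spans c v P) (hX : P * X + X * P = X) :
    pair P (J P X) Y = -Complex.I * pair P X Y := by
  have h1 : P * J P X * Y = (-Complex.I) • (P * X * Y) :=
    ring_proj_J h.mul_self (proj_mul_proj h.mul_self hX)
  rw [pair, h1, pair]
  exact map_smul (LinearMap.trace ℂ C3) (-Complex.I) (P * X * Y).toLinearMap

lemma Spans.J_mem (h : Spans c v P) (hX : X ∈ tangent c P) : J P X ∈ tangent c P := by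
  constructor
  · intro u w
    have e1 : herm c (X (P u)) w = herm c u (P (X w)) := by rw [hX.1, h.selfAdjoint]
    have e2 : herm c (P (X u)) w = herm c u (X (P w)) := by rw [h.selfAdjoint, hX.1]
    simp only [J, sub_eq_add_neg, smul_add, add_apply, smul_apply, mul_apply_eq_comp, neg_apply, herm_add_left,
      herm_add_right, herm_smul_left, herm_smul_right]
    rw [e1, ← neg_one_smul ℂ (P (X u)), ← neg_one_smul ℂ (P (X w)), herm_smul_left,
      herm_smul_right, e2]
    simp
    ring
  · exact ring_J_mem h.mul_self (proj_mul_proj h.mul_self hX.2)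

lemma Spans.J_J (h : Spans c v P) (hX : X ∈ tangent c P) : J P (J P X) = -X :=
  ring_J_J h.mul_self (proj_mul_proj h.mul_self hX.2) hX.2

/-- `pair` is conjugate linear in `X`, so its imaginary part is the real part after replacing `X` by
`J X`: metric and Kähler form are the two parts of one Hermitian form. -/
lemma Spans.pair_eq_metric (hc : c ≠ 0) (h : Spans c v P) (hX : X ∈ tangent c P)
    (hY : Y ∈ tangent c P) :
    (pair P X Y).re = c / 4 * metric c X Y ∧ (pair P X Y).im = c / 4 * metric c (J P X) Y := by
  rw [h.metric_eq hX hY, h.metric_eq (h.J_mem hX) hY, h.pair_J hX.2]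
  constructor
  · field_simp
  · simp
    field_simp

lemma Spans.metric_J_left (hc : c ≠ 0) (h : Spans c v P) (hX : X ∈ tangent c P)
    (hY : Y ∈ tangent c P) : metric c (J P X) Y = -metric c X (J P Y) := by
  have h1 := (h.pair_eq_metric hc hX hY).2
  have h2 := (h.pair_eq_metric hc hY hX).2
  rw [← h.star_pair hX.1 hY.1] at h2
  rw [metric_comm c X]
  have : c / 4 * (metric c (J P X) Y + metric c (J P Y) X) = 0 := by
    rw [mul_add, ← h1, ← h2]; simp
  rcases mul_eq_zero.1 this with h3 | h3
  · exact absurd h3 (by positivity)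
  · linarith

/-- The curvature tensor of a space of constant holomorphic sectional curvature `c`. -/
def curvature (c : ℝ) (P X Y Z : EndC3) : EndC3 :=
  (c / 4) • (metric c Y Z • X - metric c X Z • Y + metric c (J P Y) Z • J P X
    - metric c (J P X) Z • J P Y - (2 * metric c (J P X) Y) • J P Z)

/-- The left side is the curvature of a symmetric space, the double commutator. The six Hermitian
products in `ring_bracket` are conjugate in pairs; their real parts give the metric terms of the
curvature tensor and their imaginary parts the terms with `J`. -/
lemma Spans.bracket_eq_curvature (hc : c ≠ 0) (h : Spans c v P) (hX : X ∈ tangent c P)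
    (hY : Y ∈ tangent c P) (hZ : Z ∈ tangent c P) :
    (X * Y - Y * X) * Z - Z * (X * Y - Y * X) = curvature c P X Y Z := by
  have t1 := tangent_triple hX.2 hY.2 hZ.2
  have t2 := tangent_triple hY.2 hX.2 hZ.2
  have t3 := tangent_triple hZ.2 hX.2 hY.2
  have t4 := tangent_triple hZ.2 hY.2 hX.2
  have h1 := ring_bracket t1 t2 t3 t4 (h.proj_mul_mul hX.2 hY.2) (h.proj_mul_mul hY.2 hX.2)
    (h.proj_mul_mul hZ.2 hX.2) (h.proj_mul_mul hZ.2 hY.2) (h.mul_mul_proj hX.2 hY.2)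
    (h.mul_mul_proj hY.2 hX.2) (h.mul_mul_proj hX.2 hZ.2) (h.mul_mul_proj hY.2 hZ.2)
  rw [h1, ← h.star_pair hY.1 hZ.1, ← h.star_pair hX.1 hZ.1, ← h.star_pair hX.1 hY.1]
  have e : (star (pair P X Y) - pair P X Y) = star (pair P X Y - star (pair P X Y)) := by simp
  rw [e, smul_add_star_smul hX.2, smul_add_star_smul hY.2, smul_add_star_smul hZ.2,
    (h.pair_eq_metric hc hY hZ).1, (h.pair_eq_metric hc hY hZ).2,
    (h.pair_eq_metric hc hX hZ).1, (h.pair_eq_metric hc hX hZ).2]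
  have e1 : (pair P X Y - star (pair P X Y)).re = 0 := by simp
  have e2 : (pair P X Y - star (pair P X Y)).im = 2 * (c / 4 * metric c (J P X) Y) := by
    rw [← (h.pair_eq_metric hc hX hY).2]; simp; ring
  rw [e1, e2, curvature]
  module

end SpaceForm

/-! ### Off-diagonal projection and the second fundamental form of the embedded plane. -/

namespace SpaceForm

section ring
variable {A : Type*} [Ring A] [Algebra ℂ A] {p x y v b w n m : A}

omit [Algebra ℂ A] in
lemma comm_of_mem (hx : p * x + x * p = x) (hy : p * y + y * p = y) :
    p * (x * y) = x * y * p := by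
  have h1 : p * (x * y) = (x - x * p) * y := by rw [← mul_assoc, eq_sub_of_add_eq hx]
  have h2 : x * y * p = x * (y - p * y) := by rw [mul_assoc, eq_sub_of_add_eq' hy]
  rw [h1, h2, sub_mul, mul_sub, mul_assoc x p y]

/-- The off-diagonal part of `w` with respect to the idempotent `p`. -/
def offDiag (p w : A) : A := p * w + w * p - (2 : ℂ) • (p * w * p)

lemma offDiag_add : offDiag p (x + y) = offDiag p x + offDiag p y := by
  simp only [offDiag, mul_add, add_mul]; module

lemma offDiag_sub : offDiag p (x - y) = offDiag p x - offDiag p y := by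
  simp only [offDiag, mul_sub, sub_mul]; module

lemma offDiag_eq_self (hp : p * p = p) (hx : p * x + x * p = x) : offDiag p x = x := by
  have h1 : p * x * p = 0 := by
    have h1 : p * (p * x + x * p) = p * x := by rw [hx]
    rw [mul_add, ← mul_assoc, hp, ← mul_assoc] at h1
    simpa using h1
  rw [offDiag, h1, hx]; simp

lemma offDiag_reflect_eq_zero (hp : p * p = p) (hx : p * x = x * p) :
    offDiag p ((1 - p - p) * x) = 0 := by
  have e1 : p * ((1 - p - p) * x) = - (x * p) := by
    rw [← mul_assoc, mul_sub, mul_sub, mul_one, hp, ← hx]; noncomm_ring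
  have e2 : (1 - p - p) * x * p = - (x * p) := by
    have h1 : (1 - p - p) * p = -p := by rw [sub_mul, sub_mul, one_mul, hp]; abel
    rw [mul_assoc, ← hx, ← mul_assoc, h1, neg_mul]
  have e3 : x * p * p = x * p := by rw [mul_assoc, hp]
  rw [offDiag, e1, e2, neg_mul, e3]
  module

lemma offDiag_mem (hp : p * p = p) : p * offDiag p w + offDiag p w * p = offDiag p w := by
  have e1 : p * (p * w) = p * w := by rw [← mul_assoc, hp]
  have e2 : w * p * p = w * p := by rw [mul_assoc, hp]
  have e3 : p * (p * w * p) = p * w * p := by rw [mul_assoc p w p, ← mul_assoc, hp]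
  have e4 : p * w * p * p = p * w * p := by rw [mul_assoc, hp]
  simp only [offDiag, mul_sub, sub_mul, mul_add, add_mul, mul_smul_comm, smul_mul_assoc, e1, e2,
    e3, e4]
  rw [← mul_assoc]
  module

/-- The hypothesis `hw` is the derivative of pv + vp = v in a direction x, with w the derivative of
v. It determines the diagonal part of w: both diagonal blocks come from xv + vx, the one on the
range of p with sign −1, which is the effect of the reflection 1 − 2p. -/
lemma offDiag_of_deriv (hp : p * p = p) (hx : p * x + x * p = x) (hv : p * v + v * p = v)
    (hw : (x * v + p * w) + (w * p + v * x) = w) :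
    w = offDiag p w + (1 - p - p) * (x * v + v * x) := by
  have hd : p * (x * v + v * x) = (x * v + v * x) * p := by
    rw [mul_add, add_mul, comm_of_mem hx hv, comm_of_mem hv hx]
  generalize hdd : x * v + v * x = d at hd ⊢
  have h1 : d = w - p * w - w * p := by rw [← hdd]; nth_rewrite 1 [← hw]; abel
  have h2 : p * d = - (p * w * p) := by
    rw [h1, mul_sub, mul_sub, ← mul_assoc, hp, ← mul_assoc]; abel
  rw [sub_mul, sub_mul, one_mul, h2, h1, offDiag, two_smul]
  abel

omit [Algebra ℂ A] in
lemma mul_reflect (hx : p * x + x * p = x) : x * (1 - p - p) = - ((1 - p - p) * x) := by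
  have : x * p = x - p * x := eq_sub_of_add_eq' hx
  rw [mul_sub, mul_sub, this, sub_mul, sub_mul, mul_one, one_mul]
  abel

omit [Algebra ℂ A] in
lemma reflect_reflect (hp : p * p = p) : (1 - p - p) * ((1 - p - p) * x) = x := by
  rw [← mul_assoc]
  have : (1 - p - p) * (1 - p - p) = 1 := by
    simp only [mul_sub, sub_mul, hp, one_mul, mul_one]; abel
  rw [this, one_mul]

omit [Algebra ℂ A] in
lemma triple_mem (hx : p * x + x * p = x) (hy : p * y + y * p = y)
    (hv : p * v + v * p = v) : p * (x * y * v) + x * y * v * p = x * y * v := by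
  calc p * (x * y * v) + x * y * v * p = p * (x * y) * v + x * y * (v * p) := by noncomm_ring
    _ = x * y * (p * v + v * p) := by rw [comm_of_mem hx hy]; noncomm_ring
    _ = _ := by rw [hv]

/-- The reflection 1 − 2p squares to 1 and anticommutes with off-diagonal elements. Hence the
tangential parts `nx`, `ny` and the second derivatives of the immersion, which enter only through
the off-diagonal `dxy - dyx`, contribute diagonal terms; `offDiag` kills these and leaves a cubic
commutator. -/
lemma ring_curvature (hp : p * p = p) (hx : p * x + x * p = x) (hy : p * y + y * p = y)
    (hv : p * v + v * p = v) {wx wy dxy dyx nx ny dvxy dvyx : A}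
    (hb : p * (dxy - dyx) + (dxy - dyx) * p = dxy - dyx)
    (hnx : p * nx + nx * p = nx) (hny : p * ny + ny * p = ny)
    (hwx : wx = nx + (1 - p - p) * (x * v + v * x))
    (hwy : wy = ny + (1 - p - p) * (y * v + v * y)) :
    offDiag p (dvxy - ((- x - x) * (y * v + v * y) +
        (1 - p - p) * (dxy * v + y * wx + (wx * y + v * dxy)))) -
      offDiag p (dvyx - ((- y - y) * (x * v + v * x) +
        (1 - p - p) * (dyx * v + x * wy + (wy * x + v * dyx)))) - offDiag p (dvxy - dvyx) =
      (x * y - y * x) * v - v * (x * y - y * x) := by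
  rw [← offDiag_sub, ← offDiag_sub]
  have yS : ∀ u, (1 - p - p) * (y * ((1 - p - p) * u)) = - (y * u) := fun u => by
    rw [← mul_assoc y, mul_reflect hy, neg_mul, mul_neg, mul_assoc, reflect_reflect hp]
  have xS : ∀ u, (1 - p - p) * (x * ((1 - p - p) * u)) = - (x * u) := fun u => by
    rw [← mul_assoc x, mul_reflect hx, neg_mul, mul_neg, mul_assoc, reflect_reflect hp]
  have e : dvxy - ((- x - x) * (y * v + v * y) +
        (1 - p - p) * (dxy * v + y * wx + (wx * y + v * dxy))) -
      (dvyx - ((- y - y) * (x * v + v * x) +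
        (1 - p - p) * (dyx * v + x * wy + (wy * x + v * dyx)))) - (dvxy - dvyx)
      = (x * y * v - y * x * v - v * x * y + v * y * x)
        + (1 - p - p) * (x * ny - y * nx + (ny * x - nx * y) - ((dxy - dyx) * v + v * (dxy - dyx)))
        := by
    subst hwx hwy
    have a1 : (1 - p - p) * (dxy * v + y * (nx + (1 - p - p) * (x * v + v * x)) +
        ((nx + (1 - p - p) * (x * v + v * x)) * y + v * dxy)) =
        (1 - p - p) * (dxy * v + y * nx + nx * y + v * dxy) +
          (1 - p - p) * (y * ((1 - p - p) * (x * v + v * x))) +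
          (1 - p - p) * ((1 - p - p) * ((x * v + v * x) * y)) := by noncomm_ring
    have a2 : (1 - p - p) * (dyx * v + x * (ny + (1 - p - p) * (y * v + v * y)) +
        ((ny + (1 - p - p) * (y * v + v * y)) * x + v * dyx)) =
        (1 - p - p) * (dyx * v + x * ny + ny * x + v * dyx) +
          (1 - p - p) * (x * ((1 - p - p) * (y * v + v * y))) +
          (1 - p - p) * ((1 - p - p) * ((y * v + v * y) * x)) := by noncomm_ring
    rw [a1, a2, yS, xS, reflect_reflect hp, reflect_reflect hp]
    noncomm_ring
  rw [e, offDiag_add, offDiag_reflect_eq_zero hp, add_zero, offDiag_eq_self hp]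
  · noncomm_ring
  · have t1 := triple_mem hx hy hv
    have t2 := triple_mem hy hx hv
    have t3 := triple_mem hv hx hy
    have t4 := triple_mem hv hy hx
    calc _ = (p * (x * y * v) + x * y * v * p) - (p * (y * x * v) + y * x * v * p)
        - (p * (v * x * y) + v * x * y * p) + (p * (v * y * x) + v * y * x * p) := by noncomm_ring
      _ = _ := by rw [t1, t2, t3, t4]
  · generalize dxy - dyx = b at hb ⊢
    simp only [mul_add, mul_sub, add_mul, sub_mul, comm_of_mem hx hny, comm_of_mem hny hx,
      comm_of_mem hy hnx, comm_of_mem hnx hy, comm_of_mem hb hv, comm_of_mem hv hb]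

lemma two_smul_mul : ((2 : ℂ) • w) * x = w * x + w * x := by
  rw [smul_mul_assoc, two_smul]

lemma offDiag_eq_add : offDiag p w = p * w + w * p + (-2 : ℂ) • (p * w * p) := by
  rw [offDiag, sub_eq_add_neg, ← neg_smul]

lemma smul_mem_tangent (a : ℂ) (hx : p * x + x * p = x) : p * (a • x) + (a • x) * p = a • x := by
  rw [mul_smul_comm, smul_mul_assoc, ← smul_add, hx]

end ring

lemma tangentProj_eq_offDiag (P W : EndC3) : tangentProj P W = offDiag P W := rfl

/-! ### Tangent spaces of the plane: orthogonal projection, positivity, dimension. -/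

variable {c : ℝ} {v : C3} {P X Y Z W : EndC3}

/-- A block diagonal endomorphism times an off-diagonal one has trace zero, so the projection is
orthogonal for the trace form. -/
lemma Spans.metric_tangentProj (h : Spans c v P) (hX : X ∈ tangent c P) :
    metric c (tangentProj P W) X = metric c W X := by
  have h0 := proj_mul_proj h.mul_self hX.2
  have tr : ∀ A B : EndC3, reTrace (A * B) = reTrace (B * A) := fun A B =>
    congrArg Complex.re (LinearMap.trace_mul_comm ℂ A.toLinearMap B.toLinearMap)
  have e : ∀ A B, metric c A B = 2 / c * reTrace (A * B) := fun A B => rfl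
  have e1 : reTrace (P * W * X) = reTrace (W * (X * P)) := by rw [mul_assoc, tr, mul_assoc]
  have e2 : reTrace (P * W * P * X) = 0 := by
    rw [mul_assoc, mul_assoc, tr, mul_assoc, h0, mul_zero, map_zero]
  have e3 : ((2 : ℂ) • (P * W * P)) * X = P * W * P * X + P * W * P * X :=
    two_smul_mul
  rw [e, e, tangentProj, sub_mul, add_mul, e3, map_sub, map_add, map_add, e1, e2, mul_assoc W P X,
    ← map_add, ← mul_add, add_comm (X * P), hX.2]
  simp

lemma Spans.tangentProj_mem (h : Spans c v P)
    (hW : ∀ u w, herm c (W u) w = herm c u (W w)) : tangentProj P W ∈ tangent c P := by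
  refine ⟨fun u w => ?_, offDiag_mem h.mul_self⟩
  have e : tangentProj P W = P * W + W * P + (-2 : ℂ) • (P * W * P) :=
    offDiag_eq_add
  rw [e]
  simp only [add_apply, smul_apply, mul_apply_eq_comp, herm_add_left,
      herm_add_right, herm_smul_left, herm_smul_right, h.selfAdjoint, hW]
  simp
  ring

lemma Spans.tangentProj_eq_self (h : Spans c v P) (hX : X ∈ tangent c P) :
    tangentProj P X = X := offDiag_eq_self h.mul_self hX.2

/-- The tangent space of the plane as a real subspace. -/
def tangentSubmodule (c : ℝ) (P : EndC3) : Submodule ℝ EndC3 where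
  carrier := tangent c P
  zero_mem' := ⟨by simp [herm], by simp⟩
  add_mem' {X Y} hX hY := ⟨fun u w => by
      simp only [add_apply, herm_add_left, herm_add_right, hX.1, hY.1],
    by conv_rhs => rw [← hX.2, ← hY.2]
       rw [mul_add, add_mul]; abel⟩
  smul_mem' a X hX := ⟨fun u w => by
      simp only [real_smul_eq, smul_apply, herm_smul_left, herm_smul_right, hX.1]
      simp,
    by rw [real_smul_eq]; exact smul_mem_tangent _ hX.2⟩

lemma Spans.eq_zero_of_apply (h : Spans c v P) (hX : X ∈ tangent c P) (h0 : X v = 0) : X = 0 := by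
  have h1 : X * P = 0 := by
    ext1 w; simp [h.apply, h0]
  have h2 : P * X = 0 := by
    ext1 w
    refine herm_nondegenerate (c := c) fun u => ?_
    have h3 : X (P u) = 0 := DFunLike.congr_fun h1 u
    rw [mul_apply_eq_comp, ← h.selfAdjoint, ← hX.1, h3]
    simp [herm]
  rw [← hX.2, h1, h2, add_zero]

lemma Spans.herm_apply (h : Spans c v P) (hX : X ∈ tangent c P) : herm c v (X v) = 0 := by
  have h1 : P (X v) = 0 := by
    have := DFunLike.congr_fun (proj_mul_proj h.mul_self hX.2) v
    simpa [h.apply_self] using this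
  rw [h.apply] at h1
  rcases smul_eq_zero.1 h1 with h2 | h2
  · rcases div_eq_zero_iff.1 h2 with h3 | h3
    · exact h3
    · exact absurd h3 h.herm_ne
  · exact absurd h2 h.ne_zero

/-- For s = 1 the form is positive definite. For s = −1 the vector `v` is timelike, and the
Cauchy-Schwarz inequality in the first two coordinates shows that its complement is spacelike. -/
lemma Spans.herm_pos (h : Spans c v P) {u : C3} (hu : herm c v u = 0) (hu0 : u ≠ 0) :
    0 < (herm c u u).re := by
  have hre : ∀ w : C3, (herm c w w).re = ‖w 0‖ ^ 2 + ‖w 1‖ ^ 2 + sgn c * ‖w 2‖ ^ 2 := fun w => by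
    have e : ∀ z : ℂ, star z * z = ((‖z‖ ^ 2 : ℝ) : ℂ) := fun z => by
      rw [Complex.star_def, mul_comm, Complex.mul_conj, Complex.normSq_eq_norm_sq]
    rw [herm, e, e, e, ← Complex.ofReal_mul, ← Complex.ofReal_add, ← Complex.ofReal_add,
      Complex.ofReal_re]
  have h1 := h.pos
  rw [hre] at h1 ⊢
  have h2 : ‖u 0‖ ^ 2 + ‖u 1‖ ^ 2 ≠ 0 ∨ ‖u 2‖ ≠ 0 := by
    by_contra! h3
    have h4 : ‖u 0‖ = 0 := by nlinarith [sq_nonneg ‖u 0‖, sq_nonneg ‖u 1‖, h3.1]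
    have h5 : ‖u 1‖ = 0 := by nlinarith [sq_nonneg ‖u 0‖, sq_nonneg ‖u 1‖, h3.1]
    apply hu0
    ext i
    fin_cases i
    · exact norm_eq_zero.1 h4
    · exact norm_eq_zero.1 h5
    · exact norm_eq_zero.1 h3.2
  unfold sgn at h1 ⊢
  split_ifs at h1 ⊢ with hcp
  · rcases h2 with h2 | h2 <;> positivity
  · have h3 : star (v 0) * u 0 + star (v 1) * u 1 = star (v 2) * u 2 := by
      have := hu
      simp only [herm, sgn, if_neg hcp] at this
      push_cast at this
      linear_combination this
    have h4 : ‖v 2‖ * ‖u 2‖ ≤ ‖v 0‖ * ‖u 0‖ + ‖v 1‖ * ‖u 1‖ := by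
      have := norm_add_le (star (v 0) * u 0) (star (v 1) * u 1)
      rw [h3] at this
      simpa using this
    have p2 : 0 < ‖v 2‖ := by
      rcases (norm_nonneg (v 2)).lt_or_eq with h5 | h5
      · exact h5
      · rw [← h5] at h1; nlinarith [sq_nonneg ‖v 0‖, sq_nonneg ‖v 1‖]
    have h5 : (‖v 2‖ * ‖u 2‖) ^ 2 ≤ (‖v 0‖ ^ 2 + ‖v 1‖ ^ 2) * (‖u 0‖ ^ 2 + ‖u 1‖ ^ 2) := by
      calc _ ≤ (‖v 0‖ * ‖u 0‖ + ‖v 1‖ * ‖u 1‖) ^ 2 := by gcongr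
        _ ≤ _ := by nlinarith [sq_nonneg (‖v 0‖ * ‖u 1‖ - ‖v 1‖ * ‖u 0‖)]
    have h6 : 0 < ‖u 0‖ ^ 2 + ‖u 1‖ ^ 2 := by
      rcases (add_nonneg (sq_nonneg ‖u 0‖) (sq_nonneg ‖u 1‖)).lt_or_eq with h7 | h7
      · exact h7
      · rw [← h7, mul_zero] at h5
        have h8 : ‖v 2‖ * ‖u 2‖ = 0 := by nlinarith [sq_nonneg (‖v 2‖ * ‖u 2‖)]
        rcases h2 with h2 | h2
        · exact absurd h7.symm h2
        · exact absurd h8 (mul_ne_zero p2.ne' h2)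
    have h7 : (‖v 2‖ * ‖u 2‖) ^ 2 < ‖v 2‖ ^ 2 * (‖u 0‖ ^ 2 + ‖u 1‖ ^ 2) :=
      h5.trans_lt (by gcongr; linarith)
    rw [mul_pow] at h7
    have := lt_of_mul_lt_mul_left h7 (by positivity)
    linarith

/-- The metric is (4/c) h(Xv, Xv) / h(v, v). The denominator has the sign of c, and Xv is a nonzero
vector orthogonal to v. -/
lemma Spans.metric_pos (hc : c ≠ 0) (h : Spans c v P) (hX : X ∈ tangent c P) (h0 : X ≠ 0) :
    0 < metric c X X := by
  have h1 : X v ≠ 0 := fun h1 => h0 (h.eq_zero_of_apply hX h1)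
  have h2 := h.herm_pos (h.herm_apply hX) h1
  have h3 := h.pos
  rw [h.metric_eq hX hX, h.pair_eq hX.1, Complex.div_re, herm_self_im, herm_self_im]
  have h4 : 0 < Complex.normSq (herm c v v) := Complex.normSq_pos.2 h.herm_ne
  have h5 : 0 < 4 / c * (herm c v v).re := by
    unfold sgn at h3
    split_ifs at h3 with hcp
    · simp at h3; positivity
    · have hcn : c < 0 := lt_of_le_of_ne (not_lt.1 hcp) hc
      simp at h3
      exact mul_pos_of_neg_of_neg (div_neg_of_pos_of_neg (by norm_num) hcn) h3
  have : 4 / c * ((herm c (X v) (X v)).re * (herm c v v).re / Complex.normSq (herm c v v) +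
      0 * 0 / Complex.normSq (herm c v v)) =
      (4 / c * (herm c v v).re) * (herm c (X v) (X v)).re / Complex.normSq (herm c v v) := by ring
  rw [this]
  positivity

/-- X ↦ Xv embeds the tangent space in v^⊥, of complex dimension 2. The upper bound suffices,
because equality is only needed for the image of the immersion, where it follows by counting. -/
lemma Spans.finrank_tangent_le (h : Spans c v P) :
    Module.finrank ℝ (tangentSubmodule c P) ≤ 4 := by
  let T : tangentSubmodule c P →ₗ[ℝ] (LinearMap.ker (hermL c v)) :=
    { toFun := fun X => ⟨X.1 v, h.herm_apply X.2⟩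
      map_add' := fun X Y => rfl
      map_smul' := fun a X => rfl }
  have hT : Function.Injective T := by
    intro X Y hXY
    have h1 : X.1 v = Y.1 v := congrArg Subtype.val hXY
    rw [← sub_eq_zero]
    refine Subtype.ext (h.eq_zero_of_apply (X - Y).2 ?_)
    simp [h1]
  have h1 := LinearMap.finrank_le_finrank_of_injective hT
  have h2 := finrank_real_of_complex (LinearMap.ker (hermL c v))
  have h3 := LinearMap.finrank_range_add_finrank_ker (hermL c v)
  have h4 : LinearMap.range (hermL c v) = ⊤ :=
    LinearMap.range_eq_top.2 (LinearMap.surjective (f := hermL c v)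
      fun h0 => h.herm_ne (DFunLike.congr_fun h0 v))
  rw [h4, finrank_top, Module.finrank_self] at h3
  simp at h3
  omega

/-- The tangent space of a hypersurface with unit normal `N` is the orthogonal complement of
`N`. -/
lemma Spans.exists_preimage (h : Spans c v P) {E : Type*} [AddCommGroup E]
    [Module ℝ E] (hE : Module.finrank ℝ E = 3) {N : EndC3} (hN : N ∈ tangent c P)
    (hN1 : metric c N N = 1) (T : E →ₗ[ℝ] EndC3) (hT : Function.Injective T)
    (hTt : ∀ x, T x ∈ tangent c P) (hTN : ∀ x, metric c N (T x) = 0)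
    (hX : X ∈ tangent c P) (hXN : metric c X N = 0) : ∃ x, T x = X := by
  let K : Submodule ℝ EndC3 := tangentSubmodule c P ⊓ LinearMap.ker (metricB c N).toLinearMap
  have hlt : K < tangentSubmodule c P := by
    refine lt_of_le_of_ne inf_le_left fun h0 => ?_
    have h1 : N ∈ K := by rw [h0]; exact hN
    have h2 : metric c N N = 0 := by rw [← metricB_apply]; exact h1.2
    rw [hN1] at h2
    exact one_ne_zero h2
  have hK : Module.finrank ℝ K ≤ 3 := by
    have := Submodule.finrank_lt_finrank_of_lt hlt
    have := h.finrank_tangent_le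
    omega
  have hle : LinearMap.range T ≤ K := by
    rintro _ ⟨x, rfl⟩
    exact ⟨hTt x, (metricB_apply c N (T x)).trans (hTN x)⟩
  have heq : LinearMap.range T = K :=
    Submodule.eq_of_le_of_finrank_le hle (by
      rw [LinearMap.finrank_range_of_inj hT, hE]; exact hK)
  have : X ∈ K := ⟨hX, (metricB_apply c N X).trans ((metric_comm c N X).trans hXN)⟩
  rw [← heq] at this
  exact this

end SpaceForm

namespace RealHypersurface

variable {c : ℝ} {M : Type*} [TopologicalSpace M] [ChartedSpace (EuclideanSpace ℝ (Fin 3)) M]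
variable (S : RealHypersurface c M)

/-! ### The tangent spaces of the hypersurface -/

lemma smoothFun_f (U : Set M) : SmoothFun S.f U := S.f_smooth.contMDiffOn
lemma smoothFun_N (U : Set M) : SmoothFun S.N U := S.N_smooth.contMDiffOn

lemma mdiff_f (p : M) : MDifferentiableAt (𝓡 3) 𝓘(ℝ, EndC3) S.f p :=
  (S.smoothFun_f Set.univ).mdiff isOpen_univ (Set.mem_univ p)

lemma f_mul_f (p : M) : S.f p * S.f p = S.f p := by
  obtain ⟨v, hv⟩ := exists_spans (S.f_mem p); exact hv.mul_self

/-- The linear functional `X ↦ h(X v, w) - h(v, X w)` measuring the failure of self-adjointness. -/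
def adjDefect (c : ℝ) (v w : C3) : EndC3 →L[ℝ] ℂ :=
  LinearMap.toContinuousLinearMap
    { toFun := fun X => herm c (X v) w - herm c v (X w)
      map_add' := fun X Y => by
        simp only [add_apply, herm_add_left, herm_add_right]; ring
      map_smul' := fun a X => by
        simp only [real_smul_eq, smul_apply, herm_smul_left, herm_smul_right]
        simp; ring }

lemma adjDefect_apply (c : ℝ) (v w : C3) (X : EndC3) :
    adjDefect c v w X = herm c (X v) w - herm c v (X w) := rfl

lemma deriv_selfAdjoint (X : Field M) {V : M → EndC3} {U : Set M} (hU : IsOpen U)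
    (hV : SmoothFun V U) (h : ∀ q ∈ U, ∀ u w, herm c (V q u) w = herm c u (V q w)) {p : M}
    (hp : p ∈ U) (u w : C3) : herm c (deriv X V p u) w = herm c u (deriv X V p w) := by
  have h1 := deriv_clm X (adjDefect c u w) (hV.mdiff hU hp)
  rw [deriv_eq_zero_of_const hU (a := 0)
    (fun q hq => by rw [adjDefect_apply, h q hq, sub_self]) hp, adjDefect_apply] at h1
  exact sub_eq_zero.1 h1.symm

lemma deriv_mulB (X : Field M) {V W : M → EndC3} {p : M}
    (hV : MDifferentiableAt (𝓡 3) 𝓘(ℝ, EndC3) V p) (hW : MDifferentiableAt (𝓡 3) 𝓘(ℝ, EndC3) W p) :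
    deriv X (fun q => V q * W q) p = deriv X V p * W p + V p * deriv X W p := by
  have := deriv_bilin X SpaceForm.mulB hV hW
  simpa only [mulB_apply] using this

lemma SmoothFun.comp_mul {V W : M → EndC3} {U : Set M} (hV : SmoothFun V U) (hW : SmoothFun W U) :
    SmoothFun (fun q => V q * W q) U := by
  have := hV.bilin hW SpaceForm.mulB
  simpa only [mulB_apply] using this

lemma deriv_metric (X : Field M) {V W : M → EndC3} {p : M}
    (hV : MDifferentiableAt (𝓡 3) 𝓘(ℝ, EndC3) V p) (hW : MDifferentiableAt (𝓡 3) 𝓘(ℝ, EndC3) W p) :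
    deriv X (fun q => metric c (V q) (W q)) p =
      metric c (deriv X V p) (W p) + metric c (V p) (deriv X W p) := by
  have := deriv_bilin X (metricB c) hV hW
  simpa only [metricB_apply] using this

lemma SmoothFun.metric {V W : M → EndC3} {U : Set M} (hV : SmoothFun V U) (hW : SmoothFun W U) :
    SmoothFun (fun q => metric c (V q) (W q)) U := by
  have := hV.bilin hW (metricB c)
  simpa only [metricB_apply] using this

/-- The differential of the immersion as a linear map. -/
def dfL (p : M) : TangentSpace (𝓡 3) p →ₗ[ℝ] EndC3 := (mvfderiv (𝓡 3) S.f p).toLinearMap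

lemma dfL_apply (p : M) (X : TangentSpace (𝓡 3) p) : S.dfL p X = S.df p X := rfl

lemma df_mem (p : M) (X : TangentSpace (𝓡 3) p) : S.df p X ∈ tangent c (S.f p) := by
  have hf := S.mdiff_f p
  let X' : Field M := fun _ => (X : EuclideanSpace ℝ (Fin 3))
  have e : S.df p X = deriv X' S.f p := rfl
  rw [e]
  constructor
  · exact deriv_selfAdjoint X' isOpen_univ (S.smoothFun_f _) (fun q _ => by
      obtain ⟨v, hv⟩ := exists_spans (S.f_mem q); exact hv.selfAdjoint) (Set.mem_univ p)
  · have h1 := deriv_mulB X' hf hf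
    rw [deriv_congr isOpen_univ (k := S.f) (fun q _ => S.f_mul_f q) (Set.mem_univ p)] at h1
    rw [add_comm]
    exact h1.symm

lemma exists_df_eq {p : M} {W : EndC3} (hW : W ∈ tangent c (S.f p))
    (hN : metric c W (S.N p) = 0) : ∃ X, S.df p X = W := by
  obtain ⟨v, hv⟩ := exists_spans (S.f_mem p)
  exact hv.exists_preimage (E := TangentSpace (𝓡 3) p) (finrank_euclideanSpace_fin)
    (S.N_tangent p) (S.N_unit p) (S.dfL p) (S.f_immersion p) (S.df_mem p) (S.N_normal p) hW hN

lemma df_injective (p : M) : Function.Injective (S.df p) := S.f_immersion p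

/-- The coordinates of a tangent vector in the standard basis. -/
def coords (p : M) (X : TangentSpace (𝓡 3) p) : Fin 3 → ℝ := WithLp.ofLp (p := 2) (V := Fin 3 → ℝ) X

lemma eq_sum_basisVec (p : M) (X : TangentSpace (𝓡 3) p) :
    X = ∑ i, coords p X i • basisVec p i := by
  have := (EuclideanSpace.basisFun (Fin 3) ℝ).sum_repr (X : EuclideanSpace ℝ (Fin 3))
  simp only [EuclideanSpace.basisFun_apply] at this
  exact this.symm

lemma metric_df_basisVec (p : M) (X : TangentSpace (𝓡 3) p) :
    (fun j => metric c (S.df p X) (S.df p (basisVec p j))) =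
      S.gram p *ᵥ coords p X := by
  ext j
  have h1 : S.df p X = ∑ i, coords p X i • S.df p (basisVec p i) := by
    conv_lhs => rw [eq_sum_basisVec p X]
    simp only [← dfL_apply, map_sum, map_smul]
  rw [h1, metric_comm, ← metricB_apply, map_sum, Matrix.mulVec, dotProduct]
  refine Finset.sum_congr rfl fun i _ => ?_
  rw [metricB_apply, metric_smul_right, mul_comm]
  rfl

lemma isUnit_gram (hc : c ≠ 0) (p : M) : IsUnit (S.gram p) := by
  rw [← Matrix.mulVec_injective_iff_isUnit]
  have h0 : ∀ x : Fin 3 → ℝ, S.gram p *ᵥ x = 0 → x = 0 := by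
    intro x hx
    let X : TangentSpace (𝓡 3) p := (WithLp.toLp 2 x : EuclideanSpace ℝ (Fin 3))
    have h1 := S.metric_df_basisVec p X
    have h2 : (fun j => metric c (S.df p X) (S.df p (basisVec p j))) = 0 := h1.trans hx
    obtain ⟨v, hv⟩ := exists_spans (S.f_mem p)
    have h3 : metric c (S.df p X) (S.df p X) = 0 := by
      nth_rewrite 2 [eq_sum_basisVec p X]
      simp only [← dfL_apply, map_sum, map_smul]
      rw [← metricB_apply, map_sum]
      refine Finset.sum_eq_zero fun i _ => ?_
      rw [metricB_apply, metric_smul_right]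
      have := congrFun h2 i
      simp only [dfL_apply]
      rw [this]; simp
    have h4 : S.df p X = 0 := by
      by_contra h5
      exact (hv.metric_pos hc (S.df_mem p X) h5).ne' h3
    have h5 : X = 0 := S.df_injective p (h4.trans (map_zero (S.dfL p)).symm)
    exact congrArg (WithLp.ofLp (p := 2) (V := Fin 3 → ℝ)) h5
  intro x y hxy
  rw [← sub_eq_zero]
  apply h0
  rw [Matrix.mulVec_sub, sub_eq_zero]
  exact hxy

lemma tan_df (hc : c ≠ 0) {p : M} {W : EndC3} {X : TangentSpace (𝓡 3) p}
    (h : ∀ Y, metric c W (S.df p Y) = metric c (S.df p X) (S.df p Y)) : S.tan p W = X := by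
  have h1 : (fun j => metric c W (S.df p (basisVec p j))) =
      S.gram p *ᵥ coords p X := by
    rw [← S.metric_df_basisVec]; ext j; exact h _
  rw [tan, h1, Matrix.mulVec_mulVec, Matrix.nonsing_inv_mul _
    ((Matrix.isUnit_iff_isUnit_det _).1 (S.isUnit_gram hc p)), Matrix.one_mulVec]
  exact (eq_sum_basisVec p X).symm

lemma df_tan (hc : c ≠ 0) {p : M} {W : EndC3} (hW : W ∈ tangent c (S.f p)) :
    S.df p (S.tan p W) = W - metric c W (S.N p) • S.N p := by
  obtain ⟨X, hX⟩ := S.exists_df_eq (p := p) (W := W - metric c W (S.N p) • S.N p)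
    ((tangentSubmodule c (S.f p)).sub_mem hW
      ((tangentSubmodule c (S.f p)).smul_mem _ (S.N_tangent p)))
    (by rw [metric_sub_left, metric_smul_left, S.N_unit]; ring)
  rw [S.tan_df hc (X := X), hX]
  intro Y
  rw [hX, metric_sub_left, metric_smul_left, show metric c (S.N p) (S.df p Y) = 0 from S.N_normal p Y]
  ring

end RealHypersurface

/-! ### Smoothness of a vector field tested after the immersion. -/

namespace RealHypersurface

variable {c : ℝ} {M : Type*} [TopologicalSpace M] [ChartedSpace (EuclideanSpace ℝ (Fin 3)) M]
variable (S : RealHypersurface c M)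

/-- The vector field along the immersion given by a vector field on `M`. -/
def push (X : Field M) : M → EndC3 := fun q => S.df q (X q)

variable [IsManifold (𝓡 3) ∞ M]

lemma smoothFun_push {X : Field M} {U : Set M} (hU : IsOpen U) (hX : SmoothOn X U) :
    SmoothFun (S.push X) U := (S.smoothFun_f U).deriv hU hX

/-- A vector field is smooth if its image under the differential of the immersion is. -/
lemma smoothOn_of_push {X : Field M} {U : Set M} (hU : IsOpen U)
    (hX : SmoothFun (S.push X) U) : SmoothOn X U := by
  intro p hp
  apply ContMDiffAt.contMDiffWithinAt
  let E := EuclideanSpace ℝ (Fin 3)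
  let e := trivializationAt E (TangentSpace (𝓡 3) : M → Type _) p
  let b := (EuclideanSpace.basisFun (Fin 3) ℝ).toBasis
  have hpe : p ∈ e.baseSet := FiberBundle.mem_baseSet_trivializationAt' p
  let s := e.localFrame b
  have hs : ∀ i, SmoothOn (s i) e.baseSet := fun i =>
    e.contMDiffOn_localFrame_baseSet (I := 𝓡 3) ∞ b i
  have hF : ∀ i, SmoothFun (S.push (s i)) e.baseSet := fun i =>
    S.smoothFun_push e.open_baseSet (hs i)
  let co : Fin 3 → M → ℝ := fun i => LinearMap.piApply (e.localFrameCoeff (𝓡 3) b i) X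
  have hsum : ∀ q ∈ e.baseSet, S.push X q = ∑ i, co i q • S.push (s i) q := by
    intro q hq
    have h1 : X q = ∑ i, co i q • s i q :=
      Bundle.Trivialization.eq_sum_localFrameCoeff_smul (I := 𝓡 3) (e := e) (b := b) hq
    have h2 := congrArg (S.dfL q) h1
    rw [map_sum] at h2
    simp only [map_smul] at h2
    exact h2
  rw [contMDiffAt_iff_localFrameCoeff (I := 𝓡 3) (e := e) b (k := ∞) hpe]
  -- a left inverse of the differential at `p`
  obtain ⟨B, hB⟩ : ∃ B : EndC3 →L[ℝ] E, ∀ i, B (S.push (s i) p) = b i := by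
    have hli : LinearIndependent ℝ (fun i => S.push (s i) p) :=
      ((e.isLocalFrameOn_localFrame_baseSet (𝓡 3) ∞ b).linearIndependent hpe).map' (S.dfL p)
        (LinearMap.ker_eq_bot.2 (S.df_injective p))
    obtain ⟨B, hB⟩ := LinearMap.exists_extend (Finsupp.linearCombination ℝ b ∘ₗ hli.repr)
    refine ⟨LinearMap.toContinuousLinearMap B, fun i => ?_⟩
    have h1 := DFunLike.congr_fun hB ⟨S.push (s i) p, Submodule.subset_span ⟨i, rfl⟩⟩
    refine h1.trans ?_
    rw [LinearMap.comp_apply, hli.repr_eq_single i _ rfl]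
    simp
  let T : Fin 3 → E →L[ℝ] (E →L[ℝ] E) := fun i =>
    ContinuousLinearMap.smulRightL ℝ E E (EuclideanSpace.proj i : E →L[ℝ] ℝ)
  -- `m q` is `B` composed with the differential at `q`, read in the local frame. It is the identity
  -- at `p`, hence invertible nearby, and its inverse recovers the frame coefficients of `X`
  -- smoothly from `S.push X`.
  let m : M → E →L[ℝ] E := fun q => T 0 (B (S.push (s 0) q)) + T 1 (B (S.push (s 1) q)) +
    T 2 (B (S.push (s 2) q))
  have hm : SmoothFun m e.baseSet :=
    ((((hF 0).clm B).clm (T 0)).add (((hF 1).clm B).clm (T 1))).add (((hF 2).clm B).clm (T 2))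
  have hT : ∀ i y x, T i y x = x i • y := fun i y x => rfl
  have hmp : m p = ((1 : (E →L[ℝ] E)ˣ) : E →L[ℝ] E) := by
    ext1 x
    have h1 := (EuclideanSpace.basisFun (Fin 3) ℝ).sum_repr x
    rw [Fin.sum_univ_three] at h1
    simp only [m, add_apply, hT, hB]
    simpa [b] using h1
  have hco : ∀ q ∈ e.baseSet, m q (WithLp.toLp 2 fun i => co i q) = B (S.push X q) := by
    intro q hq
    rw [hsum q hq, Fin.sum_univ_three]
    simp [m, hT]
  have hinv : ContMDiffAt (𝓡 3) 𝓘(ℝ, E →L[ℝ] E) ∞ (fun q => Ring.inverse (m q)) p := by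
    have h1 : ContDiffAt ℝ ∞ Ring.inverse (m p) := by
      rw [hmp]; exact contDiffAt_ringInverse ℝ 1
    exact h1.contMDiffAt.comp p ((hm p hpe).contMDiffAt (e.open_baseSet.mem_nhds hpe))
  have hvec : ContMDiffAt (𝓡 3) 𝓘(ℝ, E) ∞ (fun q => Ring.inverse (m q) (B (S.push X q))) p :=
    hinv.clm_apply ((hX.clm B p hp).contMDiffAt (hU.mem_nhds hp))
  have hunit : ∀ᶠ q in nhds p, IsUnit (m q) := by
    have h1 : IsUnit (m p) := by rw [hmp]; exact Units.isUnit _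
    have h2 : ContinuousAt m p :=
      ((hm p hpe).contMDiffAt (e.open_baseSet.mem_nhds hpe)).continuousAt
    exact h2.eventually (Units.isOpen.mem_nhds h1)
  intro i
  have h1 : ContMDiffAt (𝓡 3) 𝓘(ℝ, ℝ) ∞
      (fun q => (EuclideanSpace.proj i : E →L[ℝ] ℝ) (Ring.inverse (m q) (B (S.push X q)))) p :=
    (EuclideanSpace.proj i : E →L[ℝ] ℝ).contDiff.contMDiff.contMDiffAt.comp p hvec
  refine h1.congr_of_eventuallyEq ?_
  filter_upwards [hunit, e.open_baseSet.mem_nhds hpe] with q hq1 hq2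
  rw [← hco q hq2, ← mul_apply_eq_comp, Ring.inverse_mul_cancel _ hq1]
  rfl

end RealHypersurface

/-! ### Covariant derivative along the immersion and the curvature of the plane. -/

namespace RealHypersurface

variable {c : ℝ} {M : Type*} [TopologicalSpace M] [ChartedSpace (EuclideanSpace ℝ (Fin 3)) M]
variable (S : RealHypersurface c M)

section smooth
variable {F : Type*} [NormedAddCommGroup F] [NormedSpace ℝ F] {V W : M → F} {U : Set M}

lemma SmoothFun.fun_add (hV : SmoothFun V U) (hW : SmoothFun W U) :
    SmoothFun (fun q => V q + W q) U := ContMDiffOn.add hV hW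

lemma SmoothFun.fun_sub (hV : SmoothFun V U) (hW : SmoothFun W U) :
    SmoothFun (fun q => V q - W q) U := ContMDiffOn.sub hV hW

lemma SmoothFun.const (a : F) : SmoothFun (fun _ : M => a) U := contMDiffOn_const

lemma SmoothFun.fun_smul {a : M → ℝ} (ha : SmoothFun a U) (hV : SmoothFun V U) :
    SmoothFun (fun q => a q • V q) U := ha.bilin hV (ContinuousLinearMap.lsmul ℝ ℝ)

end smooth

/-- A smooth vector field along the immersion, tangent to the plane. -/
structure TangentAlong (V : M → EndC3) (U : Set M) : Prop where
  smooth : SmoothFun V U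
  mem : ∀ q ∈ U, V q ∈ tangent c (S.f q)

/-- The covariant derivative of a vector field along the immersion. -/
def cov (X : Field M) (V : M → EndC3) : M → EndC3 := fun q => S.ambientNabla q (X q) V

lemma cov_apply (X : Field M) (V : M → EndC3) (q : M) :
    S.cov X V q = offDiag (S.f q) (deriv X V q) := rfl

lemma exists_spans_f (p : M) : ∃ v, Spans c v (S.f p) := exists_spans (S.f_mem p)

lemma tangentAlong_N (U : Set M) : S.TangentAlong S.N U :=
  ⟨S.smoothFun_N U, fun q _ => S.N_tangent q⟩

namespace TangentAlong
variable {S} {V W : M → EndC3} {U : Set M}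

lemma mdiff (hV : S.TangentAlong V U) (hU : IsOpen U) {p : M} (hp : p ∈ U) :
    MDifferentiableAt (𝓡 3) 𝓘(ℝ, EndC3) V p := hV.smooth.mdiff hU hp

lemma add (hV : S.TangentAlong V U) (hW : S.TangentAlong W U) :
    S.TangentAlong (fun q => V q + W q) U :=
  ⟨hV.smooth.fun_add hW.smooth, fun q hq =>
    (tangentSubmodule c (S.f q)).add_mem (hV.mem q hq) (hW.mem q hq)⟩

lemma smul {a : M → ℝ} (ha : SmoothFun a U) (hV : S.TangentAlong V U) :
    S.TangentAlong (fun q => a q • V q) U :=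
  ⟨ha.fun_smul hV.smooth, fun q hq =>
    (tangentSubmodule c (S.f q)).smul_mem _ (hV.mem q hq)⟩

end TangentAlong

/-- The complex linear multiplication by `i` as a real linear map. -/
def mulI : EndC3 →L[ℝ] EndC3 :=
  LinearMap.toContinuousLinearMap
    { toFun := fun X => Complex.I • X
      map_add' := fun X Y => smul_add _ X Y
      map_smul' := fun a X => by
        rw [RingHom.id_apply, real_smul_eq, real_smul_eq, smul_comm] }

lemma TangentAlong.J {V : M → EndC3} {U : Set M} (hV : S.TangentAlong V U) :
    S.TangentAlong (fun q => J (S.f q) (V q)) U := by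
  constructor
  · have hf := S.smoothFun_f U
    exact ((hV.smooth.comp_mul hf).fun_sub (hf.comp_mul hV.smooth)).clm mulI
  · intro q hq
    obtain ⟨v, hv⟩ := S.exists_spans_f q
    exact hv.J_mem (hV.mem q hq)

section ring
variable {A : Type*} [Ring A] [Algebra ℂ A] {p x v w : A}

/-- This is ∇J = 0: differentiating `p` inside `J` only adds a multiple of vx − xv, which is block
diagonal and is removed by `offDiag`. -/
lemma ring_cov_J (hp : p * p = p) (hx : p * x + x * p = x) (hv : p * v + v * p = v) :
    offDiag p (Complex.I • ((w * p + v * x) - (x * v + p * w))) =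
      Complex.I • (offDiag p w * p - p * offDiag p w) := by
  have e1 : p * (p * w) = p * w := by rw [← mul_assoc, hp]
  have e2 : w * p * p = w * p := by rw [mul_assoc, hp]
  have e3 : p * (p * w * p) = p * w * p := by rw [mul_assoc p w p, ← mul_assoc, hp]
  have e4 : p * w * p * p = p * w * p := by rw [mul_assoc, hp]
  have e5 : p * (w * p) = p * w * p := by rw [mul_assoc]
  have f1 := comm_of_mem hx hv
  have f2 := comm_of_mem hv hx
  have e6 : x * v * p * p = x * v * p := by rw [mul_assoc, hp]
  have e7 : v * x * p * p = v * x * p := by rw [mul_assoc, hp]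
  simp only [offDiag, mul_sub, sub_mul, mul_add, add_mul, mul_smul_comm, smul_mul_assoc, e1, e2,
    e3, e4, e5, f1, f2, e6, e7]
  module

end ring

variable [IsManifold (𝓡 3) ∞ M]

section cov
variable {S} {X Y : Field M} {V W : M → EndC3} {U : Set M} (hU : IsOpen U)
include hU

lemma tangentAlong_push (hX : SmoothOn X U) : S.TangentAlong (S.push X) U :=
  ⟨S.smoothFun_push hU hX, fun q _ => S.df_mem q (X q)⟩

omit [IsManifold (𝓡 3) ∞ M] in
lemma cov_mem (hV : S.TangentAlong V U) {p : M} (hp : p ∈ U) :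
    S.cov X V p ∈ tangent c (S.f p) := by
  obtain ⟨v, hv⟩ := S.exists_spans_f p
  exact hv.tangentProj_mem
    (deriv_selfAdjoint X hU hV.smooth (fun q hq => (hV.mem q hq).1) hp)

lemma tangentAlong_cov (hX : SmoothOn X U) (hV : S.TangentAlong V U) :
    S.TangentAlong (S.cov X V) U := by
  refine ⟨?_, fun q hq => cov_mem hU hV hq⟩
  have hf := S.smoothFun_f U
  have hd := hV.smooth.deriv hU hX
  have h1 := ((hf.comp_mul hd).fun_add (hd.comp_mul hf)).fun_add
    (((hf.comp_mul hd).comp_mul hf).clm ((-2 : ℝ) • ContinuousLinearMap.id ℝ EndC3))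
  refine h1.congr fun q _ => ?_
  rw [cov_apply, offDiag_eq_add]
  refine congrArg (S.f q * deriv X V q + deriv X V q * S.f q + ·) ?_
  have h2 := real_smul_eq (-2) (S.f q * deriv X V q * S.f q)
  rw [Complex.ofReal_neg, Complex.ofReal_ofNat] at h2
  exact h2.symm

-- The second summand is the second fundamental form of the plane in the flat space `EndC3`; it is
-- symmetric in the two tangent vectors.
omit [IsManifold (𝓡 3) ∞ M] in
lemma deriv_eq_cov_add (hV : S.TangentAlong V U) {p : M} (hp : p ∈ U) :
    deriv X V p = S.cov X V p +
      (1 - S.f p - S.f p) * (S.push X p * V p + V p * S.push X p) := by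
  have h1 := hV.mdiff hU hp
  refine offDiag_of_deriv (S.f_mul_f p) (S.df_mem p (X p)).2 (hV.mem p hp).2 ?_
  have h2 : deriv X (fun q => S.f q * V q + V q * S.f q) p = deriv X V p :=
    deriv_congr hU (fun q hq => (hV.mem q hq).2) hp
  have hf := S.smoothFun_f U
  rw [deriv_add X ((hf.comp_mul hV.smooth).mdiff hU hp) ((hV.smooth.comp_mul hf).mdiff hU hp),
    deriv_mulB X (S.mdiff_f p) h1, deriv_mulB X h1 (S.mdiff_f p)] at h2
  exact h2

omit [IsManifold (𝓡 3) ∞ M] in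
lemma metric_cov (hV : S.TangentAlong V U) (hW : S.TangentAlong W U) {p : M} (hp : p ∈ U) :
    deriv X (fun q => metric c (V q) (W q)) p =
      metric c (S.cov X V p) (W p) + metric c (V p) (S.cov X W p) := by
  obtain ⟨v, hv⟩ := S.exists_spans_f p
  rw [deriv_metric X (hV.mdiff hU hp) (hW.mdiff hU hp)]
  rw [metric_comm c (V p) (S.cov X W p), metric_comm c (V p)]
  congr 1
  · exact (hv.metric_tangentProj (hW.mem p hp)).symm
  · exact (hv.metric_tangentProj (hV.mem p hp)).symm

omit [IsManifold (𝓡 3) ∞ M] in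
lemma cov_J (hV : S.TangentAlong V U) {p : M} (hp : p ∈ U) :
    S.cov X (fun q => J (S.f q) (V q)) p = J (S.f p) (S.cov X V p) := by
  have hf := S.smoothFun_f U
  have h1 := hV.smooth.comp_mul hf
  have h2 := hf.comp_mul hV.smooth
  have h3 : deriv X (fun q => J (S.f q) (V q)) p = Complex.I •
      ((deriv X V p * S.f p + V p * S.push X p) - (S.push X p * V p + S.f p * deriv X V p)) := by
    have h4 := deriv_clm X mulI ((h1.fun_sub h2).mdiff hU hp)
    have h5 := deriv_sub X (h1.mdiff hU hp) (h2.mdiff hU hp)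
    rw [deriv_mulB X (hV.mdiff hU hp) (S.mdiff_f p), deriv_mulB X (S.mdiff_f p) (hV.mdiff hU hp)]
      at h5
    exact h4.trans (congrArg mulI h5)
  rw [cov_apply, h3]
  exact ring_cov_J (S.f_mul_f p) (S.df_mem p (X p)).2 (hV.mem p hp).2

omit [IsManifold (𝓡 3) ∞ M] in
lemma cov_add (hV : S.TangentAlong V U) (hW : S.TangentAlong W U) {p : M} (hp : p ∈ U) :
    S.cov X (fun q => V q + W q) p = S.cov X V p + S.cov X W p := by
  rw [cov_apply, deriv_add X (hV.mdiff hU hp) (hW.mdiff hU hp), offDiag_add]; rfl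

omit [IsManifold (𝓡 3) ∞ M] in
lemma cov_smul {a : M → ℝ} (ha : SmoothFun a U) (hV : S.TangentAlong V U) {p : M} (hp : p ∈ U) :
    S.cov X (fun q => a q • V q) p = deriv X a p • V p + a p • S.cov X V p := by
  obtain ⟨v, hv⟩ := S.exists_spans_f p
  have h0 : ∀ (r : ℝ) (Z : EndC3), offDiag (S.f p) (r • Z) = r • offDiag (S.f p) Z := by
    intro r Z
    have e1 : S.f p * (r • Z) = r • (S.f p * Z) := by
      simp only [← mulB_apply, map_smul]
    have e2 : ∀ Z : EndC3, (r • Z) * S.f p = r • (Z * S.f p) := fun Z => by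
      simp only [← mulB_apply, map_smul, smul_apply]
    rw [offDiag, e1, e2, e2, offDiag, smul_sub, smul_add, smul_comm]
  rw [cov_apply, deriv_smul X (ha.mdiff hU hp) (hV.mdiff hU hp), offDiag_add, h0, h0]
  congr 2
  exact hv.tangentProj_eq_self (hV.mem p hp)

lemma push_mlieBracket (hX : SmoothOn X U) (hY : SmoothOn Y U) {p : M} (hp : p ∈ U) :
    S.push (VectorField.mlieBracket (𝓡 3) X Y) p =
      deriv X (S.push Y) p - deriv Y (S.push X) p :=
  deriv_mlieBracket hU hX hY (S.smoothFun_f U) hp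

lemma push_mlieBracket_eq_cov (hX : SmoothOn X U) (hY : SmoothOn Y U) {p : M} (hp : p ∈ U) :
    S.push (VectorField.mlieBracket (𝓡 3) X Y) p = S.cov X (S.push Y) p - S.cov Y (S.push X) p := by
  obtain ⟨v, hv⟩ := S.exists_spans_f p
  rw [cov_apply, cov_apply, ← offDiag_sub, ← push_mlieBracket hU hX hY hp]
  exact (hv.tangentProj_eq_self (S.df_mem p _)).symm

/-- The curvature of the plane along the hypersurface. -/
theorem cov_cov_sub (hc : c ≠ 0) (hX : SmoothOn X U) (hY : SmoothOn Y U)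
    (hV : S.TangentAlong V U) {p : M} (hp : p ∈ U) :
    S.cov X (S.cov Y V) p - S.cov Y (S.cov X V) p -
      S.cov (VectorField.mlieBracket (𝓡 3) X Y) V p =
        curvature c (S.f p) (S.push X p) (S.push Y p) (V p) := by
  obtain ⟨v, hv⟩ := S.exists_spans_f p
  have hf := S.smoothFun_f U
  have tV := hV.mem p hp
  have tX : S.push X p ∈ tangent c (S.f p) := S.df_mem p (X p)
  have tY : S.push Y p ∈ tangent c (S.f p) := S.df_mem p (Y p)
  -- The inner covariant derivative is the flat derivative minus the second fundamental form; this
  -- expression is differentiated by the product rule.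
  have expand : ∀ {X Y : Field M}, SmoothOn X U → SmoothOn Y U →
      S.cov X (S.cov Y V) p = offDiag (S.f p) (deriv X (deriv Y V) p -
        ((- S.push X p - S.push X p) * (S.push Y p * V p + V p * S.push Y p) +
          (1 - S.f p - S.f p) * (deriv X (S.push Y) p * V p + S.push Y p * deriv X V p +
            (deriv X V p * S.push Y p + V p * deriv X (S.push Y) p)))) := by
    intro X Y hX hY
    have hy := S.smoothFun_push hU hY
    have s1 : SmoothFun (fun q => 1 - S.f q - S.f q) U := ((SmoothFun.const 1).fun_sub hf).fun_sub hf
    have s2 := hy.comp_mul hV.smooth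
    have s3 := hV.smooth.comp_mul hy
    have s4 := s2.fun_add s3
    have s5 := s1.comp_mul s4
    have s6 := hV.smooth.deriv hU hY
    have e1 : deriv X (S.cov Y V) p = deriv X (fun q => deriv Y V q -
        (1 - S.f q - S.f q) * (S.push Y q * V q + V q * S.push Y q)) p :=
      deriv_congr hU (fun q hq => by
        show S.cov Y V q = _
        rw [deriv_eq_cov_add hU hV hq]; abel) hp
    have e2 : deriv X (fun q => 1 - S.f q - S.f q) p = - S.push X p - S.push X p := by
      rw [deriv_sub X (((SmoothFun.const 1).fun_sub hf).mdiff hU hp)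
        (hf.mdiff hU hp), deriv_sub X ((SmoothFun.const 1).mdiff hU hp) (hf.mdiff hU hp),
        deriv_eq_zero_of_const hU (fun _ _ => rfl) hp, zero_sub]
      rfl
    rw [cov_apply, e1, deriv_sub X (s6.mdiff hU hp) (s5.mdiff hU hp),
      deriv_mulB X (s1.mdiff hU hp) (s4.mdiff hU hp), e2,
      deriv_add X (s2.mdiff hU hp) (s3.mdiff hU hp),
      deriv_mulB X (hy.mdiff hU hp) (hV.mdiff hU hp),
      deriv_mulB X (hV.mdiff hU hp) (hy.mdiff hU hp)]
  have hb := S.df_mem p (VectorField.mlieBracket (𝓡 3) X Y p)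
  have hb' : deriv X (S.push Y) p - deriv Y (S.push X) p ∈ tangent c (S.f p) := by
    rw [← push_mlieBracket hU hX hY hp]; exact hb
  rw [expand hX hY, expand hY hX, cov_apply, deriv_mlieBracket hU hX hY hV.smooth hp,
    ← hv.bracket_eq_curvature hc tX tY tV]
  exact ring_curvature (S.f_mul_f p) tX.2 tY.2 tV.2 hb'.2
    (cov_mem hU hV hp : S.cov X V p ∈ _).2 (cov_mem hU hV hp : S.cov Y V p ∈ _).2
    (deriv_eq_cov_add hU hV hp) (deriv_eq_cov_add hU hV hp)

end cov

end RealHypersurface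

/-! ### Shape operator, induced connection and the Gauss equation. -/

namespace RealHypersurface

variable {c : ℝ} {M : Type*} [TopologicalSpace M] [ChartedSpace (EuclideanSpace ℝ (Fin 3)) M]
variable (S : RealHypersurface c M)

lemma offDiag_real_smul (P : EndC3) (r : ℝ) (Z : EndC3) :
    offDiag P (r • Z) = r • offDiag P Z := by
  have e1 : P * (r • Z) = r • (P * Z) := by simp only [← mulB_apply, map_smul]
  have e2 : ∀ Z : EndC3, (r • Z) * P = r • (Z * P) := fun Z => by
    simp only [← mulB_apply, map_smul, smul_apply]
  rw [offDiag, e1, e2, e2, offDiag, smul_sub, smul_add, smul_comm]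

/-- The covariant derivative at a point as a linear function of the direction. -/
def covL (p : M) (V : M → EndC3) : TangentSpace (𝓡 3) p →ₗ[ℝ] EndC3 where
  toFun X := S.ambientNabla p X V
  map_add' X Y := by
    simp only [ambientNabla, map_add, tangentProj_eq_offDiag, offDiag_add]
  map_smul' r X := by
    simp only [ambientNabla, map_smul, tangentProj_eq_offDiag, offDiag_real_smul, RingHom.id_apply]

lemma covL_apply (p : M) (V : M → EndC3) (X : Field M) : S.covL p V (X p) = S.cov X V p := rfl

variable {S} {X Y Z : Field M} {U : Set M} {p : M}

lemma cov_congr {V W : M → EndC3} (hU : IsOpen U) (e : Set.EqOn V W U) (hp : p ∈ U) :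
    S.cov X V p = S.cov X W p := by
  rw [cov_apply, cov_apply, deriv_congr hU e hp]

lemma metric_push_N (X : Field M) (p : M) : metric c (S.push X p) (S.N p) = 0 :=
  (metric_comm c _ _).trans (S.N_normal p (X p))

lemma metric_cov_N_N (p : M) : metric c (S.cov X S.N p) (S.N p) = 0 := by
  have h1 := metric_cov (X := X) isOpen_univ (S.tangentAlong_N Set.univ)
    (S.tangentAlong_N Set.univ) (Set.mem_univ p)
  rw [deriv_eq_zero_of_const isOpen_univ (fun q _ => S.N_unit q) (Set.mem_univ p),
    metric_comm c (S.N p)] at h1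
  linarith

lemma cov_N_mem (X : Field M) (p : M) : S.cov X S.N p ∈ tangent c (S.f p) :=
  cov_mem isOpen_univ (S.tangentAlong_N Set.univ) (Set.mem_univ p)

lemma df_A (hc : c ≠ 0) (X : Field M) (p : M) : S.df p (S.A p (X p)) = - S.cov X S.N p := by
  have h1 : -S.ambientNabla p (X p) S.N ∈ tangent c (S.f p) :=
    (tangentSubmodule c (S.f p)).neg_mem (S.cov_N_mem X p)
  rw [A, S.df_tan hc h1, metric_neg_left]
  have h2 : metric c (S.ambientNabla p (X p) S.N) (S.N p) = 0 := metric_cov_N_N (X := X) p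
  rw [h2]
  show -S.cov X S.N p - _ = _
  module

lemma metric_J_N_N (hc : c ≠ 0) (p : M) : metric c (J (S.f p) (S.N p)) (S.N p) = 0 := by
  obtain ⟨v, hv⟩ := S.exists_spans_f p
  have h1 := hv.metric_J_left hc (S.N_tangent p) (S.N_tangent p)
  rw [metric_comm c (S.N p)] at h1
  linarith

lemma push_xi (hc : c ≠ 0) (p : M) : S.push S.xi p = - J (S.f p) (S.N p) := by
  obtain ⟨v, hv⟩ := S.exists_spans_f p
  have h1 : -J (S.f p) (S.N p) ∈ tangent c (S.f p) :=
    (tangentSubmodule c (S.f p)).neg_mem (hv.J_mem (S.N_tangent p))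
  rw [push, xi, S.df_tan hc h1, metric_neg_left, metric_J_N_N hc]
  module

variable [IsManifold (𝓡 3) ∞ M]

lemma metric_cov_push_N (hU : IsOpen U) (hY : SmoothOn Y U) (hp : p ∈ U) :
    metric c (S.cov X (S.push Y) p) (S.N p) = - metric c (S.push Y p) (S.cov X S.N p) := by
  have h1 := metric_cov (X := X) hU (tangentAlong_push (S := S) hU hY) (S.tangentAlong_N U) hp
  rw [deriv_eq_zero_of_const hU (fun q _ => metric_push_N Y q) hp] at h1
  linarith

lemma push_nabla (hc : c ≠ 0) (hU : IsOpen U) (hY : SmoothOn Y U) (hp : p ∈ U) :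
    S.push (S.nabla X Y) p = S.cov X (S.push Y) p +
      metric c (S.push Y p) (S.cov X S.N p) • S.N p := by
  have h1 : S.push (S.nabla X Y) p = S.cov X (S.push Y) p -
      metric c (S.cov X (S.push Y) p) (S.N p) • S.N p :=
    S.df_tan hc (cov_mem hU (tangentAlong_push hU hY) hp)
  rw [h1, metric_cov_push_N hU hY hp, sub_eq_add_neg]
  module

/-- The Gauss equation. -/
theorem push_R (hc : c ≠ 0) (hU : IsOpen U) (hX : SmoothOn X U) (hY : SmoothOn Y U)
    (hZ : SmoothOn Z U) (hp : p ∈ U) :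
    S.push (S.R X Y Z) p =
      curvature c (S.f p) (S.push X p) (S.push Y p) (S.push Z p)
        - metric c (curvature c (S.f p) (S.push X p) (S.push Y p) (S.push Z p)) (S.N p) • S.N p
        + metric c (S.push Z p) (S.cov Y S.N p) • S.cov X S.N p
        - metric c (S.push Z p) (S.cov X S.N p) • S.cov Y S.N p := by
  have tz := tangentAlong_push (S := S) hU hZ
  have tN := S.tangentAlong_N U
  -- The inner ∇ differs from the ambient derivative by a multiple of N. Differentiating that
  -- multiple gives a normal term, lost in the projection, and the tangential term that becomes the
  -- quadratic part in A.
  have second : ∀ {X Y : Field M}, SmoothOn X U → SmoothOn Y U →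
      S.push (S.nabla X (S.nabla Y Z)) p = S.cov X (S.cov Y (S.push Z)) p
        - metric c (S.cov X (S.cov Y (S.push Z)) p) (S.N p) • S.N p
        + metric c (S.push Z p) (S.cov Y S.N p) • S.cov X S.N p := by
    intro X Y hX hY
    have ha : SmoothFun (fun q => metric c (S.push Z q) (S.cov Y S.N q)) U :=
      tz.smooth.metric (tangentAlong_cov hU hY tN).smooth
    have tc := tangentAlong_cov hU hY tz
    have h1 : S.cov X (S.push (S.nabla Y Z)) p = S.cov X (S.cov Y (S.push Z)) p +
        (deriv X (fun q => metric c (S.push Z q) (S.cov Y S.N q)) p • S.N p +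
          metric c (S.push Z p) (S.cov Y S.N p) • S.cov X S.N p) := by
      rw [← cov_smul hU ha tN hp, ← cov_add hU tc (tN.smul ha) hp]
      exact cov_congr hU (fun q hq => push_nabla hc hU hZ hq) hp
    have h2 : S.push (S.nabla X (S.nabla Y Z)) p = S.cov X (S.push (S.nabla Y Z)) p -
        metric c (S.cov X (S.push (S.nabla Y Z)) p) (S.N p) • S.N p := by
      refine S.df_tan hc ?_
      show S.cov X (S.push (S.nabla Y Z)) p ∈ _
      rw [cov_congr hU (fun q hq => push_nabla hc hU hZ hq) hp]
      exact cov_mem hU (tc.add (tN.smul ha)) hp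
    rw [h2, h1]
    simp only [metric_add_left, metric_smul_left, S.N_unit, metric_cov_N_N]
    module
  have h3 : S.push (S.R X Y Z) p = S.push (S.nabla X (S.nabla Y Z)) p -
      S.push (S.nabla Y (S.nabla X Z)) p -
      S.push (S.nabla (VectorField.mlieBracket (𝓡 3) X Y) Z) p := by
    exact (map_sub (S.dfL p) (S.nabla X (S.nabla Y Z) p - S.nabla Y (S.nabla X Z) p)
      (S.nabla (VectorField.mlieBracket (𝓡 3) X Y) Z p)).trans
      (congrArg (· - _) (map_sub (S.dfL p) _ _))
  rw [h3, second hX hY, second hY hX, push_nabla hc hU hZ hp,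
    ← cov_cov_sub hU hc hX hY tz hp]
  simp only [metric_sub_left, metric_cov_push_N hU hZ hp]
  module

end RealHypersurface

section ring
variable {A : Type*} [Ring A] [Algebra ℂ A]

lemma ring_J_neg (p x : A) :
    Complex.I • (-x * p - p * -x) = -(Complex.I • (x * p - p * x)) := by
  rw [← smul_neg]; congr 1; noncomm_ring

end ring

lemma SpaceForm.J_neg (P X : EndC3) : J P (-X) = -J P X := ring_J_neg P X

/-! ### Adapted frames: connection coefficients, Codazzi and Gauss equations. -/

namespace RealHypersurface

variable {c : ℝ} {M : Type*} [TopologicalSpace M] [ChartedSpace (EuclideanSpace ℝ (Fin 3)) M]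
  [IsManifold (𝓡 3) ∞ M]

/-- A smooth orthonormal frame `ξ`, `U`, `JU` of a real hypersurface on an open set. -/
structure AdaptedFrame (S : RealHypersurface c M) (Ω : Set M) where
  /-- the frame fields -/
  E : Fin 3 → Field M
  c_ne : c ≠ 0
  isOpen : IsOpen Ω
  smooth : ∀ i, SmoothOn (E i) Ω
  push_zero : ∀ q ∈ Ω, S.push (E 0) q = -J (S.f q) (S.N q)
  push_two : ∀ q ∈ Ω, S.push (E 2) q = J (S.f q) (S.push (E 1) q)
  unit : ∀ q ∈ Ω, metric c (S.push (E 1) q) (S.push (E 1) q) = 1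
  orth : ∀ q ∈ Ω, metric c (S.push (E 0) q) (S.push (E 1) q) = 0

namespace AdaptedFrame
variable {S : RealHypersurface c M} {Ω : Set M} (𝓕 : AdaptedFrame S Ω)

/-- The frame fields as fields along the immersion. -/
def e (i : Fin 3) : M → EndC3 := S.push (𝓕.E i)

/-- The derivative along a frame field. -/
def D (i : Fin 3) (h : M → ℝ) : M → ℝ := deriv (𝓕.E i) h

/-- The matrix of the shape operator. -/
def a (i j : Fin 3) (q : M) : ℝ := -metric c (S.cov (𝓕.E i) S.N q) (𝓕.e j q)

/-- The connection coefficients. -/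
def Γ (i k l : Fin 3) (q : M) : ℝ := metric c (S.cov (𝓕.E i) (𝓕.e k) q) (𝓕.e l q)

lemma tangentAlong_e (i : Fin 3) : S.TangentAlong (𝓕.e i) Ω :=
  tangentAlong_push 𝓕.isOpen (𝓕.smooth i)

lemma smooth_a (i j : Fin 3) : SmoothFun (𝓕.a i j) Ω := by
  have h0 : SmoothFun (fun q => metric c (S.cov (𝓕.E i) S.N q) (𝓕.e j q)) Ω :=
    SmoothFun.metric (c := c)
      (tangentAlong_cov 𝓕.isOpen (𝓕.smooth i) (S.tangentAlong_N Ω)).smooth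
      (𝓕.tangentAlong_e j).smooth
  exact h0.clm (-(ContinuousLinearMap.id ℝ ℝ))

lemma smooth_Γ (i k l : Fin 3) : SmoothFun (𝓕.Γ i k l) Ω :=
  SmoothFun.metric (c := c)
    (tangentAlong_cov 𝓕.isOpen (𝓕.smooth i) (𝓕.tangentAlong_e k)).smooth
    (𝓕.tangentAlong_e l).smooth

lemma metric_N_e (i : Fin 3) (q : M) : metric c (S.N q) (𝓕.e i q) = 0 := S.N_normal q _

lemma metric_e_N (i : Fin 3) (q : M) : metric c (𝓕.e i q) (S.N q) = 0 := metric_push_N _ q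

include 𝓕 in
lemma metric_J_J {q : M} {X Y : EndC3} (hX : X ∈ tangent c (S.f q)) (hY : Y ∈ tangent c (S.f q)) :
    metric c (J (S.f q) X) Y = -metric c X (J (S.f q) Y) := by
  obtain ⟨v, hv⟩ := S.exists_spans_f q
  exact hv.metric_J_left 𝓕.c_ne hX hY

variable {q : M} (hq : q ∈ Ω)
include 𝓕 hq

lemma e_zero : 𝓕.e 0 q = -J (S.f q) (S.N q) := 𝓕.push_zero q hq
lemma J_e_one : J (S.f q) (𝓕.e 1 q) = 𝓕.e 2 q := (𝓕.push_two q hq).symm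
lemma J_N : J (S.f q) (S.N q) = -𝓕.e 0 q := by rw [𝓕.e_zero hq, neg_neg]
lemma J_e_two : J (S.f q) (𝓕.e 2 q) = -𝓕.e 1 q := by
  obtain ⟨v, hv⟩ := S.exists_spans_f q
  rw [← 𝓕.J_e_one hq, hv.J_J ((𝓕.tangentAlong_e 1).mem q hq)]
lemma J_e_zero : J (S.f q) (𝓕.e 0 q) = S.N q := by
  obtain ⟨v, hv⟩ := S.exists_spans_f q
  have h1 := hv.J_J (S.N_tangent q)
  rw [𝓕.J_N hq] at h1
  rw [J_neg] at h1
  exact neg_injective h1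

/-- Everything follows from |U| = 1 and U ⊥ ξ, because `J` is skew, JU is the third frame field and
Jξ = N. -/
lemma metric_e (i j : Fin 3) : metric c (𝓕.e i q) (𝓕.e j q) = if i = j then 1 else 0 := by
  have t := fun i => (𝓕.tangentAlong_e i).mem q hq
  have tN := S.N_tangent q
  have h11 : metric c (𝓕.e 1 q) (𝓕.e 1 q) = 1 := 𝓕.unit q hq
  have h01 : metric c (𝓕.e 0 q) (𝓕.e 1 q) = 0 := 𝓕.orth q hq
  have h00 : metric c (𝓕.e 0 q) (𝓕.e 0 q) = 1 := by
    have := 𝓕.metric_J_J tN (t 0)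
    rw [𝓕.J_N hq, 𝓕.J_e_zero hq, metric_neg_left, S.N_unit] at this
    linarith
  have h02 : metric c (𝓕.e 0 q) (𝓕.e 2 q) = 0 := by
    have := 𝓕.metric_J_J (t 0) (t 1)
    rw [𝓕.J_e_zero hq, 𝓕.J_e_one hq, 𝓕.metric_N_e] at this
    linarith
  have h12 : metric c (𝓕.e 1 q) (𝓕.e 2 q) = 0 := by
    have := 𝓕.metric_J_J (t 1) (t 1)
    rw [𝓕.J_e_one hq, metric_comm c (𝓕.e 2 q)] at this
    linarith
  have h22 : metric c (𝓕.e 2 q) (𝓕.e 2 q) = 1 := by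
    have := 𝓕.metric_J_J (t 1) (t 2)
    rw [𝓕.J_e_one hq, 𝓕.J_e_two hq, metric_neg_right, h11] at this
    linarith
  fin_cases i <;> fin_cases j <;>
    simp [h00, h11, h22, h01, h02, h12, metric_comm c (𝓕.e 1 q) (𝓕.e 0 q),
      metric_comm c (𝓕.e 2 q) (𝓕.e 0 q), metric_comm c (𝓕.e 2 q) (𝓕.e 1 q)]

lemma metric_sum_e (x : Fin 3 → ℝ) (j : Fin 3) :
    metric c (∑ i, x i • 𝓕.e i q) (𝓕.e j q) = x j := by
  rw [Fin.sum_univ_three]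
  simp only [metric_add_left, metric_smul_left, 𝓕.metric_e hq]
  fin_cases j <;> simp

/-- Expansion of a tangent vector in the frame. -/
lemma field_eq_sum (X : TangentSpace (𝓡 3) q) :
    X = ∑ i, metric c (S.df q X) (𝓕.e i q) • 𝓕.E i q := by
  have hli : LinearIndependent ℝ (fun i => 𝓕.E i q) := by
    rw [Fintype.linearIndependent_iff]
    intro x hx i
    have h1 := congrArg (S.dfL q) hx
    rw [map_sum, map_zero] at h1
    simp only [map_smul] at h1
    have h2 := 𝓕.metric_sum_e hq x i
    have h3 : ∑ i, x i • 𝓕.e i q = 0 := h1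
    rw [h3, metric_zero_left] at h2
    exact h2.symm
  have hspan := hli.span_eq_top_of_card_eq_finrank
    (by rw [Fintype.card_fin]; exact (finrank_euclideanSpace_fin (𝕜 := ℝ) (n := 3)).symm)
  have hX : X ∈ Submodule.span ℝ (Set.range fun i => 𝓕.E i q) := by rw [hspan]; trivial
  obtain ⟨x, hx⟩ := (Submodule.mem_span_range_iff_exists_fun ℝ).1 hX
  have h1 := congrArg (S.dfL q) hx
  rw [map_sum] at h1
  simp only [map_smul] at h1
  have h3 : ∑ i, x i • 𝓕.e i q = S.df q X := h1
  have h4 : ∀ i, metric c (S.df q X) (𝓕.e i q) = x i := fun i => by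
    rw [← h3, 𝓕.metric_sum_e hq]
  rw [Finset.sum_congr rfl fun i _ => congrArg (· • 𝓕.E i q) (h4 i)]
  exact hx.symm

lemma eq_sum {W : EndC3} (hW : W ∈ tangent c (S.f q)) :
    W = (∑ i, metric c W (𝓕.e i q) • 𝓕.e i q) + metric c W (S.N q) • S.N q := by
  have h0 : W - metric c W (S.N q) • S.N q ∈ tangent c (S.f q) :=
    (tangentSubmodule c (S.f q)).sub_mem hW
      ((tangentSubmodule c (S.f q)).smul_mem _ (S.N_tangent q))
  obtain ⟨X, hX⟩ := S.exists_df_eq h0 (by rw [metric_sub_left, metric_smul_left, S.N_unit]; ring)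
  have h1 := congrArg (S.dfL q) (𝓕.field_eq_sum hq X)
  rw [map_sum] at h1
  simp only [map_smul] at h1
  have h2 : S.df q X = ∑ i, metric c (S.df q X) (𝓕.e i q) • 𝓕.e i q := h1
  have h3 : ∀ i, metric c (S.df q X) (𝓕.e i q) = metric c W (𝓕.e i q) := fun i => by
    rw [hX, metric_sub_left, metric_smul_left, 𝓕.metric_N_e]; ring
  simp only [h3] at h2
  rw [← h2, hX]
  module

lemma cov_N_eq (i : Fin 3) : S.cov (𝓕.E i) S.N q = -∑ j, 𝓕.a i j q • 𝓕.e j q := by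
  have h1 := 𝓕.eq_sum hq (S.cov_N_mem (𝓕.E i) q)
  rw [metric_cov_N_N] at h1
  simp only [Fin.sum_univ_three, a] at h1 ⊢
  conv_lhs => rw [h1]
  module

lemma metric_cov_e_N (i k : Fin 3) : metric c (S.cov (𝓕.E i) (𝓕.e k) q) (S.N q) = 𝓕.a i k q := by
  have := metric_cov_push_N (S := S) (X := 𝓕.E i) 𝓕.isOpen (𝓕.smooth k) hq
  rw [metric_comm c (S.push _ q)] at this
  exact this

lemma cov_mem_e (i k : Fin 3) : S.cov (𝓕.E i) (𝓕.e k) q ∈ tangent c (S.f q) :=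
  cov_mem 𝓕.isOpen (𝓕.tangentAlong_e k) hq

lemma cov_e_eq (i k : Fin 3) : S.cov (𝓕.E i) (𝓕.e k) q =
    (∑ j, 𝓕.Γ i k j q • 𝓕.e j q) + 𝓕.a i k q • S.N q := by
  have h1 := 𝓕.eq_sum hq (𝓕.cov_mem_e hq i k)
  rw [𝓕.metric_cov_e_N hq] at h1
  exact h1

lemma Γ_antisymm (i k l : Fin 3) : 𝓕.Γ i k l q = -𝓕.Γ i l k q := by
  have h1 := metric_cov (S := S) (X := 𝓕.E i) 𝓕.isOpen (𝓕.tangentAlong_e k) (𝓕.tangentAlong_e l) hq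
  rw [deriv_eq_zero_of_const 𝓕.isOpen (fun q hq => 𝓕.metric_e hq k l) hq,
    metric_comm c (𝓕.e k q)] at h1
  simp only [Γ]
  linarith

lemma Γ_self (i k : Fin 3) : 𝓕.Γ i k k q = 0 := by
  have := 𝓕.Γ_antisymm hq i k k
  linarith

/-- Since ξ = −JN and J is parallel, ∇ξ is expressed by A. Consequently the only connection
coefficients not given by the shape operator are the `𝓕.Γ i 1 2`. -/
lemma cov_e_zero (i : Fin 3) :
    S.cov (𝓕.E i) (𝓕.e 0) q = -J (S.f q) (S.cov (𝓕.E i) S.N q) := by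
  have h1 : S.cov (𝓕.E i) (𝓕.e 0) q =
      S.cov (𝓕.E i) (fun r => (-1 : ℝ) • J (S.f r) (S.N r)) q :=
    cov_congr 𝓕.isOpen (fun r hr => by rw [𝓕.e_zero hr]; module) hq
  rw [h1, cov_smul 𝓕.isOpen (SmoothFun.const (-1)) (S.tangentAlong_N Ω).J hq,
    cov_J 𝓕.isOpen (S.tangentAlong_N Ω) hq, deriv_eq_zero_of_const 𝓕.isOpen (fun _ _ => rfl) hq]
  module

lemma Γ_zero_one (i : Fin 3) : 𝓕.Γ i 0 1 q = -𝓕.a i 2 q := by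
  have t := (𝓕.tangentAlong_e 1).mem q hq
  rw [Γ, 𝓕.cov_e_zero hq, metric_neg_left, 𝓕.metric_J_J (S.cov_N_mem _ _) t, 𝓕.J_e_one hq, a]

lemma Γ_zero_two (i : Fin 3) : 𝓕.Γ i 0 2 q = 𝓕.a i 1 q := by
  have t := (𝓕.tangentAlong_e 2).mem q hq
  rw [Γ, 𝓕.cov_e_zero hq, metric_neg_left, 𝓕.metric_J_J (S.cov_N_mem _ _) t, 𝓕.J_e_two hq,
    metric_neg_right, a]
  ring

lemma Γ_one_zero (i : Fin 3) : 𝓕.Γ i 1 0 q = 𝓕.a i 2 q := by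
  rw [𝓕.Γ_antisymm hq, 𝓕.Γ_zero_one hq, neg_neg]

lemma Γ_two_zero (i : Fin 3) : 𝓕.Γ i 2 0 q = -𝓕.a i 1 q := by
  rw [𝓕.Γ_antisymm hq, 𝓕.Γ_zero_two hq]

lemma Γ_two_one (i : Fin 3) : 𝓕.Γ i 2 1 q = -𝓕.Γ i 1 2 q := 𝓕.Γ_antisymm hq i 2 1

/-- The Lie brackets of the frame fields. -/
lemma mlieBracket_eq (i j : Fin 3) : VectorField.mlieBracket (𝓡 3) (𝓕.E i) (𝓕.E j) q =
    ∑ l, (𝓕.Γ i j l q - 𝓕.Γ j i l q) • 𝓕.E l q := by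
  have h1 := 𝓕.field_eq_sum hq (VectorField.mlieBracket (𝓡 3) (𝓕.E i) (𝓕.E j) q)
  have h2 := push_mlieBracket_eq_cov (S := S) 𝓕.isOpen (𝓕.smooth i) (𝓕.smooth j) hq
  refine h1.trans (Finset.sum_congr rfl fun l _ => ?_)
  congr 1
  show metric c (S.push _ q) _ = _
  rw [h2, metric_sub_left]
  rfl

lemma a_symm (i j : Fin 3) : 𝓕.a i j q = 𝓕.a j i q := by
  have h2 := push_mlieBracket_eq_cov (S := S) 𝓕.isOpen (𝓕.smooth i) (𝓕.smooth j) hq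
  have h3 := metric_push_N (S := S) (VectorField.mlieBracket (𝓡 3) (𝓕.E i) (𝓕.E j)) q
  rw [h2, metric_sub_left] at h3
  have h4 := 𝓕.metric_cov_e_N hq i j
  have h5 := 𝓕.metric_cov_e_N hq j i
  simp only [e] at h4 h5
  linarith

/-- Second derivatives of a function along frame fields. -/
lemma D_comm {h : M → ℝ} (hh : SmoothFun h Ω) (i j : Fin 3) :
    𝓕.D i (𝓕.D j h) q - 𝓕.D j (𝓕.D i h) q =
      ∑ l, (𝓕.Γ i j l q - 𝓕.Γ j i l q) * 𝓕.D l h q := by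
  have h1 := deriv_mlieBracket 𝓕.isOpen (𝓕.smooth i) (𝓕.smooth j) hh hq
  rw [deriv, 𝓕.mlieBracket_eq hq, map_sum] at h1
  simp only [map_smul] at h1
  exact h1.symm

lemma cov_mlieBracket (V : M → EndC3) (i j : Fin 3) :
    S.cov (VectorField.mlieBracket (𝓡 3) (𝓕.E i) (𝓕.E j)) V q =
      ∑ l, (𝓕.Γ i j l q - 𝓕.Γ j i l q) • S.cov (𝓕.E l) V q := by
  rw [← covL_apply, 𝓕.mlieBracket_eq hq, map_sum]
  simp only [map_smul, covL_apply]

/-- The Codazzi equation. -/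
lemma codazzi (i j k : Fin 3) :
    𝓕.D j (𝓕.a i k) q - 𝓕.D i (𝓕.a j k) q
      + (∑ l, (𝓕.a j l q * 𝓕.Γ i k l q - 𝓕.a i l q * 𝓕.Γ j k l q))
      + (∑ l, (𝓕.Γ i j l q - 𝓕.Γ j i l q) * 𝓕.a l k q) =
      metric c (curvature c (S.f q) (𝓕.e i q) (𝓕.e j q) (S.N q)) (𝓕.e k q) := by
  have tN := S.tangentAlong_N Ω
  have key : ∀ i j, metric c (S.cov (𝓕.E i) (S.cov (𝓕.E j) S.N) q) (𝓕.e k q) =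
      -𝓕.D i (𝓕.a j k) q + ∑ l, 𝓕.a j l q * 𝓕.Γ i k l q := by
    intro i j
    have tc := tangentAlong_cov 𝓕.isOpen (𝓕.smooth j) tN
    have h1 := metric_cov (S := S) (X := 𝓕.E i) 𝓕.isOpen tc (𝓕.tangentAlong_e k) hq
    have h2 : 𝓕.D i (𝓕.a j k) q = -deriv (𝓕.E i)
        (fun r => metric c (S.cov (𝓕.E j) S.N r) (𝓕.e k r)) q :=
      deriv_clm (𝓕.E i) (-ContinuousLinearMap.id ℝ ℝ)
        ((tc.smooth.metric (𝓕.tangentAlong_e k).smooth).mdiff 𝓕.isOpen hq)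
    have h3 : metric c (S.cov (𝓕.E j) S.N q) (S.cov (𝓕.E i) (𝓕.e k) q) =
        -∑ l, 𝓕.a j l q * 𝓕.Γ i k l q := by
      rw [𝓕.cov_N_eq hq j]
      simp only [Fin.sum_univ_three, metric_neg_left, metric_add_left, metric_smul_left,
        metric_comm c (𝓕.e _ q), Γ]
    rw [h3] at h1
    rw [h2]
    linarith
  have h4 := cov_cov_sub 𝓕.isOpen 𝓕.c_ne (𝓕.smooth i) (𝓕.smooth j) tN hq
  have h5 := congrArg (fun W => metric c W (𝓕.e k q)) h4
  simp only [metric_sub_left, key, 𝓕.cov_mlieBracket hq, Fin.sum_univ_three, metric_add_left,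
    metric_smul_left] at h5
  refine Eq.trans ?_ h5
  simp only [Fin.sum_univ_three, a]
  ring

/-- The Gauss equation for the connection form `Γ₁₂`. -/
lemma gauss (i j : Fin 3) :
    𝓕.D i (𝓕.Γ j 1 2) q - 𝓕.D j (𝓕.Γ i 1 2) q
      + 2 * (𝓕.a i 1 q * 𝓕.a j 2 q - 𝓕.a i 2 q * 𝓕.a j 1 q)
      - (∑ l, (𝓕.Γ i j l q - 𝓕.Γ j i l q) * 𝓕.Γ l 1 2 q) =
      metric c (curvature c (S.f q) (𝓕.e i q) (𝓕.e j q) (𝓕.e 1 q)) (𝓕.e 2 q) := by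
  have t1 := 𝓕.tangentAlong_e 1
  have key : ∀ i j, metric c (S.cov (𝓕.E i) (S.cov (𝓕.E j) (𝓕.e 1)) q) (𝓕.e 2 q) =
      𝓕.D i (𝓕.Γ j 1 2) q + 𝓕.a j 2 q * 𝓕.a i 1 q - 𝓕.a j 1 q * 𝓕.a i 2 q := by
    intro i j
    have tc := tangentAlong_cov 𝓕.isOpen (𝓕.smooth j) t1
    have h1 : 𝓕.D i (𝓕.Γ j 1 2) q = _ :=
      metric_cov (S := S) (X := 𝓕.E i) 𝓕.isOpen tc (𝓕.tangentAlong_e 2) hq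
    -- The covariant derivatives of U and JU have common components only along ξ and N; the
    -- N-components and, by `Γ_one_zero` and `Γ_two_zero`, the ξ-components are entries of A.
    have h3 : metric c (S.cov (𝓕.E j) (𝓕.e 1) q) (S.cov (𝓕.E i) (𝓕.e 2) q) =
        𝓕.a j 1 q * 𝓕.a i 2 q - 𝓕.a j 2 q * 𝓕.a i 1 q := by
      rw [𝓕.cov_e_eq hq j 1]
      simp only [Fin.sum_univ_three, metric_add_left, metric_smul_left,
        metric_comm c (𝓕.e _ q), metric_comm c (S.N q), 𝓕.metric_cov_e_N hq]
      change 𝓕.Γ j 1 0 q * 𝓕.Γ i 2 0 q + 𝓕.Γ j 1 1 q * 𝓕.Γ i 2 1 q +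
        𝓕.Γ j 1 2 q * 𝓕.Γ i 2 2 q + _ = _
      rw [𝓕.Γ_self hq, 𝓕.Γ_self hq, 𝓕.Γ_one_zero hq, 𝓕.Γ_two_zero hq]
      ring
    rw [h3] at h1
    linarith
  have h4 := cov_cov_sub 𝓕.isOpen 𝓕.c_ne (𝓕.smooth i) (𝓕.smooth j) t1 hq
  have h5 := congrArg (fun W => metric c W (𝓕.e 2 q)) h4
  simp only [metric_sub_left, key, 𝓕.cov_mlieBracket hq, Fin.sum_univ_three, metric_add_left,
    metric_smul_left] at h5
  refine Eq.trans ?_ h5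
  simp only [Fin.sum_univ_three, Γ]
  ring

end AdaptedFrame
end RealHypersurface

/-! ### The adapted frame on the set where ξ is not principal. -/

namespace RealHypersurface

variable {c : ℝ} {M : Type*} [TopologicalSpace M] [ChartedSpace (EuclideanSpace ℝ (Fin 3)) M]

lemma SmoothFun.inv_sqrt {h : M → ℝ} {U : Set M} (hh : SmoothFun h U) (h0 : ∀ q ∈ U, h q ≠ 0)
    (hpos : ∀ q, 0 ≤ h q) : SmoothFun (fun q => (√(h q))⁻¹) U := by
  intro q hq
  have h1 : ContDiffAt ℝ ∞ (fun x : ℝ => (√x)⁻¹) (h q) :=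
    (Real.contDiffAt_sqrt (h0 q hq)).inv
      (Real.sqrt_ne_zero'.2 (lt_of_le_of_ne (hpos q) (h0 q hq).symm))
  exact h1.contMDiffAt.comp_contMDiffWithinAt q (hh q hq)

variable [IsManifold (𝓡 3) ∞ M] (S : RealHypersurface c M)

omit [IsManifold (𝓡 3) ∞ M] in
lemma push_tan (hc : c ≠ 0) {V : M → EndC3} {U : Set M} (hV : S.TangentAlong V U) {q : M} (hq : q ∈ U)
    (h : metric c (V q) (S.N q) = 0) : S.push (fun r => S.tan r (V r)) q = V q := by
  rw [push, S.df_tan hc (hV.mem q hq), h]; module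

lemma smoothOn_tan (hc : c ≠ 0) {V : M → EndC3} {U : Set M} (hU : IsOpen U)
    (hV : S.TangentAlong V U) (h : ∀ q ∈ U, metric c (V q) (S.N q) = 0) :
    SmoothOn (fun r => S.tan r (V r)) U :=
  S.smoothOn_of_push hU (hV.smooth.congr fun _ hq => S.push_tan hc hV hq (h _ hq))

omit [IsManifold (𝓡 3) ∞ M] in
lemma push_xi_eqOn (hc : c ≠ 0) (U : Set M) :
    Set.EqOn (S.push S.xi) (fun q => (-1 : ℝ) • J (S.f q) (S.N q)) U := fun q _ => by
  simp only [S.push_xi hc]; module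

omit [IsManifold (𝓡 3) ∞ M] in
lemma tangentAlong_push_xi (hc : c ≠ 0) (U : Set M) : S.TangentAlong (S.push S.xi) U where
  smooth := ((S.tangentAlong_N U).J.smul (SmoothFun.const (-1))).smooth.congr (S.push_xi_eqOn hc U)
  mem q _ := S.df_mem q _

lemma smoothOn_xi (hc : c ≠ 0) {U : Set M} (hU : IsOpen U) : SmoothOn S.xi U :=
  S.smoothOn_of_push hU (S.tangentAlong_push_xi hc U).smooth

omit [IsManifold (𝓡 3) ∞ M] in
lemma metric_push_xi (hc : c ≠ 0) (q : M) : metric c (S.push S.xi q) (S.push S.xi q) = 1 := by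
  obtain ⟨v, hv⟩ := S.exists_spans_f q
  have hN := S.N_tangent q
  rw [S.push_xi hc, metric_neg_left, metric_neg_right, hv.metric_J_left hc hN (hv.J_mem hN),
    hv.J_J hN, metric_neg_right, S.N_unit]
  norm_num

/-- The component of `Aξ` orthogonal to `ξ`, as a field along the immersion. -/
def hopfDefect (q : M) : EndC3 :=
  (-1 : ℝ) • S.cov S.xi S.N q + metric c (S.cov S.xi S.N q) (S.push S.xi q) • S.push S.xi q

lemma tangentAlong_hopfDefect (hc : c ≠ 0) : S.TangentAlong S.hopfDefect Set.univ := by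
  have h1 := tangentAlong_cov isOpen_univ (S.smoothOn_xi hc isOpen_univ) (S.tangentAlong_N Set.univ)
  have h2 := S.tangentAlong_push_xi hc Set.univ
  exact (h1.smul (SmoothFun.const (-1))).add (h2.smul (h1.smooth.metric (c := c) h2.smooth))

omit [IsManifold (𝓡 3) ∞ M] in
lemma metric_hopfDefect_N (q : M) : metric c (S.hopfDefect q) (S.N q) = 0 := by
  rw [hopfDefect, metric_add_left, metric_smul_left, metric_smul_left, metric_cov_N_N,
    metric_push_N]
  ring

omit [IsManifold (𝓡 3) ∞ M] in
lemma metric_hopfDefect_xi (hc : c ≠ 0) (q : M) :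
    metric c (S.push S.xi q) (S.hopfDefect q) = 0 := by
  rw [hopfDefect, metric_add_right, metric_smul_right, metric_smul_right, S.metric_push_xi hc,
    metric_comm c (S.push S.xi q)]
  ring

omit [IsManifold (𝓡 3) ∞ M] in
lemma hopf_of_hopfDefect_eq_zero (hc : c ≠ 0) {q : M} (h : S.hopfDefect q = 0) :
    S.A q (S.xi q) = S.eta q (S.A q (S.xi q)) • S.xi q := by
  apply S.df_injective q
  have h1 : S.df q (S.A q (S.xi q)) = -S.cov S.xi S.N q := S.df_A hc S.xi q
  have h2 : S.df q (S.eta q (S.A q (S.xi q)) • S.xi q) =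
    S.eta q (S.A q (S.xi q)) • S.push S.xi q := (S.dfL q).map_smul _ _
  have h3 : S.eta q (S.A q (S.xi q)) = -metric c (S.cov S.xi S.N q) (S.push S.xi q) := by
    rw [eta, g, h1, metric_neg_left]; rfl
  rw [h2, h1, h3]
  rw [hopfDefect] at h
  rw [← sub_eq_zero, ← h]
  module

lemma metric_hopfDefect_nonneg (hc : c ≠ 0) (q : M) :
    0 ≤ metric c (S.hopfDefect q) (S.hopfDefect q) := by
  obtain ⟨v, hv⟩ := S.exists_spans_f q
  by_cases h : S.hopfDefect q = 0
  · rw [h, metric_zero_left]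
  · exact (hv.metric_pos hc ((S.tangentAlong_hopfDefect hc).mem q trivial) h).le

/-- Where `ξ` is not principal there is a frame `ξ, U, JU` with `Aξ = αξ + βU`, `β ≠ 0`. -/
theorem exists_adaptedFrame (hc : c ≠ 0) : ∃ (Ω : Set M) (𝓕 : AdaptedFrame S Ω),
    𝓕.E 0 = S.xi ∧ (∀ q ∈ Ω, 𝓕.a 0 1 q ≠ 0 ∧ 𝓕.a 0 2 q = 0) ∧ (Ω = ∅ → S.IsHopf) := by
  set w := S.hopfDefect with hw
  set h : M → ℝ := fun q => metric c (w q) (w q) with hh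
  have tw : S.TangentAlong w Set.univ := S.tangentAlong_hopfDefect hc
  have sh : SmoothFun h Set.univ := SmoothFun.metric (c := c) tw.smooth tw.smooth
  have hcont : Continuous h := continuousOn_univ.1 sh.continuousOn
  -- `h` is |Aξ − αξ|², so on Ω the function β will be √h. Ω may be empty; the frame exists in any
  -- case, and emptiness is exactly what is to be proved.
  set Ω : Set M := {q | h q ≠ 0} with hΩ
  have oΩ : IsOpen Ω := isOpen_ne.preimage hcont
  have hnn : ∀ q, 0 ≤ h q := S.metric_hopfDefect_nonneg hc
  have sβ : SmoothFun (fun q => (√(h q))⁻¹) Ω :=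
    SmoothFun.inv_sqrt (sh.mono (Set.subset_univ _)) (fun _ hq => hq) hnn
  have tw' : S.TangentAlong w Ω := ⟨tw.smooth.mono (Set.subset_univ _), fun q _ => tw.mem q trivial⟩
  set e1 : M → EndC3 := fun q => (√(h q))⁻¹ • w q with he1
  have t1 : S.TangentAlong e1 Ω := tw'.smul sβ
  have n1 : ∀ q, metric c (e1 q) (S.N q) = 0 := fun q => by
    rw [he1]; simp only [metric_smul_left]; rw [hw, S.metric_hopfDefect_N, mul_zero]
  have t2 : S.TangentAlong (fun q => J (S.f q) (e1 q)) Ω := t1.J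
  have o1 : ∀ q, metric c (S.push S.xi q) (e1 q) = 0 := fun q => by
    rw [he1]; simp only [metric_smul_right]; rw [hw, S.metric_hopfDefect_xi hc, mul_zero]
  have n2 : ∀ q ∈ Ω, metric c (J (S.f q) (e1 q)) (S.N q) = 0 := fun q hq => by
    obtain ⟨v, hv⟩ := S.exists_spans_f q
    have := o1 q
    rw [S.push_xi hc, metric_neg_left, metric_comm c (J _ _)] at this
    rw [hv.metric_J_left hc (t1.mem q hq) (S.N_tangent q)]
    exact this
  have p1 : ∀ q ∈ Ω, S.push (fun r => S.tan r (e1 r)) q = e1 q := fun q hq =>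
    S.push_tan hc t1 hq (n1 q)
  have hs : ∀ q ∈ Ω, √(h q) ≠ 0 := fun q hq =>
    Real.sqrt_ne_zero'.2 (lt_of_le_of_ne (hnn q) (Ne.symm hq))
  let 𝓕 : AdaptedFrame S Ω :=
    { E := ![S.xi, fun r => S.tan r (e1 r), fun r => S.tan r (J (S.f r) (e1 r))]
      c_ne := hc
      isOpen := oΩ
      smooth := by
        intro i
        fin_cases i
        · exact S.smoothOn_xi hc oΩ
        · exact S.smoothOn_tan hc oΩ t1 fun q _ => n1 q
        · exact S.smoothOn_tan hc oΩ t2 n2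
      push_zero := fun q _ => S.push_xi hc q
      push_two := fun q hq => by
        have h1 := S.push_tan hc t2 hq (n2 q hq)
        have h2 := p1 q hq
        exact h1.trans (congrArg (J (S.f q)) h2.symm)
      unit := fun q hq => by
        refine (congrArg₂ (metric c) (p1 q hq) (p1 q hq)).trans ?_
        rw [he1]; simp only [metric_smul_left, metric_smul_right]
        have h1 : √(h q) * √(h q) = h q := Real.mul_self_sqrt (hnn q)
        change (√(h q))⁻¹ * ((√(h q))⁻¹ * h q) = 1
        rw [← mul_assoc, ← mul_inv, h1]; exact inv_mul_cancel₀ hq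
      orth := fun q hq => (congrArg (metric c (S.push S.xi q)) (p1 q hq)).trans (o1 q) }
  refine ⟨Ω, 𝓕, rfl, fun q hq => ?_, fun h0 q => ?_⟩
  · have h1 : 𝓕.e 1 q = (√(h q))⁻¹ • w q := p1 q hq
    have h2 : w q = √(h q) • 𝓕.e 1 q := by
      rw [h1, smul_smul, mul_inv_cancel₀ (hs q hq), one_smul]
    have h3 : ∀ j, 𝓕.a 0 j q = metric c (√(h q) • 𝓕.e 1 q -
        metric c (S.cov S.xi S.N q) (S.push S.xi q) • 𝓕.e 0 q) (𝓕.e j q) := by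
      intro j
      have e0 : 𝓕.e 0 q = S.push S.xi q := rfl
      have h4 : √(h q) • 𝓕.e 1 q - metric c (S.cov S.xi S.N q) (S.push S.xi q) • 𝓕.e 0 q =
        -S.cov S.xi S.N q := by rw [← h2, e0, hw, hopfDefect]; module
      rw [h4, metric_neg_left]; rfl
    constructor
    · rw [h3, metric_sub_left, metric_smul_left, metric_smul_left, 𝓕.metric_e hq, 𝓕.metric_e hq]
      simpa using hs q hq
    · rw [h3, metric_sub_left, metric_smul_left, metric_smul_left, 𝓕.metric_e hq, 𝓕.metric_e hq]
      simp
  · have hq : q ∉ Ω := h0 ▸ Set.notMem_empty q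
    have hz : h q = 0 := not_not.1 hq
    apply S.hopf_of_hopfDefect_eq_zero hc
    by_contra hne
    obtain ⟨v, hv⟩ := S.exists_spans_f q
    exact (hv.metric_pos hc (tw.mem q trivial) hne).ne' hz

end RealHypersurface

/-! ### Pointwise algebra of the pseudo-parallel condition. -/

namespace GaussAlgebra

/-- The tangential part of the complex structure in an adapted frame. -/
def phi (x : Fin 3 → ℝ) : Fin 3 → ℝ := ![0, -x 2, x 1]

/-- The curvature tensor given by the Gauss equation, in an adapted frame. -/
def curv (k : ℝ) (a : Matrix (Fin 3) (Fin 3) ℝ) (x y z : Fin 3 → ℝ) : Fin 3 → ℝ :=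
  k • ((y ⬝ᵥ z) • x - (x ⬝ᵥ z) • y + (phi y ⬝ᵥ z) • phi x - (phi x ⬝ᵥ z) • phi y
    - (2 * (phi x ⬝ᵥ y)) • phi z) + (y ᵥ* a ⬝ᵥ z) • (x ᵥ* a) - (x ᵥ* a ⬝ᵥ z) • (y ᵥ* a)

/-- The coordinates of `ξ` in an adapted frame. -/
def xi : Fin 3 → ℝ := ![1, 0, 0]

/-- The structure Jacobi operator in an adapted frame. -/
def jacobi (k : ℝ) (a : Matrix (Fin 3) (Fin 3) ℝ) (x : Fin 3 → ℝ) : Fin 3 → ℝ :=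
  curv k a x xi xi

/-- The wedge endomorphism in an adapted frame. -/
def wedge (x y z : Fin 3 → ℝ) : Fin 3 → ℝ := (y ⬝ᵥ z) • x - (z ⬝ᵥ x) • y

/-- The pseudo-parallelism of the structure Jacobi operator, in an adapted frame. -/
def PseudoParallel (k : ℝ) (a : Matrix (Fin 3) (Fin 3) ℝ) (L : ℝ) : Prop :=
  ∀ i j m : Fin 3, curv k a (Pi.single i 1) (Pi.single j 1) (jacobi k a (Pi.single m 1)) -
      jacobi k a (curv k a (Pi.single i 1) (Pi.single j 1) (Pi.single m 1)) =
    L • (wedge (Pi.single i 1) (Pi.single j 1) (jacobi k a (Pi.single m 1)) -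
      jacobi k a (wedge (Pi.single i 1) (Pi.single j 1) (Pi.single m 1)))

variable {k L α β γ δ μ : ℝ} {a : Matrix (Fin 3) (Fin 3) ℝ}

lemma single_zero : (Pi.single 0 1 : Fin 3 → ℝ) = ![1, 0, 0] := by
  ext i; fin_cases i <;> rfl
lemma single_one : (Pi.single 1 1 : Fin 3 → ℝ) = ![0, 1, 0] := by
  ext i; fin_cases i <;> rfl
lemma single_two : (Pi.single 2 1 : Fin 3 → ℝ) = ![0, 0, 1] := by
  ext i; fin_cases i <;> rfl

lemma vec_vecMul (x y z : ℝ) : ![x, y, z] ᵥ* !![α, β, 0; β, γ, δ; 0, δ, μ] =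
    ![x * α + y * β, x * β + y * γ + z * δ, y * δ + z * μ] := by
  ext i; fin_cases i <;> simp [Matrix.vecMul, dotProduct, Fin.sum_univ_three]

lemma vec_dot (x y z x' y' z' : ℝ) : ![x, y, z] ⬝ᵥ ![x', y', z'] = x * x' + y * y' + z * z' := by
  simp [dotProduct, Fin.sum_univ_three]

lemma phi_vec (x y z : ℝ) : phi ![x, y, z] = ![0, -z, y] := rfl

lemma vec_add (x y z x' y' z' : ℝ) : ![x, y, z] + ![x', y', z'] = ![x + x', y + y', z + z'] := by
  simp
lemma vec_sub (x y z x' y' z' : ℝ) : ![x, y, z] - ![x', y', z'] = ![x - x', y - y', z - z'] := by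
  simp
lemma vec_smul (r x y z : ℝ) : r • ![x, y, z] = ![r * x, r * y, r * z] := by
  simp

lemma jacobi_vec (x y z : ℝ) : jacobi k !![α, β, 0; β, γ, δ; 0, δ, μ] ![x, y, z] =
    ![0, (k + α * γ - β ^ 2) * y + α * δ * z, α * δ * y + (k + α * μ) * z] := by
  simp only [jacobi, curv, xi, vec_vecMul, vec_dot, phi_vec, vec_add, vec_sub, vec_smul]
  congr 1
  · ring
  congr 1
  · ring
  congr 1
  ring

/-- The consequences of pseudo-parallelism for the shape operator. -/
theorem PseudoParallel.shape (h : PseudoParallel k !![α, β, 0; β, γ, δ; 0, δ, μ] L) (hk : k ≠ 0)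
    (hβ : β ≠ 0) : δ = 0 ∧ α ≠ 0 ∧
      ((α * μ = 0 ∧ α * γ = β ^ 2) ∨ (α * μ = -k ∧ α * γ = β ^ 2 - k)) := by
  -- The components of the first three equations used below do not involve L: lξ = 0, and here the
  -- wedge terms are multiples of ξ or zero. The last two, R(U,JU)U and R(JU,ξ)ξ, bring L in.
  have h120 := h 1 2 0
  have h101 := h 1 0 1
  have h201 := h 2 0 1
  have h121 := h 1 2 1
  have h200 := h 2 0 0
  simp only [curv, wedge, single_zero, single_one, single_two, vec_vecMul, vec_dot, jacobi_vec,
    phi_vec, vec_add, vec_sub, vec_smul] at h120 h101 h201 h121 h200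
  have f2 := congrFun h120 2
  have p1 := congrFun h101 1
  have p2 := congrFun h101 2
  have r2 := congrFun h201 2
  have t2 := congrFun h121 2
  have u2 := congrFun h200 2
  simp at f2 p1 p2 r2 t2 u2
  clear h120 h121 h101 h201 h200 h
  have q1 : β * (α * δ ^ 2) = 0 := by linear_combination -p1 / 2
  have q2 : α * δ = 0 := by
    have := (mul_eq_zero.1 q1).resolve_left hβ
    rcases mul_eq_zero.1 this with h | h
    · rw [h, zero_mul]
    · rw [pow_eq_zero_iff two_ne_zero |>.1 h, mul_zero]
  have hδ : δ = 0 := by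
    have : β ^ 3 * δ = 0 := by linear_combination -p2 + β * (γ - μ) * q2
    exact (mul_eq_zero.1 this).resolve_left (pow_ne_zero 3 hβ)
  subst hδ
  have r3 : β * (μ * (α * γ - α * μ - β ^ 2)) = 0 := by linear_combination r2
  have f3 : β * (μ * (α * μ + k)) = 0 := by linear_combination f2
  have r4 := (mul_eq_zero.1 r3).resolve_left hβ
  have f4 := (mul_eq_zero.1 f3).resolve_left hβ
  refine ⟨rfl, ?_⟩
  -- The alternatives are whether l is a scalar on the complement of ξ, its eigenvalues on U and JU
  -- being k + αγ − β² and k + αμ.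
  by_cases hs : α * γ - α * μ - β ^ 2 = 0
  · rcases mul_eq_zero.1 f4 with h | h
    · subst h
      refine ⟨?_, Or.inl ⟨mul_zero _, by linear_combination hs⟩⟩
      rintro rfl
      apply hβ
      have : β ^ 2 = 0 := by linear_combination -hs
      exact pow_eq_zero_iff two_ne_zero |>.1 this
    · refine ⟨?_, Or.inr ⟨by linear_combination h, by linear_combination hs + h⟩⟩
      rintro rfl
      apply hk
      linear_combination h
  · exfalso
    have hμ := (mul_eq_zero.1 r4).resolve_right hs
    subst hμ
    -- With μ = 0 and distinct eigenvalues, L equals the sectional curvature 4k of the plane of U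
    -- and JU, whereas the equation for R(JU,ξ)ξ requires k² = Lk.
    have hs' : (α * γ - β ^ 2) * (L - 4 * k) = 0 := by linear_combination t2
    have hL : L = 4 * k := by
      rcases mul_eq_zero.1 hs' with h | h
      · exact absurd (by linear_combination h) hs
      · linear_combination h
    subst hL
    have : k * k = 0 := by linear_combination u2 / 3
    exact hk (mul_self_eq_zero.1 this)

end GaussAlgebra

/-! ### Translation of the hypothesis into frame coordinates. -/

namespace RealHypersurface

variable {c : ℝ} {M : Type*} [TopologicalSpace M] [ChartedSpace (EuclideanSpace ℝ (Fin 3)) M]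
  [IsManifold (𝓡 3) ∞ M] {S : RealHypersurface c M} {Ω : Set M}

section smooth
variable {X Y Z : Field M} (hΩ : IsOpen Ω) (hX : SmoothOn X Ω) (hY : SmoothOn Y Ω)
  (hZ : SmoothOn Z Ω)
include hΩ hX hY

lemma smoothOn_nabla (hc : c ≠ 0) : SmoothOn (S.nabla X Y) Ω := by
  apply S.smoothOn_of_push hΩ
  have h1 := tangentAlong_push (S := S) hΩ hY
  have h2 := tangentAlong_cov hΩ hX h1
  have h3 := tangentAlong_cov hΩ hX (S.tangentAlong_N Ω)
  exact (h2.add ((S.tangentAlong_N Ω).smul (h1.smooth.metric (c := c) h3.smooth))).smooth.congr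
    fun _ hq => push_nabla hc hΩ hY hq

lemma smoothOn_mlieBracket (S : RealHypersurface c M) : SmoothOn (VectorField.mlieBracket (𝓡 3) X Y) Ω := by
  apply S.smoothOn_of_push hΩ
  have h1 := tangentAlong_push (S := S) hΩ hX
  have h2 := tangentAlong_push (S := S) hΩ hY
  exact ((tangentAlong_cov hΩ hX h2).smooth.fun_sub (tangentAlong_cov hΩ hY h1).smooth).congr
    fun _ hq => push_mlieBracket_eq_cov hΩ hX hY hq

include hZ

lemma smoothOn_R (hc : c ≠ 0) : SmoothOn (S.R X Y Z) Ω := by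
  apply S.smoothOn_of_push hΩ
  have h1 := S.smoothFun_push hΩ
    (smoothOn_nabla (S := S) hΩ hX (smoothOn_nabla (S := S) hΩ hY hZ hc) hc)
  have h2 := S.smoothFun_push hΩ
    (smoothOn_nabla (S := S) hΩ hY (smoothOn_nabla (S := S) hΩ hX hZ hc) hc)
  have h3 := S.smoothFun_push hΩ
    (smoothOn_nabla (S := S) hΩ (smoothOn_mlieBracket hΩ hX hY S) hZ hc)
  refine ((h1.fun_sub h2).fun_sub h3).congr fun q _ => ?_
  exact ((S.dfL q).map_sub _ _).trans (congrArg (· - _) ((S.dfL q).map_sub _ _))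

lemma smoothOn_wedge : SmoothOn (S.wedge X Y Z) Ω := by
  apply S.smoothOn_of_push hΩ
  have h1 := S.smoothFun_push hΩ hX
  have h2 := S.smoothFun_push hΩ hY
  have h3 := S.smoothFun_push hΩ hZ
  refine (((h2.metric (c := c) h3).fun_smul h1).fun_sub
    ((h3.metric (c := c) h1).fun_smul h2)).congr fun q _ => ?_
  refine ((S.dfL q).map_sub _ _).trans ?_
  rw [map_smul, map_smul]
  rfl

end smooth

namespace AdaptedFrame
variable (𝓕 : AdaptedFrame S Ω)

/-- The coordinates of a tangent vector in the frame. -/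
def coordL (q : M) : TangentSpace (𝓡 3) q →ₗ[ℝ] (Fin 3 → ℝ) where
  toFun X := fun i => metric c (S.df q X) (𝓕.e i q)
  map_add' X Y := by
    ext i
    change metric c (S.dfL q (X + Y)) _ = metric c (S.dfL q X) _ + metric c (S.dfL q Y) _
    rw [map_add, metric_add_left]
  map_smul' r X := by
    ext i
    change metric c (S.dfL q (r • X)) _ = r * metric c (S.dfL q X) _
    rw [map_smul, metric_smul_left]

/-- The coordinates of a vector field in the frame. -/
def coord (X : Field M) (q : M) : Fin 3 → ℝ := 𝓕.coordL q (X q)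

lemma coord_apply (X : Field M) (q : M) (i : Fin 3) :
    𝓕.coord X q i = metric c (S.push X q) (𝓕.e i q) := rfl

/-- The shape operator in the frame. -/
def shape (q : M) : Matrix (Fin 3) (Fin 3) ℝ := Matrix.of fun i j => 𝓕.a i j q

variable {q : M} (hq : q ∈ Ω) (X Y Z : Field M)
include hq

lemma push_eq_sum : S.push X q = ∑ i, 𝓕.coord X q i • 𝓕.e i q := by
  have h1 := congrArg (S.dfL q) (𝓕.field_eq_sum hq (X q))
  rw [map_sum] at h1
  simp only [map_smul] at h1
  exact h1

lemma metric_push_right (V : EndC3) :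
    metric c V (S.push X q) = (fun i => metric c V (𝓕.e i q)) ⬝ᵥ 𝓕.coord X q := by
  rw [𝓕.push_eq_sum hq X, Fin.sum_univ_three]
  simp only [metric_add_right, metric_smul_right, dotProduct, Fin.sum_univ_three]
  ring

lemma metric_push_push :
    metric c (S.push X q) (S.push Y q) = 𝓕.coord X q ⬝ᵥ 𝓕.coord Y q :=
  𝓕.metric_push_right hq Y (S.push X q)

lemma coord_J : (fun i => metric c (J (S.f q) (S.push X q)) (𝓕.e i q)) =
    GaussAlgebra.phi (𝓕.coord X q) := by
  have t := fun i => (𝓕.tangentAlong_e i).mem q hq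
  ext i
  have hX : S.push X q ∈ tangent c (S.f q) := S.df_mem q (X q)
  rw [𝓕.metric_J_J hX (t i)]
  fin_cases i
  · change -metric c (S.push X q) (J (S.f q) (𝓕.e 0 q)) = 0
    rw [𝓕.J_e_zero hq, metric_push_N, neg_zero]
  · change -metric c (S.push X q) (J (S.f q) (𝓕.e 1 q)) = -𝓕.coord X q 2
    rw [𝓕.J_e_one hq, coord_apply]
  · change -metric c (S.push X q) (J (S.f q) (𝓕.e 2 q)) = 𝓕.coord X q 1
    rw [𝓕.J_e_two hq, coord_apply, metric_neg_right, neg_neg]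

lemma metric_J_push :
    metric c (J (S.f q) (S.push X q)) (S.push Y q) =
      GaussAlgebra.phi (𝓕.coord X q) ⬝ᵥ 𝓕.coord Y q := by
  rw [𝓕.metric_push_right hq, 𝓕.coord_J hq]

lemma coord_cov_N : (fun i => metric c (S.cov X S.N q) (𝓕.e i q)) =
    -(𝓕.coord X q ᵥ* 𝓕.shape q) := by
  have h0 : S.cov X S.N q = ∑ i, 𝓕.coord X q i • S.cov (𝓕.E i) S.N q := by
    have h1 := congrArg (S.covL q S.N) (𝓕.field_eq_sum hq (X q))
    rw [map_sum] at h1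
    simp only [map_smul] at h1
    exact h1
  ext j
  rw [h0, Fin.sum_univ_three]
  simp only [metric_add_left, metric_smul_left, Pi.neg_apply, Matrix.vecMul, dotProduct,
    Fin.sum_univ_three, shape, Matrix.of_apply, a]
  ring

lemma metric_cov_N_push : metric c (S.push Y q) (S.cov X S.N q) =
    -(𝓕.coord X q ᵥ* 𝓕.shape q ⬝ᵥ 𝓕.coord Y q) := by
  rw [metric_comm c (S.push Y q), 𝓕.metric_push_right hq, 𝓕.coord_cov_N hq, neg_dotProduct]

variable {X Y Z}

/-- The Gauss equation in the frame. -/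
lemma coord_R (hX : SmoothOn X Ω) (hY : SmoothOn Y Ω) (hZ : SmoothOn Z Ω) :
    𝓕.coord (S.R X Y Z) q =
      GaussAlgebra.curv (c / 4) (𝓕.shape q) (𝓕.coord X q) (𝓕.coord Y q) (𝓕.coord Z q) := by
  ext i
  have hJ := fun W => congrFun (𝓕.coord_J hq W) i
  have hN := fun W => congrFun (𝓕.coord_cov_N hq W) i
  rw [coord_apply, push_R 𝓕.c_ne 𝓕.isOpen hX hY hZ hq]
  simp only [metric_sub_left, metric_add_left, metric_smul_left, 𝓕.metric_N_e, curvature,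
    𝓕.metric_push_push hq, 𝓕.metric_J_push hq, 𝓕.metric_cov_N_push hq, ← 𝓕.coord_apply, hJ, hN,
    GaussAlgebra.curv, Pi.add_apply, Pi.sub_apply, Pi.smul_apply, Pi.neg_apply, smul_eq_mul]
  ring

lemma coord_wedge : 𝓕.coord (S.wedge X Y Z) q =
    GaussAlgebra.wedge (𝓕.coord X q) (𝓕.coord Y q) (𝓕.coord Z q) := by
  have h1 : S.g q (Y q) (Z q) = 𝓕.coord Y q ⬝ᵥ 𝓕.coord Z q := 𝓕.metric_push_push hq Y Z
  have h2 : S.g q (Z q) (X q) = 𝓕.coord Z q ⬝ᵥ 𝓕.coord X q := 𝓕.metric_push_push hq Z X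
  rw [coord, wedge, map_sub, map_smul, map_smul, h1, h2]
  rfl

lemma coord_E (i : Fin 3) : 𝓕.coord (𝓕.E i) q = Pi.single i 1 := by
  ext j
  rw [coord_apply]
  exact (𝓕.metric_e hq i j).trans (by rw [Pi.single_apply]; simp only [eq_comm])

lemma coord_l (h0 : 𝓕.E 0 = S.xi) (hX : SmoothOn X Ω) :
    𝓕.coord (S.l X) q = GaussAlgebra.jacobi (c / 4) (𝓕.shape q) (𝓕.coord X q) := by
  have hs := h0 ▸ 𝓕.smooth 0
  rw [l, 𝓕.coord_R hq hX hs hs, ← h0, 𝓕.coord_E hq, GaussAlgebra.single_zero]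
  rfl

/-- The hypothesis is tested on frame fields only. The nested expressions apply R and l to the
fields lZ, R(X,Y)Z and (X ∧ Y)Z, whose smoothness is what allows `coord_R` and `coord_l` to evaluate
them pointwise. -/
theorem pseudoParallel (h0 : 𝓕.E 0 = S.xi) (hS : S.PseudoParallelStructureJacobi) :
    ∃ L, GaussAlgebra.PseudoParallel (c / 4) (𝓕.shape q) L := by
  obtain ⟨L, hL⟩ := hS
  refine ⟨L q, fun i j m => ?_⟩
  have hs := h0 ▸ 𝓕.smooth 0
  have hi := 𝓕.smooth i
  have hj := 𝓕.smooth j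
  have hm := 𝓕.smooth m
  have hl : SmoothOn (S.l (𝓕.E m)) Ω := smoothOn_R 𝓕.isOpen hm hs hs 𝓕.c_ne
  have h1 := congrArg (𝓕.coordL q) (hL Ω 𝓕.isOpen _ _ _ hi hj hm q hq)
  rw [map_smul, map_sub, map_sub] at h1
  change 𝓕.coord _ q - 𝓕.coord _ q = _ • (𝓕.coord _ q - 𝓕.coord _ q) at h1
  rw [𝓕.coord_R hq hi hj hl, 𝓕.coord_wedge hq,
    𝓕.coord_l hq h0 (smoothOn_R 𝓕.isOpen hi hj hm 𝓕.c_ne),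
    𝓕.coord_l hq h0 (smoothOn_wedge 𝓕.isOpen hi hj hm),
    𝓕.coord_R hq hi hj hm, 𝓕.coord_l hq h0 hm, 𝓕.coord_wedge hq] at h1
  simpa only [𝓕.coord_E hq] using h1

end AdaptedFrame
end RealHypersurface

/-! ### Structure equations and the contradiction on Ω. -/

namespace RealHypersurface

variable {c : ℝ} {M : Type*} [TopologicalSpace M] [ChartedSpace (EuclideanSpace ℝ (Fin 3)) M]
  [IsManifold (𝓡 3) ∞ M] {S : RealHypersurface c M} {Ω : Set M}
namespace AdaptedFrame
variable (𝓕 : AdaptedFrame S Ω)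

lemma D_congr {h k : M → ℝ} (e : Set.EqOn h k Ω) {q : M} (hq : q ∈ Ω) (i : Fin 3) :
    𝓕.D i h q = 𝓕.D i k q := deriv_congr 𝓕.isOpen e hq

lemma D_const {h : M → ℝ} {r : ℝ} (e : ∀ q ∈ Ω, h q = r) {q : M} (hq : q ∈ Ω) (i : Fin 3) :
    𝓕.D i h q = 0 := deriv_eq_zero_of_const 𝓕.isOpen e hq

lemma D_mul {h k : M → ℝ} (hh : SmoothFun h Ω) (hk : SmoothFun k Ω) {q : M} (hq : q ∈ Ω)
    (i : Fin 3) : 𝓕.D i (fun r => h r * k r) q = h q * 𝓕.D i k q + k q * 𝓕.D i h q := by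
  have := deriv_mul (𝓕.E i) (hh.mdiff 𝓕.isOpen hq) (hk.mdiff 𝓕.isOpen hq)
  rw [D, this]; simp only [D]; ring

/-- The Codazzi equations and one of the Gauss equations, if the shape operator is block
diagonal. -/
theorem structure_equations (h02 : ∀ q ∈ Ω, 𝓕.a 0 2 q = 0) (h12 : ∀ q ∈ Ω, 𝓕.a 1 2 q = 0)
    {q : M} (hq : q ∈ Ω) {α β γ μ κ₀ κ₁ κ₂ : ℝ} (hα : α = 𝓕.a 0 0 q) (hβ : β = 𝓕.a 0 1 q)
    (hγ : γ = 𝓕.a 1 1 q) (hμ : μ = 𝓕.a 2 2 q) (h₀ : κ₀ = 𝓕.Γ 0 1 2 q) (h₁ : κ₁ = 𝓕.Γ 1 1 2 q)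
    (h₂ : κ₂ = 𝓕.Γ 2 1 2 q) :
    𝓕.D 1 (𝓕.a 0 0) q = 𝓕.D 0 (𝓕.a 0 1) q ∧ 𝓕.D 1 (𝓕.a 0 1) q = 𝓕.D 0 (𝓕.a 1 1) q ∧
    β * κ₁ = β ^ 2 - α * γ - c / 4 + γ * μ + κ₀ * (γ - μ) ∧
    𝓕.D 2 (𝓕.a 0 0) q = β * (κ₀ + α - 3 * μ) ∧
    𝓕.D 2 (𝓕.a 0 1) q = c / 4 + α * μ + β ^ 2 - μ * γ + κ₀ * (γ - μ) ∧
    𝓕.D 0 (𝓕.a 2 2) q = β * κ₂ ∧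
    𝓕.D 2 (𝓕.a 1 1) q = κ₁ * (γ - μ) + β * (γ + 2 * μ) ∧
    𝓕.D 1 (𝓕.a 2 2) q = κ₂ * (γ - μ) ∧
    𝓕.D 1 (𝓕.Γ 0 1 2) q - 𝓕.D 0 (𝓕.Γ 1 1 2) q = (γ - κ₀) * κ₂ := by
  subst hα hβ hγ hμ h₀ h₁ h₂
  have s10 : Set.EqOn (𝓕.a 1 0) (𝓕.a 0 1) Ω := fun r hr => 𝓕.a_symm hr 1 0
  have z20 : ∀ r ∈ Ω, 𝓕.a 2 0 r = 0 := fun r hr => (𝓕.a_symm hr 2 0).trans (h02 r hr)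
  have z21 : ∀ r ∈ Ω, 𝓕.a 2 1 r = 0 := fun r hr => (𝓕.a_symm hr 2 1).trans (h12 r hr)
  have c010 := 𝓕.codazzi hq 0 1 0
  have c011 := 𝓕.codazzi hq 0 1 1
  have c012 := 𝓕.codazzi hq 0 1 2
  have c020 := 𝓕.codazzi hq 0 2 0
  have c021 := 𝓕.codazzi hq 0 2 1
  have c022 := 𝓕.codazzi hq 0 2 2
  have c121 := 𝓕.codazzi hq 1 2 1
  have c122 := 𝓕.codazzi hq 1 2 2
  have g10 := 𝓕.gauss hq 1 0
  simp only [Fin.sum_univ_three, curvature, 𝓕.J_e_zero hq, 𝓕.J_e_one hq, 𝓕.J_e_two hq, 𝓕.J_N hq,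
    metric_sub_left, metric_add_left, metric_smul_left, metric_neg_left, 𝓕.metric_e hq,
    𝓕.metric_e_N, 𝓕.metric_N_e, S.N_unit, 𝓕.D_congr s10 hq, 𝓕.D_const h02 hq, 𝓕.D_const h12 hq,
    𝓕.D_const z20 hq, 𝓕.D_const z21 hq, 𝓕.Γ_self hq, 𝓕.Γ_zero_one hq, 𝓕.Γ_zero_two hq,
    𝓕.Γ_one_zero hq, 𝓕.Γ_two_zero hq, 𝓕.Γ_two_one hq, s10 hq, h02 q hq, h12 q hq, z20 q hq,
    z21 q hq] at c010 c011 c012 c020 c021 c022 c121 c122 g10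
  simp at c010 c011 c012 c020 c021 c022 c121 c122 g10
  refine ⟨?_, ?_, ?_, ?_, ?_, ?_, ?_, ?_, ?_⟩
  · linear_combination c010
  · linear_combination c011
  · linear_combination c012
  · linear_combination c020
  · linear_combination c021
  · linear_combination -c022
  · linear_combination c121
  · linear_combination -c122
  · linear_combination g10

lemma deriv_eq_zero_of_eqOn {V : Set M} {q : M} (hV : IsOpen V) (hq : q ∈ V) {h : M → ℝ} {r : ℝ}
    (e : ∀ x ∈ V, h x = r) (i : Fin 3) : 𝓕.D i h q = 0 := deriv_eq_zero_of_const hV e hq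

include 𝓕 in
lemma isOpen_sep_ne {h : M → ℝ} (hh : SmoothFun h Ω) (r : ℝ) : IsOpen {q ∈ Ω | h q ≠ r} :=
  hh.continuousOn.isOpen_inter_preimage 𝓕.isOpen isOpen_ne

/-- There is no frame with the shape operator of a non-Hopf hypersurface with pseudo-parallel
structure Jacobi operator. -/
theorem eq_empty (h01 : ∀ q ∈ Ω, 𝓕.a 0 1 q ≠ 0) (h02 : ∀ q ∈ Ω, 𝓕.a 0 2 q = 0)
    (h12 : ∀ q ∈ Ω, 𝓕.a 1 2 q = 0) (h00 : ∀ q ∈ Ω, 𝓕.a 0 0 q ≠ 0)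
    (hs : ∀ q ∈ Ω, (𝓕.a 0 0 q * 𝓕.a 2 2 q = 0 ∧ 𝓕.a 0 0 q * 𝓕.a 1 1 q = 𝓕.a 0 1 q ^ 2) ∨
      (𝓕.a 0 0 q * 𝓕.a 2 2 q = -(c / 4) ∧ 𝓕.a 0 0 q * 𝓕.a 1 1 q = 𝓕.a 0 1 q ^ 2 - c / 4)) :
    Ω = ∅ := by
  have hk : c / 4 ≠ 0 := div_ne_zero 𝓕.c_ne four_ne_zero
  have eqs := @structure_equations _ _ _ _ _ _ _ 𝓕 h02 h12
  generalize c / 4 = k at *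
  have sα := 𝓕.smooth_a 0 0
  have sβ := 𝓕.smooth_a 0 1
  have sγ := 𝓕.smooth_a 1 1
  have sμ := 𝓕.smooth_a 2 2
  have sκ₁ := 𝓕.smooth_Γ 1 1 2
  have sκ₂ := 𝓕.smooth_Γ 2 1 2
  have D_sub : ∀ {h₁ h₂ : M → ℝ}, SmoothFun h₁ Ω → SmoothFun h₂ Ω → ∀ {q}, q ∈ Ω → ∀ i,
      𝓕.D i (fun r => h₁ r - h₂ r) q = 𝓕.D i h₁ q - 𝓕.D i h₂ q := fun s₁ s₂ q hq i =>
    deriv_sub (𝓕.E i) (s₁.mdiff 𝓕.isOpen hq) (s₂.mdiff 𝓕.isOpen hq)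
  have sm : ∀ {h₁ h₂ : M → ℝ}, SmoothFun h₁ Ω → SmoothFun h₂ Ω →
    SmoothFun (fun r => h₁ r * h₂ r) Ω := fun s₁ s₂ => s₁.fun_smul s₂
  have dβα : ∀ q ∈ Ω, ∀ i, 𝓕.D i (fun r => 𝓕.a 0 0 r * 𝓕.a 1 1 r - 𝓕.a 0 1 r * 𝓕.a 0 1 r) q =
      𝓕.a 0 0 q * 𝓕.D i (𝓕.a 1 1) q + 𝓕.a 1 1 q * 𝓕.D i (𝓕.a 0 0) q
        - 2 * 𝓕.a 0 1 q * 𝓕.D i (𝓕.a 0 1) q := fun q hq i => by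
    rw [D_sub (sm sα sγ) (sm sβ sβ) hq, 𝓕.D_mul sα sγ hq, 𝓕.D_mul sβ sβ hq]; ring
  -- the alternative `μ = 0` is impossible
  have hs' : ∀ q ∈ Ω, 𝓕.a 0 0 q * 𝓕.a 2 2 q = -k ∧ 𝓕.a 0 0 q * 𝓕.a 1 1 q = 𝓕.a 0 1 q ^ 2 - k := by
    intro q hq
    refine (hs q hq).resolve_left fun h => ?_
    -- The case αμ = 0 could a priori hold at `q` alone. But αμ ≠ −k is an open condition that
    -- excludes the other case, so αγ − β² vanishes near `q` and may be differentiated.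
    have hV := 𝓕.isOpen_sep_ne (sm sα sμ) (-k)
    have hqV : q ∈ {r ∈ Ω | 𝓕.a 0 0 r * 𝓕.a 2 2 r ≠ -k} :=
      ⟨hq, by rw [h.1]; exact (neg_ne_zero.2 hk).symm⟩
    have h2 := 𝓕.deriv_eq_zero_of_eqOn hV hqV
      (h := fun r => 𝓕.a 0 0 r * 𝓕.a 1 1 r - 𝓕.a 0 1 r * 𝓕.a 0 1 r) (r := 0)
      (fun r hr => by
        have := ((hs r hr.1).resolve_right fun h' => hr.2 h'.1).2
        linear_combination this) 2
    rw [dβα q hq] at h2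
    obtain ⟨-, -, e1, e2, e3, -, e4, -, -⟩ := eqs hq rfl rfl rfl rfl rfl rfl rfl
    have hμ := (mul_eq_zero.1 h.1).resolve_left (h00 q hq)
    rw [e2, e3, e4, hμ] at h2
    rw [hμ] at e1
    have hαγ := h.2
    generalize 𝓕.a 0 0 q = α at *
    have hβ := h01 q hq
    generalize 𝓕.a 0 1 q = β at *
    generalize 𝓕.a 1 1 q = γ at *
    generalize 𝓕.Γ 0 1 2 q = κ₀ at *
    generalize 𝓕.Γ 1 1 2 q = κ₁ at *
    have : β * k = 0 := by
      linear_combination (-1/3) * h2 + (1/3) * (κ₁ + 2 * β) * hαγ + (β / 3) * (e1 - hαγ)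
    exact (mul_ne_zero hβ hk) this
  clear hs
  have Dαμ : ∀ q ∈ Ω, ∀ i, 𝓕.a 0 0 q * 𝓕.D i (𝓕.a 2 2) q + 𝓕.a 2 2 q * 𝓕.D i (𝓕.a 0 0) q = 0 := by
    intro q hq i
    rw [← 𝓕.D_mul sα sμ hq]
    exact 𝓕.D_const (fun r hr => (hs' r hr).1) hq i
  have Dαγ : ∀ q ∈ Ω, ∀ i, 𝓕.a 0 0 q * 𝓕.D i (𝓕.a 1 1) q + 𝓕.a 1 1 q * 𝓕.D i (𝓕.a 0 0) q
      - 2 * 𝓕.a 0 1 q * 𝓕.D i (𝓕.a 0 1) q = 0 := by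
    intro q hq i
    rw [← dβα q hq]
    exact 𝓕.D_const (r := -k) (fun r hr => by linear_combination (hs' r hr).2) hq i
  -- the connection coefficients
  have hκ₀ : ∀ q ∈ Ω, 𝓕.Γ 0 1 2 q = -4 * 𝓕.a 0 0 q := by
    intro q hq
    have h2 := Dαγ q hq 2
    obtain ⟨-, -, e1, e2, e3, -, e4, -, -⟩ := eqs hq rfl rfl rfl rfl rfl rfl rfl
    rw [e2, e3, e4] at h2
    obtain ⟨h3, h4⟩ := hs' q hq
    have hβ := h01 q hq
    generalize 𝓕.a 0 0 q = α at *
    generalize 𝓕.a 0 1 q = β at *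
    generalize 𝓕.a 1 1 q = γ at *
    generalize 𝓕.a 2 2 q = μ at *
    generalize 𝓕.Γ 0 1 2 q = κ₀ at *
    generalize 𝓕.Γ 1 1 2 q = κ₁ at *
    have : β * k * (κ₀ + 4 * α) = 0 := by
      linear_combination (-α) * (h2 - κ₁ * (h4 - h3) - β * e1 - β * h4) + β * κ₀ * h3
    have := (mul_eq_zero.1 this).resolve_left (mul_ne_zero hβ hk)
    linear_combination this
  -- Kept as a formula for βκ₁, without division, since it is differentiated along ξ below.
  have hκ₁ : ∀ q ∈ Ω, 𝓕.a 0 1 q * 𝓕.Γ 1 1 2 q =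
      𝓕.a 1 1 q * 𝓕.a 2 2 q - 4 * (𝓕.a 0 1 q * 𝓕.a 0 1 q) := by
    intro q hq
    obtain ⟨-, -, e1, -⟩ := eqs hq rfl rfl rfl rfl rfl rfl rfl
    obtain ⟨h3, h4⟩ := hs' q hq
    rw [hκ₀ q hq] at e1
    linear_combination e1 - 5 * h4 + 4 * h3
  have D2α : ∀ q ∈ Ω, 𝓕.D 2 (𝓕.a 0 0) q = -3 * 𝓕.a 0 1 q * (𝓕.a 0 0 q + 𝓕.a 2 2 q) := by
    intro q hq
    obtain ⟨-, -, -, e2, -⟩ := eqs hq rfl rfl rfl rfl rfl rfl rfl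
    rw [e2, hκ₀ q hq]; ring
  have D2β : ∀ q ∈ Ω, 𝓕.D 2 (𝓕.a 0 1) q = -3 * 𝓕.a 0 1 q ^ 2 - 𝓕.a 1 1 q * 𝓕.a 2 2 q := by
    intro q hq
    obtain ⟨-, -, -, -, e3, -⟩ := eqs hq rfl rfl rfl rfl rfl rfl rfl
    obtain ⟨h3, h4⟩ := hs' q hq
    rw [e3, hκ₀ q hq]
    linear_combination 5 * h3 - 4 * h4
  have D0α : ∀ q ∈ Ω, k * 𝓕.D 0 (𝓕.a 0 0) q =
      𝓕.a 0 0 q ^ 2 * 𝓕.a 0 1 q * 𝓕.Γ 2 1 2 q := by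
    intro q hq
    obtain ⟨-, -, -, -, -, e5, -⟩ := eqs hq rfl rfl rfl rfl rfl rfl rfl
    have h2 := Dαμ q hq 0
    rw [e5] at h2
    linear_combination (-𝓕.a 0 0 q) * h2 + 𝓕.D 0 (𝓕.a 0 0) q * (hs' q hq).1
  have D1α : ∀ q ∈ Ω, k * 𝓕.D 1 (𝓕.a 0 0) q =
      𝓕.a 0 0 q * 𝓕.a 0 1 q ^ 2 * 𝓕.Γ 2 1 2 q := by
    intro q hq
    obtain ⟨-, -, -, -, -, -, -, e7, -⟩ := eqs hq rfl rfl rfl rfl rfl rfl rfl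
    obtain ⟨h3, h4⟩ := hs' q hq
    have h2 := Dαμ q hq 1
    rw [e7] at h2
    linear_combination (-𝓕.a 0 0 q) * h2 + 𝓕.D 1 (𝓕.a 0 0) q * h3
      + 𝓕.a 0 0 q * 𝓕.Γ 2 1 2 q * (h4 - h3)
  have D0β : ∀ q ∈ Ω, k * 𝓕.D 0 (𝓕.a 0 1) q =
      𝓕.a 0 0 q * 𝓕.a 0 1 q ^ 2 * 𝓕.Γ 2 1 2 q := fun q hq => by
    rw [← D1α q hq, (eqs hq rfl rfl rfl rfl rfl rfl rfl).1]
  have D0γ : ∀ q ∈ Ω, k * 𝓕.D 0 (𝓕.a 1 1) q =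
      𝓕.a 0 1 q * (𝓕.a 0 1 q ^ 2 + k) * 𝓕.Γ 2 1 2 q := by
    intro q hq
    obtain ⟨h3, h4⟩ := hs' q hq
    apply mul_left_cancel₀ (h00 q hq)
    linear_combination k * Dαγ q hq 0 + 2 * 𝓕.a 0 1 q * D0β q hq - 𝓕.a 1 1 q * D0α q hq
      - 𝓕.a 0 0 q * 𝓕.a 0 1 q * 𝓕.Γ 2 1 2 q * h4
  have D1β : ∀ q ∈ Ω, k * 𝓕.D 1 (𝓕.a 0 1) q =
      𝓕.a 0 1 q * (𝓕.a 0 1 q ^ 2 + k) * 𝓕.Γ 2 1 2 q := fun q hq => by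
    rw [← D0γ q hq, (eqs hq rfl rfl rfl rfl rfl rfl rfl).2.1]
  -- the Gauss equation
  have gauss : ∀ q ∈ Ω, 𝓕.Γ 2 1 2 q *
      (𝓕.a 0 1 q * 𝓕.a 0 1 q + 2 * (𝓕.a 0 0 q * 𝓕.a 0 0 q) - 2 * k) = 0 := by
    intro q hq
    obtain ⟨-, -, -, -, -, e5, -, -, e8⟩ := eqs hq rfl rfl rfl rfl rfl rfl rfl
    obtain ⟨h3, h4⟩ := hs' q hq
    -- The Gauss equation contains DUκ₀ and Dξκ₁. They are computed by differentiating κ₀ = −4α and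
    -- the formula for βκ₁; the latter gives Dξκ₁ only up to the factor β, removed at the end.
    have h5 : 𝓕.D 1 (𝓕.Γ 0 1 2) q = -4 * 𝓕.D 1 (𝓕.a 0 0) q := by
      rw [𝓕.D_congr hκ₀ hq, 𝓕.D_mul (SmoothFun.const (-4)) sα hq, 𝓕.D_const (fun _ _ => rfl) hq]
      ring
    have h6 : 𝓕.a 0 1 q * 𝓕.D 0 (𝓕.Γ 1 1 2) q + 𝓕.Γ 1 1 2 q * 𝓕.D 0 (𝓕.a 0 1) q =
        𝓕.a 1 1 q * 𝓕.D 0 (𝓕.a 2 2) q + 𝓕.a 2 2 q * 𝓕.D 0 (𝓕.a 1 1) q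
          - 8 * 𝓕.a 0 1 q * 𝓕.D 0 (𝓕.a 0 1) q := by
      rw [← 𝓕.D_mul sβ sκ₁ hq, 𝓕.D_congr hκ₁ hq,
        D_sub (sm sγ sμ) (sm (SmoothFun.const 4) (sm sβ sβ)) hq, 𝓕.D_mul sγ sμ hq,
        𝓕.D_mul (SmoothFun.const 4) (sm sβ sβ) hq, 𝓕.D_mul sβ sβ hq,
        𝓕.D_const (h := fun _ => (4 : ℝ)) (fun _ _ => rfl) hq]
      ring
    rw [h5, hκ₀ q hq] at e8
    rw [e5] at h6
    have d1 := D1α q hq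
    have d2 := D0β q hq
    have d3 := D0γ q hq
    have h7 := hκ₁ q hq
    have hβ := h01 q hq
    have hα := h00 q hq
    generalize 𝓕.D 0 (𝓕.Γ 1 1 2) q = x at *
    generalize 𝓕.D 1 (𝓕.a 0 0) q = x₁ at *
    generalize 𝓕.D 0 (𝓕.a 0 1) q = x₂ at *
    generalize 𝓕.D 0 (𝓕.a 1 1) q = x₃ at *
    generalize 𝓕.a 0 0 q = α at *
    generalize 𝓕.a 0 1 q = β at *
    generalize 𝓕.a 1 1 q = γ at *
    generalize 𝓕.a 2 2 q = μ at *
    generalize 𝓕.Γ 1 1 2 q = κ₁ at *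
    generalize 𝓕.Γ 2 1 2 q = κ₂ at *
    have : (-2 * k * β) * (κ₂ * (β * β + 2 * (α * α) - 2 * k)) = 0 := by
      linear_combination α * β * k * e8 + k * α * h6
        - α * (-4 * β * d1 + κ₁ * d2 - μ * d3 + 8 * β * d2) - α ^ 2 * β * κ₂ * h7
        - κ₂ * β * (-2 * k * h4 + α * μ * h4 - 2 * k * h3)
    exact (mul_eq_zero.1 this).resolve_left (by simp [hk, hβ])
  have hκ₂ : ∀ q ∈ Ω, 𝓕.Γ 2 1 2 q = 0 := by
    intro q hq
    by_contra hne
    have hV := 𝓕.isOpen_sep_ne sκ₂ 0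
    -- Where κ₂ ≠ 0, the function β² + 2α² is constant. Its ξ-derivative, computed from `D0α` and
    -- `D0β`, is a nonzero multiple of κ₂.
    have h2 : 𝓕.D 0 (fun r => 𝓕.a 0 1 r * 𝓕.a 0 1 r - -2 * (𝓕.a 0 0 r * 𝓕.a 0 0 r)) q = 0 :=
      𝓕.deriv_eq_zero_of_eqOn hV ⟨hq, hne⟩ (r := 2 * k) (fun r hr => by
        linear_combination (mul_eq_zero.1 (gauss r hr.1)).resolve_left hr.2) 0
    rw [D_sub (sm sβ sβ) (sm (SmoothFun.const (-2)) (sm sα sα)) hq, 𝓕.D_mul sβ sβ hq,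
      𝓕.D_mul (SmoothFun.const (-2)) (sm sα sα) hq, 𝓕.D_mul sα sα hq,
      𝓕.D_const (h := fun _ => (-2 : ℝ)) (fun _ _ => rfl) hq] at h2
    have h3 := (mul_eq_zero.1 (gauss q hq)).resolve_left hne
    have : 4 * (k * 𝓕.a 0 0 q * 𝓕.a 0 1 q * 𝓕.Γ 2 1 2 q) = 0 := by
      linear_combination k * h2 - 2 * 𝓕.a 0 1 q * D0β q hq - 4 * 𝓕.a 0 0 q * D0α q hq
        - 2 * 𝓕.a 0 0 q * 𝓕.a 0 1 q * 𝓕.Γ 2 1 2 q * h3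
    simp [hk, h00 q hq, h01 q hq, hne] at this
  -- derivatives along `ξ` and `U` vanish
  have zero : ∀ {h : M → ℝ}, SmoothFun h Ω → (∀ q ∈ Ω, 𝓕.D 0 h q = 0) → (∀ q ∈ Ω, 𝓕.D 1 h q = 0) →
      ∀ q ∈ Ω, (𝓕.a 1 1 q + 4 * 𝓕.a 0 0 q) * 𝓕.D 2 h q = 0 := by
    intro h hh h0 h1 q hq
    -- A function annihilated by ξ and U is annihilated by [U, ξ], whose JU-component is Γ₁₀₂ − Γ₀₁₂
    -- = γ + 4α.
    have := 𝓕.D_comm hq hh 1 0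
    rw [𝓕.D_const h0 hq, 𝓕.D_const h1 hq, Fin.sum_univ_three, h0 q hq, h1 q hq,
      𝓕.Γ_one_zero hq, 𝓕.Γ_self hq, 𝓕.Γ_zero_two hq, hκ₀ q hq, 𝓕.Γ_zero_one hq] at this
    linear_combination -this
  have cancel : ∀ {x y : ℝ}, k * x = y * 0 → x = 0 := fun h =>
    (mul_eq_zero.1 (h.trans (mul_zero _))).resolve_left hk
  have zα := zero sα (fun q hq => cancel ((D0α q hq).trans (by rw [hκ₂ q hq])))
    (fun q hq => cancel ((D1α q hq).trans (by rw [hκ₂ q hq])))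
  have zβ := zero sβ (fun q hq => cancel ((D0β q hq).trans (by rw [hκ₂ q hq])))
    (fun q hq => cancel ((D1β q hq).trans (by rw [hκ₂ q hq])))
  have hγ : ∀ q ∈ Ω, 𝓕.a 1 1 q = -4 * 𝓕.a 0 0 q := by
    intro q hq
    by_contra hne
    have hne' : 𝓕.a 1 1 q + 4 * 𝓕.a 0 0 q ≠ 0 := fun h => hne (by linear_combination h)
    have h1 := (mul_eq_zero.1 (zα q hq)).resolve_left hne'
    have h2 := (mul_eq_zero.1 (zβ q hq)).resolve_left hne'
    rw [D2α q hq] at h1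
    rw [D2β q hq] at h2
    -- If α and β also have zero JU-derivative, then α + μ = 0, so k = α² > 0, and 3β² + γμ = 0
    -- becomes 2β² + k = 0.
    obtain ⟨h3, h4⟩ := hs' q hq
    have h5 := (mul_eq_zero.1 h1).resolve_left (mul_ne_zero (by norm_num) (h01 q hq))
    have h6 : k = 𝓕.a 0 0 q ^ 2 := by linear_combination h3 - 𝓕.a 0 0 q * h5
    have h7 : k * (2 * 𝓕.a 0 1 q ^ 2 + k) = 0 := by
      linear_combination (-𝓕.a 0 0 q ^ 2) * h2 + 3 * 𝓕.a 0 1 q ^ 2 * h6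
        - 𝓕.a 0 0 q * 𝓕.a 2 2 q * h4 - (𝓕.a 0 1 q ^ 2 - k) * h3
    have h8 := (mul_eq_zero.1 h7).resolve_left hk
    have h9 := sq_pos_of_ne_zero (h00 q hq)
    nlinarith [sq_nonneg (𝓕.a 0 1 q)]
  by_contra hne
  obtain ⟨q, hq⟩ := Set.nonempty_iff_ne_empty.2 hne
  -- With γ = −4α, the relation αγ = β² − k says that β² + 4α² is the constant k; its JU-derivative
  -- equals 10βk.
  have h1 : 𝓕.D 2 (fun r => 𝓕.a 0 1 r * 𝓕.a 0 1 r - -4 * (𝓕.a 0 0 r * 𝓕.a 0 0 r)) q = 0 :=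
    𝓕.D_const (r := k) (fun r hr => by
      have := (hs' r hr).2
      rw [hγ r hr] at this
      linear_combination -this) hq 2
  rw [D_sub (sm sβ sβ) (sm (SmoothFun.const (-4)) (sm sα sα)) hq, 𝓕.D_mul sβ sβ hq,
    𝓕.D_mul (SmoothFun.const (-4)) (sm sα sα) hq, 𝓕.D_mul sα sα hq,
    𝓕.D_const (h := fun _ => (-4 : ℝ)) (fun _ _ => rfl) hq, D2α q hq, D2β q hq, hγ q hq] at h1
  obtain ⟨h3, h4⟩ := hs' q hq
  rw [hγ q hq] at h4
  have : 10 * (𝓕.a 0 1 q * k) = 0 := by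
    linear_combination h1 + 16 * 𝓕.a 0 1 q * h3 - 6 * 𝓕.a 0 1 q * h4
  simp [hk, h01 q hq] at this

end AdaptedFrame
end RealHypersurface

theorem RealHypersurface.isHopf_of_pseudoParallel {c : ℝ} {M : Type*} [TopologicalSpace M]
    [ChartedSpace (EuclideanSpace ℝ (Fin 3)) M] [IsManifold (𝓡 3) ∞ M] (hc : c ≠ 0)
    (S : RealHypersurface c M) (hS : S.PseudoParallelStructureJacobi) : S.IsHopf := by
  obtain ⟨Ω, 𝓕, h0, h1, h2⟩ := S.exists_adaptedFrame hc
  have key : ∀ q ∈ Ω, 𝓕.a 1 2 q = 0 ∧ 𝓕.a 0 0 q ≠ 0 ∧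
      ((𝓕.a 0 0 q * 𝓕.a 2 2 q = 0 ∧ 𝓕.a 0 0 q * 𝓕.a 1 1 q = 𝓕.a 0 1 q ^ 2) ∨
      (𝓕.a 0 0 q * 𝓕.a 2 2 q = -(c / 4) ∧
        𝓕.a 0 0 q * 𝓕.a 1 1 q = 𝓕.a 0 1 q ^ 2 - c / 4)) := by
    intro q hq
    obtain ⟨L, hL⟩ := 𝓕.pseudoParallel hq h0 hS
    have hA : 𝓕.shape q = !![𝓕.a 0 0 q, 𝓕.a 0 1 q, 0; 𝓕.a 0 1 q, 𝓕.a 1 1 q, 𝓕.a 1 2 q;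
        0, 𝓕.a 1 2 q, 𝓕.a 2 2 q] := by
      have e := (h1 q hq).2
      ext i j
      fin_cases i <;> fin_cases j <;>
        simp [AdaptedFrame.shape, e, 𝓕.a_symm hq 1 0, 𝓕.a_symm hq 2 0, 𝓕.a_symm hq 2 1]
    rw [hA] at hL
    exact hL.shape (div_ne_zero hc four_ne_zero) (h1 q hq).1
  exact h2 (𝓕.eq_empty (fun q hq => (h1 q hq).1) (fun q hq => (h1 q hq).2)
    (fun q hq => (key q hq).1) (fun q hq => (key q hq).2.1) (fun q hq => (key q hq).2.2))

end

theorem proposition4p4 {M : Type*} [TopologicalSpace M]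
    [ChartedSpace (EuclideanSpace ℝ (Fin 3)) M] [IsManifold (𝓡 3) ∞ M]
    [T2Space M] [SecondCountableTopology M] [ConnectedSpace M]
    (c : ℝ) (hc : c ≠ 0) (S : RealHypersurface c M)
    (hS : S.PseudoParallelStructureJacobi) : S.IsHopf := by
  exact S.isHopf_of_pseudoParallel hc hS
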